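/- **Setting.** Let $K$ Markov decision processes (tasks) share a state space $\mathcal S$, an action space $\mathcal A$ and a discount factor $\gamma\in[0,1)$; task $k$ has transition kernel $P_k$, initial distribution $\xi_0^k$ and reward $r_k:\mathcal S\times\mathcal A\to[0,1]$. Let $\pi_\theta(a|s)>0$, $\theta\in\mathbb R^p$, be a parameterized policy (probability densities with respect to a fixed reference measure on $\mathcal A$), $\psi_\theta(s,a)=\nabla_\theta\log\pi_\theta(a|s)$, and $\phi^k:\mathcal S\times\mathcal A\to\mathbb R^q$ feature maps. Let $J^k(\theta)=\mathbb E[\sum_{t\ge0}\gamma^t r_k(s_t,a_t)]$ ($s_0\sim\xi^k_0$), $Q^k_\theta$ the action-value function, $d^k_\theta=(1-\gamma)\sum_{t\ge 0}\gamma^t\,\mathbb P(s_t,a_t\in\cdot\mid s_0\sim\xi_0^k,\pi_\theta,P_k)$ the visitation distribution, and $\Lambda$ the probability simplex in $\mathbb R^K$. For $\lambda\in\Lambda$ put $\lambda^\top\nabla J(\theta)=\sum_k\lambda^k\nabla J^k(\theta)$, and let $\lambda^*_\theta\in\arg\min_{\lambda\in\Lambda}\|\lambda^\top\nabla J(\theta)\|^2$,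 $\lambda_t^*=\lambda^*_{\theta_t}$. Let $L_J$ be the least common Lipschitz constant of the gradients $\nabla J^k$. **Assumptions.** (1) $\log\pi_\theta(a|s)$ is differentiable in $\theta$, $\|\psi_\theta\|\le C_\phi$, $\|\phi^k\|\le C_\phi$, and $\|\psi_\theta(s,a)-\psi_{\theta'}(s,a)\|\le L_\phi\|\theta-\theta'\|$. (2) If the critic samples along trajectories (see below): there are $m>0$, $\rho\in(0,1)$ with $\sup_s\|\mathbb P((s_t,a_t)\in\cdot\mid s_0=s,\pi_\theta,P_k)-d_\theta^k\|_{TV}\le m\rho^t$ for all $t,k,\theta$. (3) With $(s,a)\sim d^k_\theta$, $s'\sim P_k(\cdot|s,a)$, $a'\sim\pi_\theta(\cdot|s')$, the matrices $A^k_\theta=\mathbb E[\phi^k(s,a)(\gamma\phi^k(s',a')-\phi^k(s,a))^\top]$ satisfy $x^\top A^k_\theta x\le-\lambda_A\|x\|^2$ with $\lambda_A>0$ for all $x,k,\theta$. (4) The TD limits $w^{*k}_\theta$, defined by $A^k_\theta w^{*k}_\theta+\mathbb E_{d_\theta^k}[\phi^kr_k]=0$, satisfy $\|w^{*k}_\theta\|\le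 B$. Let $\epsilon_{\rm app}=\sup_{\theta,k}\big(\mathbb E_{d^k_\theta}[(\phi^k(s,a)^\top w^{*k}_\theta-Q^k_\theta(s,a))^2]\big)^{1/2}$. **Algorithm (MTAC-FC).** Start from $\theta_0$, $w_0$, $\lambda_0\in\Lambda$. In iteration $t$, independently for each task, the critic runs $N_{\rm critic}$ projected TD(0) steps warm-started at $w_t^k$, $$w\leftarrow \mathcal T_B\big(w+\alpha_{t,j}\,[r_k(s_j,a_j)+\gamma\phi^k(s_j',a_j')^\top w-\phi^k(s_j,a_j)^\top w]\,\phi^k(s_j,a_j)\big),\qquad \alpha_{t,j}=\frac1{2\lambda_A(j+1)},$$ with output $w_{t+1}^k$, where $\mathcal T_B$ projects onto $\{\|w\|\le B\}$, $s_j'\sim P_k(\cdot|s_j,a_j)$, $a_j'\sim\pi_{\theta_t}(\cdot|s_j')$, and the pairs $(s_j,a_j)$ come either from one trajectory ($(s_0,a_0)\sim d^k_{\theta_t}$, $(s_{j+1},a_{j+1})=(s_j',a_j')$) or from independent draws $(s_j,a_j)\sim d^k_{\theta_t}$. For a batch of $N$ independent draws $(s_i^k,a_i^k)\sim d^k_{\theta_t}$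 for every $k$ the gradient estimate has rows $\frac1N\sum_i\phi^k(s_i^k,a_i^k)^\top w_{t+1}^k\,\psi_{\theta_t}(s_i^k,a_i^k)$. With the estimates $\bar\nabla J,\bar\nabla J'$ from two independent batches of size $N_{\rm FC}$ and $\widetilde\nabla J$ from a third one of size $N_{\rm actor}$, $$\lambda_{t+1}=\mathcal T_\Lambda\big(\lambda_t-c'\,\lambda_t^\top\bar\nabla J(\bar\nabla J')^\top\big),\qquad \theta_{t+1}=\theta_t+\beta\,\lambda_t^\top\widetilde\nabla J,$$ where $\mathcal T_\Lambda$ is the projection onto $\Lambda$. **Theorem.** Each $J^k$ is differentiable with Lipschitz gradient. There is a constant $C$, depending only on $K,\gamma,C_\phi,L_\phi,B,\lambda_A,m,\rho$, such that for all constant steps $0<\beta\le 1/L_J$ and $0<c'\le \frac1{8KC_\phi^4B^2}$, all $T,N_{\rm critic},N_{\rm actor},N_{\rm FC}\ge1$ and all initial values, $$\frac1T\sum_{t=0}^{T-1}\mathbb E\big[\|(\lambda_t^*)^\top\nabla J(\theta_t)\|^2\big]\le C\Big(\frac1{\beta T}+\frac1{c'T}+\epsilon_{\rm app}+\frac1{\sqrt{N_{\rm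 critic}}}+\frac{\beta}{N_{\rm actor}}+\frac{c'}{N_{\rm FC}}\Big).$$ -/

import Mathlib

open MeasureTheory ProbabilityTheory

namespace MTAC

/-- `ℝⁿ` with the Euclidean norm. -/
abbrev Vec (n : ℕ) : Type := EuclideanSpace ℝ (Fin n)

/-- `K` Markov decision processes with the same state space `S` and action space `A`:
transition kernels `P_k`, initial distributions `ξ_0^k`, rewards `r_k` with values in `[0, 1]`.
The discount factor is a separate argument. -/
structure MultiTaskMDP (K : ℕ) (S A : Type*) [MeasurableSpace S] [MeasurableSpace A] where
  trans : Fin K → Kernel (S × A) S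
  trans_markov : ∀ k, IsMarkovKernel (trans k)
  init : Fin K → Measure S
  init_prob : ∀ k, IsProbabilityMeasure (init k)
  reward : Fin K → S × A → ℝ
  reward_measurable : ∀ k, Measurable (reward k)
  reward_mem : ∀ k x, reward k x ∈ Set.Icc (0 : ℝ) 1

/-- A policy class `π_θ(a | s)`, `θ ∈ ℝᵖ`, given by positive probability densities with respect to
a reference measure on the actions (the counting measure when `A` is finite). -/
structure PolicyClass (p : ℕ) (S A : Type*) [MeasurableSpace S] [MeasurableSpace A] where
  base : Measure A
  base_sigmaFinite : SigmaFinite base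
  dens : Vec p → S → A → ℝ
  dens_pos : ∀ θ s a, 0 < dens θ s a
  dens_measurable : Measurable fun z : Vec p × S × A => dens z.1 z.2.1 z.2.2
  dens_total : ∀ θ s, ∫⁻ a, ENNReal.ofReal (dens θ s a) ∂base = 1

/-- How the critic obtains the state-action pairs `(s_j, a_j)` of its TD transitions.
* `trajectory`: `(s_0, a_0)` is drawn from the visitation distribution, and then one trajectory is
  followed, the pair `(s_{j+1}, a_{j+1})` observed in step `j` being the start of step `j + 1`;
* `independent`: every `(s_j, a_j)` is a fresh draw from the visitation distribution. -/
inductive CriticSampling where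
  | trajectory
  | independent

/-- Euclidean projection onto a (nonempty closed convex) set: the point of `C` closest to `v`. -/
noncomputable def proj {n : ℕ} (C : Set (Vec n)) (v : Vec n) : Vec n :=
  Classical.epsilon fun u => u ∈ C ∧ ∀ u' ∈ C, ‖v - u‖ ≤ ‖v - u'‖

/-- The probability simplex over the `K` tasks. -/
def simplex (K : ℕ) : Set (Vec K) :=
  {l | (∀ k, 0 ≤ l k) ∧ ∑ k, l k = 1}

section Model

variable {K p q : ℕ} {S A : Type*} [MeasurableSpace S] [MeasurableSpace A]

/-- The policy `π_θ` as a kernel. -/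
noncomputable def policyKernel (pol : PolicyClass p S A) (θ : Vec p) : Kernel S A :=
  haveI := pol.base_sigmaFinite
  Kernel.withDensity (Kernel.const S pol.base) fun s a => ENNReal.ofReal (pol.dens θ s a)

/-- The score function `ψ_θ(s, a) = ∇_θ log π_θ(a | s)`. -/
noncomputable def score (pol : PolicyClass p S A) (θ : Vec p) (x : S × A) : Vec p :=
  gradient (fun θ' => Real.log (pol.dens θ' x.1 x.2)) θ

/-- From a state `s`, the law of `(s, a)` with `a ∼ π_θ(· | s)`. -/
noncomputable def actKernel (pol : PolicyClass p S A) (θ : Vec p) : Kernel S (S × A) :=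
  Kernel.id ×ₖ policyKernel pol θ

/-- One step `(s, a) ↦ (s', a')`, `s' ∼ P_k(· | s, a)`, `a' ∼ π_θ(· | s')`. -/
noncomputable def chain (M : MultiTaskMDP K S A) (pol : PolicyClass p S A) (k : Fin K)
    (θ : Vec p) : Kernel (S × A) (S × A) :=
  actKernel pol θ ∘ₖ M.trans k

/-- The law of `(s_t, a_t)` given `(s_0, a_0)`. -/
noncomputable def chainIter (M : MultiTaskMDP K S A) (pol : PolicyClass p S A) (k : Fin K)
    (θ : Vec p) : ℕ → Kernel (S × A) (S × A)
  | 0 => Kernel.id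
  | t + 1 => chain M pol k θ ∘ₖ chainIter M pol k θ t

/-- The law of `(s_t, a_t)` given `s_0`, under `π_θ` and `P_k`. -/
noncomputable def lawFromState (M : MultiTaskMDP K S A) (pol : PolicyClass p S A) (k : Fin K)
    (θ : Vec p) (t : ℕ) : Kernel S (S × A) :=
  chainIter M pol k θ t ∘ₖ actKernel pol θ

/-- The law of `(s_t, a_t)` when `s_0 ∼ ξ_0^k`. -/
noncomputable def lawAt (M : MultiTaskMDP K S A) (pol : PolicyClass p S A) (k : Fin K)
    (θ : Vec p) (t : ℕ) : Measure (S × A) :=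
  (M.init k).bind (lawFromState M pol k θ t)

/-- The discounted visitation distribution `d_θ^k`. -/
noncomputable def visitation (γ : ℝ) (M : MultiTaskMDP K S A) (pol : PolicyClass p S A)
    (k : Fin K) (θ : Vec p) : Measure (S × A) :=
  Measure.sum fun t : ℕ => ENNReal.ofReal ((1 - γ) * γ ^ t) • lawAt M pol k θ t

/-- The objective `J^k(θ)`, the expected total discounted reward. -/
noncomputable def J (γ : ℝ) (M : MultiTaskMDP K S A) (pol : PolicyClass p S A) (k : Fin K)
    (θ : Vec p) : ℝ :=
  ∑' t : ℕ, γ ^ t * ∫ x, M.reward k x ∂(lawAt M pol k θ t)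

/-- The action-value function `Q^k_{π_θ}`. -/
noncomputable def Q (γ : ℝ) (M : MultiTaskMDP K S A) (pol : PolicyClass p S A) (k : Fin K)
    (θ : Vec p) (x : S × A) : ℝ :=
  ∑' t : ℕ, γ ^ t * ∫ y, M.reward k y ∂(chainIter M pol k θ t x)

/-- `L_J`: the (least common) Lipschitz constant of the gradients `∇J^k`. -/
noncomputable def gradLip (γ : ℝ) (M : MultiTaskMDP K S A) (pol : PolicyClass p S A) : ℝ :=
  sInf {L : ℝ | 0 ≤ L ∧ ∀ k θ θ',
    ‖gradient (J γ M pol k) θ - gradient (J γ M pol k) θ'‖ ≤ L * ‖θ - θ'‖}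

/-- The weighted combination `λᵀ ∇J(θ) = ∑_k λ^k ∇J^k(θ)`. -/
noncomputable def weightedGrad (γ : ℝ) (M : MultiTaskMDP K S A) (pol : PolicyClass p S A)
    (l : Vec K) (θ : Vec p) : Vec p :=
  ∑ k, l k • gradient (J γ M pol k) θ

/-- Smoothness and boundedness: `log π_θ(a | s)` is differentiable in `θ`, the score and the
features are bounded by `Cφ`, and the score is `Lφ`-Lipschitz in `θ`. -/
def SmoothBounded (pol : PolicyClass p S A) (φ : Fin K → S × A → Vec q) (Cφ Lφ : ℝ) : Prop :=
  (∀ s a, Differentiable ℝ fun θ => Real.log (pol.dens θ s a)) ∧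
  (∀ θ x, ‖score pol θ x‖ ≤ Cφ) ∧
  (∀ k x, ‖φ k x‖ ≤ Cφ) ∧
  (∀ θ θ' x, ‖score pol θ x - score pol θ' x‖ ≤ Lφ * ‖θ - θ'‖)

/-- Uniform ergodicity: the total variation distance between the law of `(s_t, a_t)` given
`s_0 = s` and `d_θ^k` is at most `m ρ^t`, uniformly in `s`. -/
def UniformlyErgodic (γ : ℝ) (M : MultiTaskMDP K S A) (pol : PolicyClass p S A)
    (m ρ : ℝ) : Prop :=
  ∀ k θ s t, ∀ E : Set (S × A), MeasurableSet E →
    |(lawFromState M pol k θ t s).real E - (visitation γ M pol k θ).real E| ≤ m * ρ ^ t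

/-- The law of a transition `((s, a), (s', a'))` with `(s, a) ∼ d_θ^k`, `s' ∼ P_k(· | s, a)`,
`a' ∼ π_θ(· | s')`. -/
noncomputable def transitionLaw (γ : ℝ) (M : MultiTaskMDP K S A) (pol : PolicyClass p S A)
    (k : Fin K) (θ : Vec p) : Measure ((S × A) × (S × A)) :=
  visitation γ M pol k θ ⊗ₘ chain M pol k θ

/-- The matrix `A^k_{π_θ} = E[φ(s, a) (γ φ(s', a') - φ(s, a))ᵀ]`. -/
noncomputable def tdMatrix (γ : ℝ) (M : MultiTaskMDP K S A) (pol : PolicyClass p S A)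
    (φ : Fin K → S × A → Vec q) (k : Fin K) (θ : Vec p) : Matrix (Fin q) (Fin q) ℝ :=
  Matrix.of fun i j =>
    ∫ z, φ k z.1 i * (γ * φ k z.2 j - φ k z.1 j) ∂(transitionLaw γ M pol k θ)

/-- The vector `b^k_{π_θ} = E[φ(s, a) r_k(s, a)]`. -/
noncomputable def tdVector (γ : ℝ) (M : MultiTaskMDP K S A) (pol : PolicyClass p S A)
    (φ : Fin K → S × A → Vec q) (k : Fin K) (θ : Vec p) : Fin q → ℝ :=
  fun i => ∫ x, φ k x i * M.reward k x ∂(visitation γ M pol k θ)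

/-- Solvability: `A^k_{π_θ}` is negative definite, with `xᵀ A x ≤ -λ_A ‖x‖²`, for all `θ`, `k`. -/
def Solvable (γ : ℝ) (M : MultiTaskMDP K S A) (pol : PolicyClass p S A)
    (φ : Fin K → S × A → Vec q) (lamA : ℝ) : Prop :=
  ∀ k θ (x : Fin q → ℝ), x ⬝ᵥ (tdMatrix γ M pol φ k θ).mulVec x ≤ -lamA * (x ⬝ᵥ x)

/-- The TD limiting point `w_θ^{*k}`, the solution of `A w + b = 0`. -/
noncomputable def tdLimit (γ : ℝ) (M : MultiTaskMDP K S A) (pol : PolicyClass p S A)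
    (φ : Fin K → S × A → Vec q) (k : Fin K) (θ : Vec p) : Vec q :=
  WithLp.toLp 2 (-((tdMatrix γ M pol φ k θ)⁻¹.mulVec (tdVector γ M pol φ k θ)))

/-- The function approximation error `ε_app`. -/
noncomputable def epsApp (γ : ℝ) (M : MultiTaskMDP K S A) (pol : PolicyClass p S A)
    (φ : Fin K → S × A → Vec q) : ℝ :=
  ⨆ i : Vec p × Fin K, Real.sqrt (∫ x,
    (inner ℝ (φ i.2 x) (tdLimit γ M pol φ i.2 i.1) - Q γ M pol i.2 i.1 x) ^ 2
      ∂(visitation γ M pol i.2 i.1))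

/-! ### The algorithm -/

/-- The projected TD(0) update of step `j`, from `x = (s_j, a_j)` and `y = (s_{j+1}, a_{j+1})`,
with step size `1 / (2 λ_A (j + 1))`. -/
noncomputable def tdUpdate (γ B lamA : ℝ) (M : MultiTaskMDP K S A) (φ : Fin K → S × A → Vec q)
    (k : Fin K) (j : ℕ) (w : Vec q) (x y : S × A) : Vec q :=
  proj (Metric.closedBall 0 B)
    (w + (1 / (2 * lamA * (j + 1)) *
      (M.reward k x + γ * inner ℝ (φ k y) w - inner ℝ (φ k x) w)) • φ k x)

/-- The law of `(w_{j+1}, (s_{j+1}, a_{j+1}))` given `(w_j, (s_j, a_j))`. -/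
noncomputable def criticStep (γ B lamA : ℝ) (M : MultiTaskMDP K S A) (pol : PolicyClass p S A)
    (φ : Fin K → S × A → Vec q) (k : Fin K) (θ : Vec p) (j : ℕ) (v : Vec q × (S × A)) :
    CriticSampling → Measure (Vec q × (S × A))
  | .trajectory => (chain M pol k θ v.2).map fun y =>
      (tdUpdate γ B lamA M φ k j v.1 v.2 y, y)
  | .independent => ((chain M pol k θ v.2).prod (visitation γ M pol k θ)).map fun y =>
      (tdUpdate γ B lamA M φ k j v.1 v.2 y.1, y.2)

/-- The law of `(w_j, (s_j, a_j))` in the critic loop for task `k` started at `w_0 = w`. -/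
noncomputable def criticLaw (γ B lamA : ℝ) (M : MultiTaskMDP K S A) (pol : PolicyClass p S A)
    (φ : Fin K → S × A → Vec q) (mode : CriticSampling) (k : Fin K) (θ : Vec p) (w : Vec q) :
    ℕ → Measure (Vec q × (S × A))
  | 0 => (visitation γ M pol k θ).map fun x => (w, x)
  | j + 1 => (criticLaw γ B lamA M pol φ mode k θ w j).bind fun v =>
      criticStep γ B lamA M pol φ k θ j v mode

/-- `N` independent samples for every task `k`, each from `d_θ^k`. -/
noncomputable def batchLaw (γ : ℝ) (M : MultiTaskMDP K S A) (pol : PolicyClass p S A)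
    (θ : Vec p) (N : ℕ) : Measure (Fin N → Fin K → S × A) :=
  Measure.pi fun _ => Measure.pi fun k => visitation γ M pol k θ

/-- The averaged gradient estimate `(1/N) ∑_i (φ^k(s_i^k, a_i^k)ᵀ w^k) ψ_θ(s_i^k, a_i^k)`. -/
noncomputable def gradEst (pol : PolicyClass p S A) (φ : Fin K → S × A → Vec q) (θ : Vec p)
    (w : Fin K → Vec q) {N : ℕ} (b : Fin N → Fin K → S × A) (k : Fin K) : Vec p :=
  (1 / (N : ℝ)) • ∑ i, inner ℝ (φ k (b i k)) (w k) • score pol θ (b i k)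

/-- The single-step weight update `T_Λ(λ - c λᵀ ∇̄J (∇̄J')ᵀ)` from the gradient estimates
`g = ∇̄J` and `g' = ∇̄J'` of two independent batches. -/
noncomputable def fcUpdate (c : ℝ) (l : Vec K) (g g' : Fin K → Vec p) : Vec K :=
  proj (simplex K) (l - c • WithLp.toLp 2 fun k => inner ℝ (∑ i, l i • g i) (g' k))

/-- The parameters of the algorithm: actor step `β`, weight step `c'`, sample sizes. -/
structure Params where
  β : ℝ
  c : ℝ
  Ncritic : ℕ
  Nactor : ℕ
  NFC : ℕ

/-- The state `(θ_t, w_t, λ_t)` of the algorithm. -/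
abbrev State (K p q : ℕ) : Type := Vec p × (Fin K → Vec q) × Vec K

/-- The law of `(θ_{t+1}, w_{t+1}, λ_{t+1})` given `(θ_t, w_t, λ_t)`: the critic loops of the
tasks, warm-started at `w_t`, give `w_{t+1}`; two batches of `NFC` samples give `λ_{t+1}`; a batch
of `Nactor` samples gives `θ_{t+1} = θ_t + β λ_tᵀ ∇̃J(θ_t)`. -/
noncomputable def iterLaw (γ B lamA : ℝ) (M : MultiTaskMDP K S A) (pol : PolicyClass p S A)
    (φ : Fin K → S × A → Vec q) (mode : CriticSampling) (par : Params) (x : State K p q) :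
    Measure (State K p q) :=
  (Measure.pi fun k =>
      (criticLaw γ B lamA M pol φ mode k x.1 (x.2.1 k) par.Ncritic).map Prod.fst).bind fun w =>
    (((batchLaw γ M pol x.1 par.NFC).prod (batchLaw γ M pol x.1 par.NFC)).prod
        (batchLaw γ M pol x.1 par.Nactor)).map fun b =>
      (x.1 + par.β • ∑ k, x.2.2 k • gradEst pol φ x.1 w b.2 k,
        w,
        fcUpdate par.c x.2.2 (gradEst pol φ x.1 w b.1.1) (gradEst pol φ x.1 w b.1.2))

/-- The law of `(θ_t, w_t, λ_t)` for the algorithm started at the state `x₀`. -/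
noncomputable def runLaw (γ B lamA : ℝ) (M : MultiTaskMDP K S A) (pol : PolicyClass p S A)
    (φ : Fin K → S × A → Vec q) (mode : CriticSampling) (par : Params) (x₀ : State K p q) :
    ℕ → Measure (State K p q)
  | 0 => Measure.dirac x₀
  | t + 1 => (runLaw γ B lamA M pol φ mode par x₀ t).bind
      (iterLaw γ B lamA M pol φ mode par)

end Model

end MTAC

/-! The proof follows one Lyapunov function. For fixed weights l in the simplex let Ψ(θ, w, λ) =
(1/c)‖λ − l‖² − (2(1 − γ)/β) lᵀJ(θ); this is `potential`, up to a truncation that is inactive on the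
simplex. Given the critic output, let h_k be the mean of the gradient estimate of task k and v = ∑
λ_k h_k. Since the two weight batches are independent, the weight step contributes −2‖v‖² + 2⟨v, ∑
l_k h_k⟩ to the mean change of Ψ, and the actor step contributes −2(1 − γ)⟨v, lᵀ∇J⟩. The visitation
law is normalized, so h_k estimates (1 − γ)∇J^k and the two cross terms cancel up to bias. The
quadratic terms are absorbed by the step size restrictions, and Ψ falls by 3/8‖v‖² up to sampling
noise and squared bias (`one_step_descent`). The minimizer λ* enters only through ‖λ*ᵀ∇J‖ ≤
‖λ_tᵀ∇J‖, so its movement with θ never has to be controlled. With l = λ_0 the potential starts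
nonpositive and stays above −2/β, and telescoping gives the rate
(`sum_integral_minimal_weightedGrad_le`). The bias is E[(φᵀw − Q)ψ], controlled by ‖w − w*‖² and
ε_app (`norm_gradError_sq_le`). For the critic, the Lyapunov function is j‖w_j − w*‖² plus a
corrector u solving a Poisson equation: u makes the drift at the current, correlated, sample act as
its mean under the visitation law, where negative definiteness applies. Each step costs O(1/j) and
the total over N steps is O(√N), so the mean squared error is O(1/√N) (`critic_error`). Smoothness
of J comes from a first order expansion of the likelihood ratio exp(log π_{θ+d} − log π_θ), pushed
through the Bellman equation by contraction. This gives a uniform quadratic remainder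
(`abs_J_sub_sub_le`), hence both the policy gradient formula and a Lipschitz gradient. -/

namespace MTAC

/-! ### Measurable families of probability measures and integrals of bounded functions. -/

section Generic

variable {X Y Z : Type*} [MeasurableSpace X] [MeasurableSpace Y] [MeasurableSpace Z]

/-- The laws of the algorithm are iterated with `Measure.bind`, which has its intended meaning only
for measurable families. Each of them must therefore be shown to depend measurably on the current
state; this lemma and the following ones give closure under mixtures, images and products. -/
lemma measurable_bind_param {μ : Z → Measure X} (hμ : Measurable μ)
    (hp : ∀ z, IsProbabilityMeasure (μ z)) {κ : Z → X → Measure Y}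
    (hκ : Measurable fun y : Z × X => κ y.1 y.2) : Measurable fun z => (μ z).bind (κ z) := by
  let μ' : Kernel Z X := ⟨μ, hμ⟩
  have : IsMarkovKernel μ' := ⟨hp⟩
  refine Measure.measurable_of_measurable_coe _ fun s hs => ?_
  have h : ∀ z, (μ z).bind (κ z) s = ∫⁻ x, κ z x s ∂(μ' z) := fun z =>
    Measure.bind_apply hs (hκ.comp measurable_prodMk_left).aemeasurable
  simp_rw [h]
  exact Measurable.lintegral_kernel_prod_right' (κ := μ') (f := fun p : Z × X => κ p.1 p.2 s)
    ((Measure.measurable_coe hs).comp hκ)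

lemma measurable_map_param {μ : Z → Measure X} (hμ : Measurable μ)
    (hp : ∀ z, IsProbabilityMeasure (μ z)) {f : Z → X → Y}
    (hf : Measurable fun y : Z × X => f y.1 y.2) : Measurable fun z => (μ z).map (f z) := by
  have : ∀ z, (μ z).map (f z) = (μ z).bind fun x => Measure.dirac (f z x) := fun z =>
    (Measure.bind_dirac_eq_map _ (hf.comp measurable_prodMk_left)).symm
  simp_rw [this]
  exact measurable_bind_param hμ hp (κ := fun z x => Measure.dirac (f z x))
    (Measure.measurable_dirac.comp hf)

lemma measurable_prod_param {μ : Z → Measure X} (hμ : Measurable μ)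
    (hp : ∀ z, IsProbabilityMeasure (μ z)) {ν : Z → Measure Y} (hν : Measurable ν)
    (hq : ∀ z, IsProbabilityMeasure (ν z)) : Measurable fun z => (μ z).prod (ν z) := by
  let μ' : Kernel Z X := ⟨μ, hμ⟩
  have : IsMarkovKernel μ' := ⟨hp⟩
  let ν' : Kernel Z Y := ⟨ν, hν⟩
  have : IsMarkovKernel ν' := ⟨hq⟩
  have : (fun z => (μ z).prod (ν z)) = μ' ×ₖ ν' := by
    ext1 z; exact (Kernel.prod_apply μ' ν' z).symm
  rw [this]
  exact Kernel.measurable _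

/-- Boxes form a generating π-system, and on a box the product measure is a finite product of
measurable functions of the parameter. -/
lemma measurable_pi_param {ι : Type*} [Fintype ι] {μ : ι → Z → Measure X}
    (hμ : ∀ i, Measurable (μ i)) (hp : ∀ i z, IsProbabilityMeasure (μ i z)) :
    Measurable fun z => Measure.pi fun i => μ i z := by
  have : ∀ z, IsProbabilityMeasure (Measure.pi fun i => μ i z) := fun z => by
    have := fun i => hp i z
    infer_instance
  refine Measurable.measure_of_isPiSystem_of_isProbabilityMeasure generateFrom_pi.symm isPiSystem_pi
    ?_
  rintro _ ⟨t, ht, rfl⟩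
  have : ∀ z, Measure.pi (fun i => μ i z) (Set.univ.pi t) = ∏ i, μ i z (t i) := fun z => by
    have := fun i => hp i z
    exact Measure.pi_pi _ _
  simp_rw [this]
  exact Finset.measurable_prod _ fun i _ =>
    (Measure.measurable_coe (ht i (Set.mem_univ i))).comp (hμ i)

lemma measurable_integral_param {E : Type*} [NormedAddCommGroup E] [NormedSpace ℝ E]
    [MeasurableSpace E] [BorelSpace E] [SecondCountableTopology E]
    {μ : Z → Measure X} (hμ : Measurable μ)
    (hp : ∀ z, IsProbabilityMeasure (μ z)) {f : Z → X → E}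
    (hf : Measurable fun y : Z × X => f y.1 y.2) : Measurable fun z => ∫ x, f z x ∂(μ z) := by
  let μ' : Kernel Z X := ⟨μ, hμ⟩
  have : IsMarkovKernel μ' := ⟨hp⟩
  exact (StronglyMeasurable.integral_kernel_prod_right (κ := μ') (f := f)
    hf.stronglyMeasurable).measurable

lemma integrable_of_bound {E : Type*} [NormedAddCommGroup E]
    [MeasurableSpace E] [BorelSpace E] [SecondCountableTopology E]
    {μ : Measure X} [IsFiniteMeasure μ] {f : X → E} (hf : Measurable f) {C : ℝ}
    (hC : ∀ x, ‖f x‖ ≤ C) : Integrable f μ :=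
  Integrable.of_bound hf.aestronglyMeasurable C (ae_of_all _ hC)

lemma norm_integral_le_bound {E : Type*} [NormedAddCommGroup E] [NormedSpace ℝ E]
    {μ : Measure X} [IsProbabilityMeasure μ] {f : X → E} {C : ℝ}
    (hC : ∀ x, ‖f x‖ ≤ C) : ‖∫ x, f x ∂μ‖ ≤ C := by
  simpa using norm_integral_le_of_norm_le_const (μ := μ) (ae_of_all _ hC)

lemma abs_integral_le_bound {μ : Measure X} [IsProbabilityMeasure μ] {f : X → ℝ} {C : ℝ}
    (hC : ∀ x, |f x| ≤ C) : |∫ x, f x ∂μ| ≤ C :=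
  norm_integral_le_bound (E := ℝ) hC

lemma isProb_bind {μ : Measure X} [IsProbabilityMeasure μ] {κ : X → Measure Y}
    (hκ : Measurable κ) (hp : ∀ x, IsProbabilityMeasure (κ x)) :
    IsProbabilityMeasure (μ.bind κ) :=
  isProbabilityMeasure_bind hκ.aemeasurable (ae_of_all _ hp)

lemma integral_bind_eq {E : Type*} [NormedAddCommGroup E] [NormedSpace ℝ E]
    {μ : Measure X} [IsProbabilityMeasure μ] {κ : X → Measure Y}
    (hκ : Measurable κ) (hp : ∀ x, IsProbabilityMeasure (κ x)) {f : Y → E}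
    (hf : Integrable f (μ.bind κ)) :
    ∫ y, f y ∂(μ.bind κ) = ∫ x, ∫ y, f y ∂(κ x) ∂μ := by
  let κ' : Kernel X Y := ⟨κ, hκ⟩
  have : IsMarkovKernel κ' := ⟨hp⟩
  have h := Kernel.integral_comp (κ := Kernel.const Unit μ) (η := κ') (a := ()) (f := f)
  rw [Kernel.comp_apply, Kernel.const_apply] at h
  exact h hf

lemma integral_bind_of_bound {E : Type*} [NormedAddCommGroup E] [NormedSpace ℝ E]
    [MeasurableSpace E] [BorelSpace E] [SecondCountableTopology E]
    {μ : Measure X} [IsProbabilityMeasure μ] {κ : X → Measure Y}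
    (hκ : Measurable κ) (hp : ∀ x, IsProbabilityMeasure (κ x)) {f : Y → E}
    (hf : Measurable f) {C : ℝ} (hC : ∀ x, ‖f x‖ ≤ C) :
    ∫ y, f y ∂(μ.bind κ) = ∫ x, ∫ y, f y ∂(κ x) ∂μ :=
  have := isProb_bind (μ := μ) hκ hp
  integral_bind_eq hκ hp (integrable_of_bound hf hC)

/-- Integrals of functions with values in `[0, M]` against measures close in total variation. -/
lemma abs_integral_sub_le_of_nonneg {μ ν : Measure X} [IsProbabilityMeasure μ]
    [IsProbabilityMeasure ν] {δ : ℝ}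
    (h : ∀ E, MeasurableSet E → |μ.real E - ν.real E| ≤ δ) {f : X → ℝ} (hf : Measurable f)
    {M : ℝ} (h0 : ∀ x, 0 ≤ f x) (hM : ∀ x, f x ≤ M) :
    |∫ x, f x ∂μ - ∫ x, f x ∂ν| ≤ M * δ := by
  have hM0 : 0 ≤ M := by
    obtain ⟨x⟩ := nonempty_of_isProbabilityMeasure μ
    exact (h0 x).trans (hM x)
  have hi : ∀ (η : Measure X) [IsProbabilityMeasure η], Integrable f η := fun η _ =>
    integrable_of_bound hf (C := M) fun x => by
      rw [Real.norm_eq_abs, abs_of_nonneg (h0 x)]; exact hM x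
  have hr : ∀ (η : Measure X) [IsProbabilityMeasure η],
      IntegrableOn (fun t : ℝ => η.real {a | t ≤ f a}) (Set.Ioc 0 M) := fun η _ => by
    refine Integrable.of_bound (C := 1) ?_ (ae_of_all _ fun t => ?_)
    · refine Measurable.aestronglyMeasurable (Antitone.measurable fun s t hst => ?_)
      exact measureReal_mono fun a (ha : t ≤ f a) => hst.trans ha
    · rw [Real.norm_eq_abs, abs_of_nonneg measureReal_nonneg]
      exact measureReal_le_one
  -- Layer-cake formula: at every level t in (0, M] the measures of {t ≤ f} differ by at most δ.
  rw [(hi μ).integral_eq_integral_Ioc_meas_le (ae_of_all _ h0) (ae_of_all _ hM),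
    (hi ν).integral_eq_integral_Ioc_meas_le (ae_of_all _ h0) (ae_of_all _ hM),
    ← integral_sub (hr μ) (hr ν)]
  have := norm_setIntegral_le_of_norm_le_const (μ := volume) (s := Set.Ioc (0 : ℝ) M) (C := δ)
    (f := fun t => μ.real {a | t ≤ f a} - ν.real {a | t ≤ f a}) (by simp)
    (fun t _ => h _ (measurableSet_le measurable_const hf))
  simpa [hM0, mul_comm] using this

/-- Adding M, which does not change the difference, moves the range into [0, 2M]; this is the factor
2. -/
lemma abs_integral_sub_le {μ ν : Measure X} [IsProbabilityMeasure μ]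
    [IsProbabilityMeasure ν] {δ : ℝ}
    (h : ∀ E, MeasurableSet E → |μ.real E - ν.real E| ≤ δ) {f : X → ℝ} (hf : Measurable f)
    {M : ℝ} (hM : ∀ x, |f x| ≤ M) :
    |∫ x, f x ∂μ - ∫ x, f x ∂ν| ≤ 2 * M * δ := by
  have h1 := abs_integral_sub_le_of_nonneg h (f := fun x => f x + M) (M := 2 * M)
    (hf.add_const M) (fun x => by linarith [(abs_le.1 (hM x)).1])
    (fun x => by linarith [(abs_le.1 (hM x)).2])
  have hi : ∀ (η : Measure X) [IsProbabilityMeasure η], ∫ x, (f x + M) ∂η = ∫ x, f x ∂η + M := by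
    intro η _
    rw [integral_add (integrable_of_bound hf (C := M) hM) (integrable_const _)]
    simp
  rw [hi μ, hi ν] at h1
  simpa using h1

end Generic

/-! ### Euclidean projection onto closed convex sets, and the simplex. -/

section Projection

variable {n : ℕ} {C : Set (Vec n)}

/-- `proj` is a choice among nearest points, meaningful because one exists in a nonempty closed
convex set. The obtuse angle inequality is the form used from here on. -/
lemma proj_spec (hne : C.Nonempty) (hcl : IsClosed C) (hc : Convex ℝ C) (v : Vec n) :
    proj C v ∈ C ∧ ∀ u ∈ C, inner ℝ (v - proj C v) (u - proj C v) ≤ 0 := by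
  have hex : ∃ u, u ∈ C ∧ ∀ u' ∈ C, ‖v - u‖ ≤ ‖v - u'‖ := by
    obtain ⟨u, hu, h⟩ := exists_norm_eq_iInf_of_complete_convex hne hcl.isComplete hc v
    exact ⟨u, hu, fun u' hu' => h ▸ ciInf_le (f := fun w : C => ‖v - w‖)
      ⟨0, Set.forall_mem_range.2 fun _ => norm_nonneg _⟩ ⟨u', hu'⟩⟩
  obtain ⟨h1, h2⟩ : proj C v ∈ C ∧ ∀ u' ∈ C, ‖v - proj C v‖ ≤ ‖v - u'‖ :=
    Classical.epsilon_spec hex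
  refine ⟨h1, (norm_eq_iInf_iff_real_inner_le_zero hc h1).1 ?_⟩
  have : Nonempty C := hne.to_subtype
  exact le_antisymm (le_ciInf fun u => h2 u u.2)
    (ciInf_le (f := fun w : C => ‖v - w‖)
      ⟨0, Set.forall_mem_range.2 fun _ => norm_nonneg _⟩ ⟨_, h1⟩)

/-- Adding the angle inequalities at the two projected points gives ‖Pv − Pw‖² ≤ ⟨v − w, Pv − Pw⟩;
Cauchy–Schwarz does the rest. -/
lemma norm_proj_sub_proj_le (hne : C.Nonempty) (hcl : IsClosed C) (hc : Convex ℝ C)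
    (v w : Vec n) : ‖proj C v - proj C w‖ ≤ ‖v - w‖ := by
  obtain ⟨hv, hv'⟩ := proj_spec hne hcl hc v
  obtain ⟨hw, hw'⟩ := proj_spec hne hcl hc w
  have h1 := hv' _ hw
  have h2 := hw' _ hv
  have h3 : ‖proj C v - proj C w‖ ^ 2 ≤ ‖v - w‖ * ‖proj C v - proj C w‖ := by
    refine le_trans ?_ (real_inner_le_norm _ _)
    rw [← real_inner_self_eq_norm_sq]
    have : inner ℝ (v - w) (proj C v - proj C w) = inner ℝ (proj C v - proj C w) (proj C v - proj C w)
        - inner ℝ (v - proj C v) (proj C w - proj C v)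
        - inner ℝ (w - proj C w) (proj C v - proj C w) := by
      simp only [inner_sub_left, inner_sub_right]; ring
    linarith
  rcases (norm_nonneg (proj C v - proj C w)).eq_or_lt with h | h
  · rw [← h]; exact norm_nonneg _
  · nlinarith

lemma proj_of_mem (hcl : IsClosed C) (hc : Convex ℝ C) {u : Vec n} (hu : u ∈ C) :
    proj C u = u := by
  have h := (proj_spec ⟨u, hu⟩ hcl hc u).2 u hu
  rw [real_inner_self_eq_norm_sq] at h
  have : ‖u - proj C u‖ = 0 := by nlinarith [norm_nonneg (u - proj C u)]
  exact (sub_eq_zero.1 (norm_eq_zero.1 this)).symm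

lemma norm_proj_sub_le (hcl : IsClosed C) (hc : Convex ℝ C) (v : Vec n) {u : Vec n} (hu : u ∈ C) :
    ‖proj C v - u‖ ≤ ‖v - u‖ := by
  simpa [proj_of_mem hcl hc hu] using norm_proj_sub_proj_le ⟨u, hu⟩ hcl hc v u

lemma measurable_proj (hne : C.Nonempty) (hcl : IsClosed C) (hc : Convex ℝ C) :
    Measurable (proj C) := by
  refine (LipschitzWith.of_dist_le_mul (K := 1) fun v w => ?_).continuous.measurable
  simpa [dist_eq_norm] using norm_proj_sub_proj_le hne hcl hc v w

lemma isClosed_simplex (K : ℕ) : IsClosed (simplex K) := by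
  have : simplex K = (⋂ k, {l : Vec K | 0 ≤ l k}) ∩ {l : Vec K | ∑ k, l k = 1} := by
    ext l; simp [simplex]
  rw [this]
  exact (isClosed_iInter fun k => isClosed_le continuous_const (by fun_prop)).inter
    (isClosed_eq (by fun_prop) continuous_const)

lemma convex_simplex (K : ℕ) : Convex ℝ (simplex K) := by
  rintro x ⟨hx, hx'⟩ y ⟨hy, hy'⟩ a b ha hb hab
  refine ⟨fun k => ?_, ?_⟩
  · simpa using add_nonneg (mul_nonneg ha (hx k)) (mul_nonneg hb (hy k))
  · simp [Finset.sum_add_distrib, ← Finset.mul_sum, hx', hy', hab]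

lemma simplex_le_one {K : ℕ} {l : Vec K} (hl : l ∈ simplex K) (k : Fin K) : l k ≤ 1 :=
  hl.2 ▸ Finset.single_le_sum (fun i _ => hl.1 i) (Finset.mem_univ k)

lemma norm_simplex_le_one {K : ℕ} {l : Vec K} (hl : l ∈ simplex K) : ‖l‖ ≤ 1 := by
  rw [EuclideanSpace.norm_eq, Real.sqrt_le_one, ← hl.2]
  refine Finset.sum_le_sum fun k _ => ?_
  rw [Real.norm_eq_abs, sq_abs]
  nlinarith [hl.1 k, simplex_le_one hl k]

lemma norm_sum_smul_le {K : ℕ} {E : Type*} [NormedAddCommGroup E] [NormedSpace ℝ E] {l : Vec K}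
    (hl : l ∈ simplex K) {g : Fin K → E} {C : ℝ} (hg : ∀ k, ‖g k‖ ≤ C) :
    ‖∑ k, l k • g k‖ ≤ C :=
  calc ‖∑ k, l k • g k‖ ≤ ∑ k, l k * C := norm_sum_le_of_le _ fun k _ => by
        rw [norm_smul, Real.norm_eq_abs, abs_of_nonneg (hl.1 k)]
        exact mul_le_mul_of_nonneg_left (hg k) (hl.1 k)
    _ = C := by rw [← Finset.sum_mul, hl.2, one_mul]

end Projection

/-! ### Policy kernels, the score, and the Markov chain of state-action pairs. -/

section Model

variable {K p q : ℕ} {S A : Type*} [MeasurableSpace S] [MeasurableSpace A]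

instance instMarkovTrans (M : MultiTaskMDP K S A) (k : Fin K) : IsMarkovKernel (M.trans k) :=
  M.trans_markov k

instance instProbInit (M : MultiTaskMDP K S A) (k : Fin K) : IsProbabilityMeasure (M.init k) :=
  M.init_prob k

instance instSigmaFiniteBase (pol : PolicyClass p S A) : SigmaFinite pol.base :=
  pol.base_sigmaFinite

section Policy

variable (pol : PolicyClass p S A)

lemma measurable_ofReal_dens (θ : Vec p) :
    Measurable (Function.uncurry fun s a => ENNReal.ofReal (pol.dens θ s a)) :=
  ENNReal.measurable_ofReal.comp (pol.dens_measurable.comp (measurable_const.prodMk measurable_id))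

lemma policyKernel_apply (θ : Vec p) (s : S) :
    policyKernel pol θ s = pol.base.withDensity fun a => ENNReal.ofReal (pol.dens θ s a) := by
  unfold policyKernel
  rw [Kernel.withDensity_apply _ (measurable_ofReal_dens pol θ), Kernel.const_apply]

instance instMarkovPolicy (θ : Vec p) : IsMarkovKernel (policyKernel pol θ) := by
  refine ⟨fun s => ⟨?_⟩⟩
  rw [policyKernel_apply, withDensity_apply _ MeasurableSet.univ, Measure.restrict_univ]
  exact pol.dens_total θ s

lemma measurable_dens (θ : Vec p) (s : S) : Measurable (pol.dens θ s) :=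
  pol.dens_measurable.comp (measurable_const.prodMk (measurable_const.prodMk measurable_id))

lemma integral_policyKernel {E : Type*} [NormedAddCommGroup E] [NormedSpace ℝ E] (θ : Vec p)
    (s : S) (f : A → E) :
    ∫ a, f a ∂(policyKernel pol θ s) = ∫ a, pol.dens θ s a • f a ∂pol.base := by
  rw [policyKernel_apply, integral_withDensity_eq_integral_toReal_smul
    (measurable_dens pol θ s).ennreal_ofReal (by simp)]
  simp_rw [ENNReal.toReal_ofReal (pol.dens_pos θ s _).le]

lemma measurable_policyKernel :
    Measurable fun z : Vec p × S => policyKernel pol z.1 z.2 := by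
  refine Measure.measurable_of_measurable_coe _ fun E hE => ?_
  simp_rw [policyKernel_apply, withDensity_apply _ hE]
  refine Measurable.lintegral_prod_right' (ν := pol.base.restrict E)
    (f := fun w : (Vec p × S) × A => ENNReal.ofReal (pol.dens w.1.1 w.1.2 w.2)) ?_
  exact ENNReal.measurable_ofReal.comp (pol.dens_measurable.comp
    (measurable_fst.fst.prodMk (measurable_fst.snd.prodMk measurable_snd)))

lemma actKernel_apply (θ : Vec p) (s : S) :
    actKernel pol θ s = (policyKernel pol θ s).map (Prod.mk s) := by
  rw [actKernel, Kernel.prod_apply, Kernel.id_apply, Measure.dirac_prod]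

instance instMarkovAct (θ : Vec p) : IsMarkovKernel (actKernel pol θ) := by
  unfold actKernel; infer_instance

lemma measurable_actKernel :
    Measurable fun z : Vec p × S => actKernel pol z.1 z.2 := by
  simp_rw [actKernel_apply]
  exact measurable_map_param (measurable_policyKernel pol) (fun _ => inferInstance)
    (f := fun z a => (z.2, a)) (measurable_fst.snd.prodMk measurable_snd)

lemma integral_actKernel {E : Type*} [NormedAddCommGroup E] [NormedSpace ℝ E]
    [MeasurableSpace E] [BorelSpace E] [SecondCountableTopology E] (θ : Vec p)
    (s : S) {f : S × A → E} (hf : Measurable f) :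
    ∫ x, f x ∂(actKernel pol θ s) = ∫ a, f (s, a) ∂(policyKernel pol θ s) := by
  rw [actKernel_apply, integral_map measurable_prodMk_left.aemeasurable hf.aestronglyMeasurable]

variable {pol} in
-- Each coordinate of the score is the pointwise limit of difference quotients of log π with
-- increments 1/(n + 1), and these are jointly measurable because the density is.
lemma measurable_score {φ : Fin K → S × A → Vec q} {Cφ Lφ : ℝ}
    (h : SmoothBounded pol φ Cφ Lφ) :
    Measurable fun z : Vec p × (S × A) => score pol z.1 z.2 := by
  have hd := h.1
  suffices H : ∀ i : Fin p, Measurable fun z : Vec p × (S × A) => score pol z.1 z.2 i by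
    have : Measurable fun z : Vec p × (S × A) => (WithLp.ofLp (score pol z.1 z.2)) :=
      measurable_pi_lambda _ H
    exact (WithLp.measurable_toLp 2 _).comp this
  intro i
  set e : Vec p := EuclideanSpace.single i 1
  have hlog : Measurable fun z : Vec p × (S × A) => Real.log (pol.dens z.1 z.2.1 z.2.2) :=
    Real.measurable_log.comp pol.dens_measurable
  let F : ℕ → Vec p × (S × A) → ℝ := fun n z =>
    ((1 : ℝ) / (n + 1))⁻¹ • (Real.log (pol.dens (z.1 + ((1 : ℝ) / (n + 1)) • e) z.2.1 z.2.2)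
      - Real.log (pol.dens z.1 z.2.1 z.2.2))
  have hF : ∀ n, Measurable (F n) := fun n => by
    exact ((hlog.comp ((measurable_fst.add_const _).prodMk measurable_snd)).sub hlog).const_mul _
  refine measurable_of_tendsto_metrizable hF ?_
  rw [tendsto_pi_nhds]
  intro z
  have hl := ((hd z.2.1 z.2.2 z.1).hasFDerivAt.hasLineDerivAt e).tendsto_slope_zero
  have h0 : Filter.Tendsto (fun n : ℕ => (1 : ℝ) / (n + 1)) Filter.atTop
      (nhdsWithin 0 {0}ᶜ) := by
    refine tendsto_nhdsWithin_iff.2 ⟨tendsto_one_div_add_atTop_nhds_zero_nat, ?_⟩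
    exact Filter.Eventually.of_forall fun n => by
      simp only [Set.mem_compl_iff, Set.mem_singleton_iff]; positivity
  have := hl.comp h0
  have he : fderiv ℝ (fun θ => Real.log (pol.dens θ z.2.1 z.2.2)) z.1 e = score pol z.1 z.2 i := by
    have : score pol z.1 z.2 i = inner ℝ (score pol z.1 z.2) e := by
      simp only [e, EuclideanSpace.inner_single_right]; simp
    rw [this, score, ← InnerProductSpace.toDual_apply_apply (𝕜 := ℝ), toDual_gradient]
  rw [← he]
  exact this

end Policy

section Chain

variable (γ : ℝ) (M : MultiTaskMDP K S A) (pol : PolicyClass p S A) (k : Fin K)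

lemma chain_apply (θ : Vec p) (x : S × A) :
    chain M pol k θ x = (M.trans k x).bind (actKernel pol θ) := Kernel.comp_apply _ _ _

instance instMarkovChain (θ : Vec p) : IsMarkovKernel (chain M pol k θ) := by
  unfold chain; infer_instance

lemma measurable_chain :
    Measurable fun z : Vec p × (S × A) => chain M pol k z.1 z.2 := by
  simp_rw [chain_apply]
  exact measurable_bind_param (μ := fun z : Vec p × (S × A) => M.trans k z.2)
    ((M.trans k).measurable.comp measurable_snd) (fun _ => inferInstance)
    (κ := fun (z : Vec p × (S × A)) s => actKernel pol z.1 s)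
    ((measurable_actKernel pol).comp (f := fun w : (Vec p × (S × A)) × S => (w.1.1, w.2)) (by fun_prop))

instance instMarkovChainIter (θ : Vec p) (t : ℕ) : IsMarkovKernel (chainIter M pol k θ t) := by
  induction t with
  | zero => unfold chainIter; infer_instance
  | succ t ih => unfold chainIter; infer_instance

/-- `chainIter` appends steps at the end; Bellman and Poisson equations need the first step split
off instead. -/
lemma chainIter_succ' (θ : Vec p) (t : ℕ) :
    chainIter M pol k θ (t + 1) = chainIter M pol k θ t ∘ₖ chain M pol k θ := by
  induction t with
  | zero => simp [chainIter]
  | succ t ih => 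
    rw [chainIter, ih, ← Kernel.comp_assoc, ← ih]
    rfl

lemma measurable_chainIter (t : ℕ) :
    Measurable fun z : Vec p × (S × A) => chainIter M pol k z.1 t z.2 := by
  induction t with
  | zero =>
    simp only [chainIter, Kernel.id_apply]
    exact Measure.measurable_dirac.comp measurable_snd
  | succ t ih =>
    simp only [chainIter, Kernel.comp_apply]
    exact measurable_bind_param ih (fun _ => inferInstance)
      (κ := fun (z : Vec p × (S × A)) y => chain M pol k z.1 y)
      ((measurable_chain M pol k).comp (f := fun w : (Vec p × (S × A)) × (S × A) => (w.1.1, w.2)) (by fun_prop))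

instance instMarkovLaw (θ : Vec p) (t : ℕ) : IsMarkovKernel (lawFromState M pol k θ t) := by
  unfold lawFromState; infer_instance

instance instProbLawAt (θ : Vec p) (t : ℕ) : IsProbabilityMeasure (lawAt M pol k θ t) :=
  isProb_bind (Kernel.measurable _) fun _ => inferInstance

lemma measurable_lawAt (t : ℕ) : Measurable fun θ : Vec p => lawAt M pol k θ t := by
  unfold lawAt lawFromState
  refine measurable_bind_param measurable_const (fun _ => inferInstance)
    (κ := fun θ s => (chainIter M pol k θ t ∘ₖ actKernel pol θ) s) ?_
  simp only [Kernel.comp_apply]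
  exact measurable_bind_param (measurable_actKernel pol) (fun _ => inferInstance)
      (κ := fun (z : Vec p × S) y => chainIter M pol k z.1 t y)
      ((measurable_chainIter M pol k t).comp (f := fun w : (Vec p × S) × (S × A) => (w.1.1, w.2)) (by fun_prop))

variable {γ} in
lemma isProb_visitation (hγ0 : 0 ≤ γ) (hγ1 : γ < 1) (θ : Vec p) :
    IsProbabilityMeasure (visitation γ M pol k θ) := by
  refine ⟨?_⟩
  have h : ∀ t : ℕ, 0 ≤ (1 - γ) * γ ^ t := fun t =>
    mul_nonneg (by linarith) (pow_nonneg hγ0 t)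
  simp only [visitation, Measure.sum_apply _ MeasurableSet.univ, Measure.smul_apply, measure_univ,
    smul_eq_mul, mul_one]
  rw [← ENNReal.ofReal_tsum_of_nonneg h
    ((summable_geometric_of_lt_one hγ0 hγ1).mul_left _), tsum_mul_left,
    tsum_geometric_of_lt_one hγ0 hγ1, mul_inv_cancel₀ (by linarith), ENNReal.ofReal_one]

lemma measurable_visitation : Measurable fun θ : Vec p => visitation γ M pol k θ := by
  refine Measure.measurable_of_measurable_coe _ fun E hE => ?_
  simp only [visitation, Measure.sum_apply _ hE, Measure.smul_apply, smul_eq_mul]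
  exact Measurable.tsum fun t =>
    (((Measure.measurable_coe hE).comp (measurable_lawAt M pol k t))).const_mul _

section Integrals

variable {E : Type*} [NormedAddCommGroup E] [NormedSpace ℝ E] [MeasurableSpace E] [BorelSpace E]
  [SecondCountableTopology E] {f : S × A → E} {C : ℝ}

lemma integral_chain (hf : Measurable f) (hC : ∀ x, ‖f x‖ ≤ C) (θ : Vec p) (x : S × A) :
    ∫ y, f y ∂(chain M pol k θ x) =
      ∫ s, ∫ a, f (s, a) ∂(policyKernel pol θ s) ∂(M.trans k x) := by
  rw [chain_apply, integral_bind_of_bound (Kernel.measurable _) (fun _ => inferInstance) hf hC]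
  simp_rw [integral_actKernel pol θ _ hf]

lemma integral_chainIter_succ (hf : Measurable f) (hC : ∀ x, ‖f x‖ ≤ C) (θ : Vec p) (t : ℕ)
    (x : S × A) :
    ∫ y, f y ∂(chainIter M pol k θ (t + 1) x) =
      ∫ y, ∫ z, f z ∂(chainIter M pol k θ t y) ∂(chain M pol k θ x) := by
  rw [chainIter_succ', Kernel.comp_apply,
    integral_bind_of_bound (Kernel.measurable _) (fun _ => inferInstance) hf hC]

lemma integral_lawAt (hf : Measurable f) (hC : ∀ x, ‖f x‖ ≤ C) (θ : Vec p) (t : ℕ) :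
    ∫ x, f x ∂(lawAt M pol k θ t) =
      ∫ s, ∫ x, ∫ y, f y ∂(chainIter M pol k θ t x) ∂(actKernel pol θ s) ∂(M.init k) := by
  rw [lawAt, integral_bind_of_bound (Kernel.measurable _) (fun _ => inferInstance) hf hC]
  refine integral_congr_ae (ae_of_all _ fun s => ?_)
  simp only [lawFromState]
  rw [Kernel.comp_apply,
    integral_bind_of_bound (Kernel.measurable _) (fun _ => inferInstance) hf hC]

lemma integral_visitation (hγ0 : 0 ≤ γ) (hγ1 : γ < 1) (hf : Measurable f) (hC : ∀ x, ‖f x‖ ≤ C)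
    (θ : Vec p) :
    HasSum (fun t : ℕ => ((1 - γ) * γ ^ t) • ∫ x, f x ∂(lawAt M pol k θ t))
      (∫ x, f x ∂(visitation γ M pol k θ)) := by
  have := isProb_visitation M pol k hγ0 hγ1 θ
  have h := hasSum_integral_measure (f := f) (μ := fun t : ℕ =>
    ENNReal.ofReal ((1 - γ) * γ ^ t) • lawAt M pol k θ t)
    (integrable_of_bound (μ := visitation γ M pol k θ) hf hC)
  rw [← visitation] at h
  convert h using 2 with t
  rw [integral_smul_measure, ENNReal.toReal_ofReal (mul_nonneg (by linarith) (pow_nonneg hγ0 t))]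

end Integrals

/-- The discounted sum `∑_t γ^t E[f(s_t, a_t)]` along the chain started at `x`. -/
noncomputable def resolvent (θ : Vec p) (f : S × A → ℝ) (x : S × A) : ℝ :=
  ∑' t : ℕ, γ ^ t * ∫ y, f y ∂(chainIter M pol k θ t x)

variable {γ} {f : S × A → ℝ} {C : ℝ}

lemma summable_resolvent (hγ0 : 0 ≤ γ) (hγ1 : γ < 1) (hC : ∀ x, |f x| ≤ C) (θ : Vec p) (x : S × A) :
    Summable (fun t : ℕ => γ ^ t * ∫ y, f y ∂(chainIter M pol k θ t x)) := by
  refine Summable.of_norm_bounded ((summable_geometric_of_lt_one hγ0 hγ1).mul_right C) fun t => ?_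
  rw [norm_mul, norm_pow, Real.norm_of_nonneg hγ0]
  exact mul_le_mul_of_nonneg_left (norm_integral_le_bound hC) (pow_nonneg hγ0 t)

lemma abs_resolvent_le (hγ0 : 0 ≤ γ) (hγ1 : γ < 1) (hC : ∀ x, |f x| ≤ C) (θ : Vec p) (x : S × A) :
    |resolvent γ M pol k θ f x| ≤ C / (1 - γ) := by
  have h : HasSum (fun t : ℕ => γ ^ t * C) (C / (1 - γ)) := by
    have := (hasSum_geometric_of_lt_one hγ0 hγ1).mul_right C
    rwa [inv_mul_eq_div] at this
  rw [← Real.norm_eq_abs]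
  refine tsum_of_norm_bounded h fun t => ?_
  rw [norm_mul, norm_pow, Real.norm_of_nonneg hγ0]
  exact mul_le_mul_of_nonneg_left (norm_integral_le_bound hC) (pow_nonneg hγ0 t)

lemma measurable_resolvent (hf : Measurable f) :
    Measurable fun z : Vec p × (S × A) => resolvent γ M pol k z.1 f z.2 := by
  refine Measurable.tsum fun t => ?_
  exact (measurable_integral_param (measurable_chainIter M pol k t) (fun _ => inferInstance)
    (f := fun _ y => f y) (hf.comp measurable_snd)).const_mul _

lemma integral_tsum_geometric {X : Type*} [MeasurableSpace X] {μ : Measure X}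
    [IsProbabilityMeasure μ] (hγ0 : 0 ≤ γ) (hγ1 : γ < 1) {g : ℕ → X → ℝ}
    (hg : ∀ t, Measurable (g t)) (hC : ∀ t x, |g t x| ≤ C) :
    ∫ x, ∑' t, γ ^ t * g t x ∂μ = ∑' t, γ ^ t * ∫ x, g t x ∂μ := by
  have hb : ∀ t x, ‖γ ^ t * g t x‖ ≤ γ ^ t * C := fun t x => by
    rw [norm_mul, norm_pow, Real.norm_of_nonneg hγ0]
    exact mul_le_mul_of_nonneg_left (hC t x) (pow_nonneg hγ0 t)
  rw [← integral_tsum_of_summable_integral_norm]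
  · simp_rw [integral_const_mul]
  · exact fun t => integrable_of_bound ((hg t).const_mul _) (hb t)
  · refine Summable.of_norm_bounded ((summable_geometric_of_lt_one hγ0 hγ1).mul_right C)
      fun t => norm_integral_le_bound fun x => ?_
    rw [norm_norm]; exact hb t x

/-- Bellman equation: after the term t = 0, the series is γ times the same series started one step
later. It is used for the reward, giving Q, and for Q⟨ψ, d⟩, giving the linear part of the change of
Q. -/
lemma resolvent_eq (hγ0 : 0 ≤ γ) (hγ1 : γ < 1) (hf : Measurable f) (hC : ∀ x, |f x| ≤ C) (θ : Vec p) (x : S × A) :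
    resolvent γ M pol k θ f x =
      f x + γ * ∫ y, resolvent γ M pol k θ f y ∂(chain M pol k θ x) := by
  have h0 := (summable_resolvent M pol k hγ0 hγ1 hC θ x).tsum_eq_zero_add
  rw [resolvent, h0]
  simp only [resolvent]
  rw [integral_tsum_geometric hγ0 hγ1 (C := C)
    (g := fun t y => ∫ z, f z ∂(chainIter M pol k θ t y))]
  · simp only [chainIter, Kernel.id_apply, integral_dirac' _ _ hf.stronglyMeasurable,
      pow_zero, one_mul]
    rw [← tsum_mul_left]
    congr 2
    ext t
    rw [← chainIter, integral_chainIter_succ M pol k hf hC]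
    ring
  · exact fun t => measurable_integral_param (Kernel.measurable _) (fun _ => inferInstance)
      (f := fun _ y => f y) (hf.comp measurable_snd)
  · exact fun t y => norm_integral_le_bound (E := ℝ) hC

end Chain

end Model

/-! ### Descent inequality, and gradients from quadratic expansions. -/

section Smooth

variable {p : ℕ}

lemma sub_le_inner_gradient {f : Vec p → ℝ} (hf : Differentiable ℝ f) {L : ℝ}
    (hL : ∀ x y, ‖gradient f x - gradient f y‖ ≤ L * ‖x - y‖) (x d : Vec p) :
    f (x + d) - f x - inner ℝ (gradient f x) d ≤ L / 2 * ‖d‖ ^ 2 := by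
  -- The slope of f along the segment exceeds ⟨∇f(x), d⟩ by at most L s‖d‖². Subtracting the
  -- primitive of this bound makes h nonincreasing on [0, 1].
  let h : ℝ → ℝ := fun s =>
    f (x + s • d) - s * inner ℝ (gradient f x) d - L / 2 * ‖d‖ ^ 2 * s ^ 2
  have hd : ∀ s, HasDerivAt h (inner ℝ (gradient f (x + s • d)) d - inner ℝ (gradient f x) d
      - L * ‖d‖ ^ 2 * s) s := fun s => by
    have h1 : HasDerivAt (fun s : ℝ => f (x + s • d)) (inner ℝ (gradient f (x + s • d)) d) s := by
      have := (hf (x + s • d)).hasGradientAt.hasFDerivAt.comp_hasDerivAt s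
        (((hasDerivAt_id s).smul_const d).const_add x)
      simpa [Function.comp_def] using this
    have h2 := ((hasDerivAt_id s).mul_const (inner ℝ (gradient f x) d))
    have h3 := ((hasDerivAt_id s).pow 2).const_mul (L / 2 * ‖d‖ ^ 2)
    refine ((h1.sub h2).sub h3).congr_deriv ?_
    simp only [id, Nat.cast_ofNat]; ring
  have hanti : AntitoneOn h (Set.Icc 0 1) := by
    refine antitoneOn_of_deriv_nonpos (convex_Icc 0 1)
      (fun s _ => (hd s).continuousAt.continuousWithinAt)
      (fun s _ => (hd s).differentiableAt.differentiableWithinAt) fun s hs => ?_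
    rw [interior_Icc] at hs
    rw [(hd s).deriv, ← inner_sub_left]
    have h1 := real_inner_le_norm (gradient f (x + s • d) - gradient f x) d
    have h2 := hL (x + s • d) x
    rw [add_sub_cancel_left, norm_smul, Real.norm_of_nonneg hs.1.le] at h2
    nlinarith [norm_nonneg d, mul_le_mul_of_nonneg_right h2 (norm_nonneg d)]
  have := hanti (Set.left_mem_Icc.2 zero_le_one) (Set.right_mem_Icc.2 zero_le_one) zero_le_one
  simp only [h, zero_smul, one_smul, add_zero] at this
  linarith

lemma gradient_neg' {f : Vec p → ℝ} (hf : Differentiable ℝ f) (x : Vec p) :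
    gradient (fun y => -f y) x = -gradient f x := by
  refine HasGradientAt.gradient ?_
  rw [hasGradientAt_iff_hasFDerivAt, map_neg]
  exact (hf x).hasGradientAt.hasFDerivAt.neg

lemma abs_sub_inner_gradient_le {f : Vec p → ℝ} (hf : Differentiable ℝ f) {L : ℝ}
    (hL : ∀ x y, ‖gradient f x - gradient f y‖ ≤ L * ‖x - y‖) (x d : Vec p) :
    |f (x + d) - f x - inner ℝ (gradient f x) d| ≤ L / 2 * ‖d‖ ^ 2 := by
  refine abs_le.2 ⟨?_, sub_le_inner_gradient hf hL x d⟩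
  have := sub_le_inner_gradient (f := fun y => -f y) hf.neg (L := L) (fun x y => by
    rw [gradient_neg' hf, gradient_neg' hf, ← neg_sub', norm_neg]; exact hL x y) x d
  rw [gradient_neg' hf, inner_neg_left] at this
  linarith

lemma abs_sub_le_of_gradient {f : Vec p → ℝ} (hf : Differentiable ℝ f) {C : ℝ}
    (hC : ∀ x, ‖gradient f x‖ ≤ C) (x y : Vec p) : |f y - f x| ≤ C * ‖y - x‖ := by
  refine Convex.norm_image_sub_le_of_norm_hasFDerivWithin_le (s := Set.univ)
    (f' := fun x => InnerProductSpace.toDual ℝ _ (gradient f x))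
    (fun x _ => (hf x).hasGradientAt.hasFDerivAt.hasFDerivWithinAt) (fun x _ => ?_) convex_univ
    trivial trivial
  rw [LinearIsometryEquiv.norm_map]; exact hC x

/-- A first order expansion with uniform quadratic remainder gives a Lipschitz gradient. -/
lemma hasGradientAt_of_quadratic {f : Vec p → ℝ} {G : Vec p → Vec p} {C : ℝ}
    (h : ∀ x d, |f (x + d) - f x - inner ℝ (G x) d| ≤ C * ‖d‖ ^ 2) (x : Vec p) :
    HasGradientAt f (G x) x := by
  rw [hasGradientAt_iff_isLittleO_nhds_zero]
  refine Asymptotics.IsBigO.trans_isLittleO (g := fun d : Vec p => ‖d‖ ^ 2) ?_ ?_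
  · refine Asymptotics.IsBigO.of_bound C (Filter.Eventually.of_forall fun d => ?_)
    rw [norm_pow, norm_norm]
    exact h x d
  · exact (Asymptotics.isLittleO_norm_pow_id one_lt_two)

/-- The expansions from x to y, from x to y + d and from y to y + d determine ⟨G x − G y, d⟩ up to
C(‖x − y‖² + ‖y − x + d‖² + ‖d‖²). Taking d parallel to G x − G y with length ‖x − y‖ gives 1 + 4 +
1 = 6. -/
lemma norm_sub_le_of_quadratic {f : Vec p → ℝ} {G : Vec p → Vec p} {C : ℝ} (hC : 0 ≤ C)
    (h : ∀ x d, |f (x + d) - f x - inner ℝ (G x) d| ≤ C * ‖d‖ ^ 2) (x y : Vec p) :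
    ‖G x - G y‖ ≤ 6 * C * ‖x - y‖ := by
  rcases (norm_nonneg (G x - G y)).eq_or_lt with h0 | h0
  · rw [← h0]; positivity
  set g := ‖G x - G y‖
  set n := ‖x - y‖
  let d : Vec p := (n / g) • (G x - G y)
  have hd : ‖d‖ = n := by
    simp only [d, norm_smul, norm_div, Real.norm_eq_abs]
    change |n| / |g| * g = n
    rw [abs_of_nonneg (norm_nonneg _), abs_of_pos h0, div_mul_cancel₀ _ h0.ne']
  have h1 := abs_le.1 (h x (y - x))
  have h2 := abs_le.1 (h x (y - x + d))
  have h3 := abs_le.1 (h y d)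
  rw [norm_sub_rev, add_sub_cancel] at h1
  rw [← add_assoc, add_sub_cancel, inner_add_right] at h2
  rw [hd] at h3
  have h4 : inner ℝ (G x - G y) d = n * g := by
    simp only [d, inner_smul_right, real_inner_self_eq_norm_sq]
    change n / g * g ^ 2 = n * g
    field_simp
  rw [inner_sub_left] at h4
  have h5 : ‖y - x + d‖ ≤ 2 * n := by
    refine (norm_add_le _ _).trans ?_
    rw [hd, norm_sub_rev]; simp only [n]; linarith
  have h6 : C * ‖y - x + d‖ ^ 2 ≤ C * (2 * n) ^ 2 := by gcongr
  have h7 : n * g ≤ 6 * C * n ^ 2 := by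
    have : ‖x - y‖ = n := rfl
    rw [this] at h1
    nlinarith
  rcases (norm_nonneg (x - y)).eq_or_lt with hn | hn
  · have : x = y := sub_eq_zero.1 (norm_eq_zero.1 hn.symm)
    simp [g, this] at h0
  · have hn' : 0 < n := hn
    nlinarith

/-- The a priori bound M only makes s = sup |h| finite; inserting m = s in H gives s ≤ γ s + c. This
replaces the inversion of I − γP. -/
lemma abs_le_of_contraction {X : Type*} {h : X → ℝ} {M c γ : ℝ} (hγ1 : γ < 1)
    (hM : ∀ x, |h x| ≤ M) (H : ∀ m, (∀ x, |h x| ≤ m) → ∀ x, |h x| ≤ γ * m + c) (x : X) :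
    |h x| ≤ c / (1 - γ) := by
  have hb : BddAbove (Set.range fun x => |h x|) := ⟨M, Set.forall_mem_range.2 hM⟩
  have : Nonempty X := ⟨x⟩
  have h1 := ciSup_le (H _ fun x => le_ciSup hb x)
  refine (le_ciSup hb x).trans ?_
  rw [le_div_iff₀ (by linarith)]
  linarith

end Smooth

/-! ### Change of measure between nearby policies. -/

section Density

variable {K p q : ℕ} {S A : Type*} [MeasurableSpace S] [MeasurableSpace A]
  {pol : PolicyClass p S A} {φ : Fin K → S × A → Vec q} {Cφ Lφ : ℝ}

/-- Positive densities make the likelihood ratio an exponential of a difference of log densities,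
and the score controls that difference to first order. -/
lemma integral_policyKernel_eq_exp (θ θ' : Vec p) (s : S) (f : A → ℝ) :
    ∫ a, f a ∂(policyKernel pol θ' s) =
      ∫ a, f a * Real.exp (Real.log (pol.dens θ' s a) - Real.log (pol.dens θ s a))
        ∂(policyKernel pol θ s) := by
  rw [integral_policyKernel, integral_policyKernel]
  refine integral_congr_ae (ae_of_all _ fun a => ?_)
  have h := pol.dens_pos θ s a
  simp only [smul_eq_mul]
  rw [Real.exp_sub, Real.exp_log h, Real.exp_log (pol.dens_pos θ' s a)]
  field_simp

lemma measurable_score_left (h : SmoothBounded pol φ Cφ Lφ) (θ : Vec p) (s : S) :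
    Measurable fun a => score pol θ (s, a) :=
  (measurable_score h).comp (measurable_const.prodMk (measurable_const.prodMk measurable_id))

lemma measurable_exp_log_sub (θ θ' : Vec p) (s : S) :
    Measurable fun a => Real.exp (Real.log (pol.dens θ' s a) - Real.log (pol.dens θ s a)) :=
  Real.measurable_exp.comp ((Real.measurable_log.comp (measurable_dens pol θ' s)).sub
    (Real.measurable_log.comp (measurable_dens pol θ s)))

lemma abs_log_dens_sub_le (h : SmoothBounded pol φ Cφ Lφ) (θ d : Vec p) (s : S) (a : A) :
    |Real.log (pol.dens (θ + d) s a) - Real.log (pol.dens θ s a)| ≤ Cφ * ‖d‖ := by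
  have := abs_sub_le_of_gradient (h.1 s a) (C := Cφ) (fun θ => h.2.1 θ (s, a)) θ (θ + d)
  simpa using this

lemma abs_inner_score_le (h : SmoothBounded pol φ Cφ Lφ) (θ d : Vec p) (x : S × A) :
    |inner ℝ (score pol θ x) d| ≤ Cφ * ‖d‖ :=
  (abs_real_inner_le_norm _ _).trans (mul_le_mul_of_nonneg_right (h.2.1 θ x) (norm_nonneg d))

/-- For Cφ‖d‖ ≤ 1 the exponent is in [−1, 1], where |eˣ − 1| ≤ 2|x|. For larger d the trivial bound
2C is already below the claim. -/
lemma abs_integral_policy_sub_le (h : SmoothBounded pol φ Cφ Lφ) (θ d : Vec p)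
    (s : S) {f : A → ℝ} (hf : Measurable f) {C : ℝ} (hC : ∀ a, |f a| ≤ C) :
    |∫ a, f a ∂(policyKernel pol (θ + d) s) - ∫ a, f a ∂(policyKernel pol θ s)| ≤
      C * (2 * Cφ * ‖d‖) := by
  obtain ⟨a₀⟩ := nonempty_of_isProbabilityMeasure (policyKernel pol θ s)
  have hC0 : 0 ≤ C := (abs_nonneg _).trans (hC a₀)
  by_cases hs : Cφ * ‖d‖ ≤ 1
  · have hl := fun a => abs_log_dens_sub_le h θ d s a
    have hb : ∀ a, ‖f a * (Real.exp (Real.log (pol.dens (θ + d) s a) - Real.log (pol.dens θ s a))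
        - 1)‖ ≤ C * (2 * Cφ * ‖d‖) := fun a => by
      rw [norm_mul]
      refine mul_le_mul (hC a) ?_ (norm_nonneg _) hC0
      refine (Real.abs_exp_sub_one_le ((hl a).trans hs)).trans ?_
      linarith [hl a]
    have hm : Measurable fun a => f a *
        (Real.exp (Real.log (pol.dens (θ + d) s a) - Real.log (pol.dens θ s a)) - 1) :=
      hf.mul ((measurable_exp_log_sub θ (θ + d) s).sub_const 1)
    have e : ∫ a, f a ∂(policyKernel pol (θ + d) s) = ∫ a, f a ∂(policyKernel pol θ s) +
        ∫ a, f a * (Real.exp (Real.log (pol.dens (θ + d) s a) - Real.log (pol.dens θ s a)) - 1)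
          ∂(policyKernel pol θ s) := by
      rw [integral_policyKernel_eq_exp θ (θ + d),
        ← integral_add (integrable_of_bound hf hC) (integrable_of_bound hm hb)]
      congr 1; ext a; ring
    rw [e, add_sub_cancel_left]
    exact norm_integral_le_bound hb
  · have h1 := abs_integral_le_bound (μ := policyKernel pol (θ + d) s) hC
    have h2 := abs_integral_le_bound (μ := policyKernel pol θ s) hC
    refine (abs_sub _ _).trans ?_
    nlinarith

/-- For Cφ‖d‖ ≤ 1, the error |eˣ − 1 − x| ≤ x² costs Cφ²‖d‖² and linearizing log π costs Lφ‖d‖²/2.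
The factor 3 is forced by Cφ‖d‖ > 1, where the crude bound C(2 + Cφ‖d‖) is at most 3C(Cφ‖d‖)². -/
lemma abs_integral_policy_sub_sub_le (h : SmoothBounded pol φ Cφ Lφ) (hL : 0 ≤ Lφ) (θ d : Vec p)
    (s : S) {f : A → ℝ} (hf : Measurable f) {C : ℝ} (hC : ∀ a, |f a| ≤ C) :
    |∫ a, f a ∂(policyKernel pol (θ + d) s) - ∫ a, f a ∂(policyKernel pol θ s) -
      ∫ a, f a * inner ℝ (score pol θ (s, a)) d ∂(policyKernel pol θ s)| ≤
      C * ((3 * Cφ ^ 2 + Lφ) * ‖d‖ ^ 2) := by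
  obtain ⟨a₀⟩ := nonempty_of_isProbabilityMeasure (policyKernel pol θ s)
  have hC0 : 0 ≤ C := (abs_nonneg _).trans (hC a₀)
  have hsb := fun a => abs_inner_score_le h θ d (s, a)
  have hsm : Measurable fun a => f a * inner ℝ (score pol θ (s, a)) d :=
    hf.mul ((measurable_score_left h θ s).inner measurable_const)
  have hsc : ∀ a, ‖f a * inner ℝ (score pol θ (s, a)) d‖ ≤ C * (Cφ * ‖d‖) := fun a => by
    rw [norm_mul]; exact mul_le_mul (hC a) (hsb a) (norm_nonneg _) hC0
  by_cases hs : Cφ * ‖d‖ ≤ 1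
  · have hl := fun a => abs_log_dens_sub_le h θ d s a
    have hb : ∀ a, ‖f a * (Real.exp (Real.log (pol.dens (θ + d) s a) - Real.log (pol.dens θ s a))
        - 1 - inner ℝ (score pol θ (s, a)) d)‖ ≤ C * ((3 * Cφ ^ 2 + Lφ) * ‖d‖ ^ 2) := fun a => by
      rw [norm_mul]
      refine mul_le_mul (hC a) ?_ (norm_nonneg _) hC0
      have h1 := abs_le.1 (Real.abs_exp_sub_one_sub_id_le ((hl a).trans hs))
      have h2 := abs_le.1 (abs_sub_inner_gradient_le (h.1 s a) (L := Lφ)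
        (fun x y => h.2.2.2 x y (s, a)) θ d)
      have h3 : (Real.log (pol.dens (θ + d) s a) - Real.log (pol.dens θ s a)) ^ 2 ≤
          (Cφ * ‖d‖) ^ 2 := sq_le_sq' (abs_le.1 (hl a)).1 (abs_le.1 (hl a)).2
      have h4 : 0 ≤ Cφ ^ 2 * ‖d‖ ^ 2 := by positivity
      have h5 : 0 ≤ Lφ * ‖d‖ ^ 2 := by positivity
      rw [Real.norm_eq_abs, abs_le]
      simp only [score]
      constructor <;> nlinarith
    have hm : Measurable fun a => f a *
        (Real.exp (Real.log (pol.dens (θ + d) s a) - Real.log (pol.dens θ s a)) - 1 -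
          inner ℝ (score pol θ (s, a)) d) :=
      hf.mul (((measurable_exp_log_sub θ (θ + d) s).sub_const 1).sub
        ((measurable_score_left h θ s).inner measurable_const))
    have e : ∫ a, f a ∂(policyKernel pol (θ + d) s) - ∫ a, f a ∂(policyKernel pol θ s) -
        ∫ a, f a * inner ℝ (score pol θ (s, a)) d ∂(policyKernel pol θ s) =
        ∫ a, f a * (Real.exp (Real.log (pol.dens (θ + d) s a) - Real.log (pol.dens θ s a)) - 1
          - inner ℝ (score pol θ (s, a)) d) ∂(policyKernel pol θ s) := by
      have hi : Integrable (fun a => f a + f a * inner ℝ (score pol θ (s, a)) d)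
          (policyKernel pol θ s) := (integrable_of_bound hf hC).add (integrable_of_bound hsm hsc)
      rw [integral_policyKernel_eq_exp θ (θ + d), sub_sub, sub_eq_iff_eq_add,
        ← integral_add (integrable_of_bound hf hC) (integrable_of_bound hsm hsc),
        ← integral_add (integrable_of_bound hm hb) hi]
      congr 1; ext a; ring
    rw [e]
    exact abs_integral_le_bound hb
  · have h1 := abs_le.1 (abs_integral_le_bound (μ := policyKernel pol (θ + d) s) hC)
    have h2 := abs_le.1 (abs_integral_le_bound (μ := policyKernel pol θ s) hC)
    have h3 := abs_le.1 (abs_integral_le_bound (μ := policyKernel pol θ s) hsc)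
    have h4 : C * (2 + Cφ * ‖d‖) ≤ C * ((3 * Cφ ^ 2 + Lφ) * ‖d‖ ^ 2) := by
      refine mul_le_mul_of_nonneg_left ?_ hC0
      have h5 : 0 ≤ Lφ * ‖d‖ ^ 2 := by positivity
      nlinarith
    rw [abs_le]
    constructor <;> linarith

end Density

/-! ### Policy gradient formula and smoothness of the objectives. -/

section PolicyGradient

variable {K p q : ℕ} {S A : Type*} [MeasurableSpace S] [MeasurableSpace A]
  {M : MultiTaskMDP K S A} {pol : PolicyClass p S A} {φ : Fin K → S × A → Vec q} {Cφ Lφ γ : ℝ}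
  {k : Fin K}

lemma abs_reward_le (M : MultiTaskMDP K S A) (k : Fin K) (x : S × A) : |M.reward k x| ≤ 1 := by
  have := M.reward_mem k x
  rw [abs_of_nonneg this.1]; exact this.2

lemma abs_Q_le (hγ0 : 0 ≤ γ) (hγ1 : γ < 1) (θ : Vec p) (x : S × A) :
    |Q γ M pol k θ x| ≤ 1 / (1 - γ) :=
  abs_resolvent_le M pol k hγ0 hγ1 (abs_reward_le M k) θ x

lemma measurable_Q_uncurry : Measurable fun z : Vec p × (S × A) => Q γ M pol k z.1 z.2 :=
  measurable_resolvent M pol k (M.reward_measurable k)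

lemma measurable_Q (θ : Vec p) : Measurable (Q γ M pol k θ) :=
  measurable_Q_uncurry.comp (measurable_const.prodMk measurable_id)

lemma measurable_resolvent_right {f : S × A → ℝ} (hf : Measurable f) (θ : Vec p) :
    Measurable (resolvent γ M pol k θ f) :=
  (measurable_resolvent M pol k hf).comp (measurable_const.prodMk measurable_id)

lemma measurable_integral_policy {f : S × A → ℝ} (hf : Measurable f) (θ : Vec p) :
    Measurable fun s => ∫ a, f (s, a) ∂(policyKernel pol θ s) :=
  measurable_integral_param (Kernel.measurable _) (fun _ => inferInstance)
    (f := fun s a => f (s, a)) hf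

lemma measurable_section {E : Type*} [MeasurableSpace E] {f : S × A → E} (hf : Measurable f)
    (s : S) : Measurable fun a => f (s, a) :=
  hf.comp measurable_prodMk_left

lemma integral_resolvent_init (hγ0 : 0 ≤ γ) (hγ1 : γ < 1) {f : S × A → ℝ} (hf : Measurable f)
    {C : ℝ} (hC : ∀ x, |f x| ≤ C) (θ : Vec p) :
    ∫ s, ∫ a, resolvent γ M pol k θ f (s, a) ∂(policyKernel pol θ s) ∂(M.init k) =
      ∑' t : ℕ, γ ^ t * ∫ x, f x ∂(lawAt M pol k θ t) := by
  have hm : ∀ t, Measurable fun x : S × A => ∫ y, f y ∂(chainIter M pol k θ t x) := fun t =>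
    measurable_integral_param (Kernel.measurable _) (fun _ => inferInstance)
      (f := fun _ y => f y) (hf.comp measurable_snd)
  have hb : ∀ t (x : S × A), |∫ y, f y ∂(chainIter M pol k θ t x)| ≤ C := fun t x =>
    abs_integral_le_bound hC
  simp only [resolvent]
  calc _ = ∫ s, ∑' t : ℕ, γ ^ t * ∫ x, ∫ y, f y ∂(chainIter M pol k θ t x) ∂(actKernel pol θ s)
        ∂(M.init k) := by
        refine integral_congr_ae (ae_of_all _ fun s => ?_)
        simp only
        rw [integral_tsum_geometric hγ0 hγ1 (C := C)
          (g := fun t a => ∫ y, f y ∂(chainIter M pol k θ t (s, a)))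
          (fun t => measurable_section (hm t) s) (fun t a => hb t _)]
        congr 1; ext t
        rw [integral_actKernel pol θ s (hm t)]
    _ = _ := by
        rw [integral_tsum_geometric hγ0 hγ1 (C := C)
          (g := fun t s => ∫ x, ∫ y, f y ∂(chainIter M pol k θ t x) ∂(actKernel pol θ s))
          (fun t => measurable_integral_param (Kernel.measurable _) (fun _ => inferInstance)
            (f := fun _ y => ∫ z, f z ∂(chainIter M pol k θ t y)) ((hm t).comp measurable_snd))
          (fun t s => abs_integral_le_bound (hb t))]
        congr 1; ext t
        rw [integral_lawAt M pol k hf hC]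

lemma J_eq (hγ0 : 0 ≤ γ) (hγ1 : γ < 1) (θ : Vec p) :
    J γ M pol k θ = ∫ s, ∫ a, Q γ M pol k θ (s, a) ∂(policyKernel pol θ s) ∂(M.init k) :=
  (integral_resolvent_init hγ0 hγ1 (M.reward_measurable k) (abs_reward_le M k) θ).symm

/-- Dividing by 1 − γ undoes the normalization of the visitation law and leaves the discounted sum
of means along the chain. This links the policy gradient to a resolvent. -/
lemma integral_visitation_eq (hγ0 : 0 ≤ γ) (hγ1 : γ < 1) {f : S × A → ℝ} (hf : Measurable f)
    {C : ℝ} (hC : ∀ x, |f x| ≤ C) (θ : Vec p) :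
    (1 / (1 - γ)) * ∫ x, f x ∂(visitation γ M pol k θ) =
      ∫ s, ∫ a, resolvent γ M pol k θ f (s, a) ∂(policyKernel pol θ s) ∂(M.init k) := by
  rw [integral_resolvent_init hγ0 hγ1 hf hC,
    ← (integral_visitation γ M pol k hγ0 hγ1 hf hC θ).tsum_eq, ← tsum_mul_left]
  congr 1; ext t
  have : (1 - γ) ≠ 0 := by linarith
  rw [smul_eq_mul]; field_simp

lemma Q_eq (hγ0 : 0 ≤ γ) (hγ1 : γ < 1) (θ : Vec p) (x : S × A) :
    Q γ M pol k θ x = M.reward k x +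
      γ * ∫ s, ∫ a, Q γ M pol k θ (s, a) ∂(policyKernel pol θ s) ∂(M.trans k x) := by
  rw [← integral_chain M pol k (measurable_Q θ) (abs_Q_le hγ0 hγ1 θ)]
  exact resolvent_eq M pol k hγ0 hγ1 (M.reward_measurable k) (abs_reward_le M k) θ x

/-- The policy gradient `(1 - γ)⁻¹ E_d[Q ψ]`. -/
noncomputable def policyGrad (γ : ℝ) (M : MultiTaskMDP K S A) (pol : PolicyClass p S A)
    (k : Fin K) (θ : Vec p) : Vec p :=
  (1 / (1 - γ)) • ∫ x, Q γ M pol k θ x • score pol θ x ∂(visitation γ M pol k θ)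

lemma measurable_score_right (h : SmoothBounded pol φ Cφ Lφ) (θ : Vec p) :
    Measurable (score pol θ) :=
  (measurable_score h).comp (measurable_const.prodMk measurable_id)

lemma norm_Q_smul_score_le (h : SmoothBounded pol φ Cφ Lφ) (hγ0 : 0 ≤ γ) (hγ1 : γ < 1)
    (θ : Vec p) (x : S × A) : ‖Q γ M pol k θ x • score pol θ x‖ ≤ 1 / (1 - γ) * Cφ := by
  rw [norm_smul]
  have : 0 < 1 - γ := by linarith
  exact mul_le_mul (abs_Q_le hγ0 hγ1 θ x) (h.2.1 θ x) (norm_nonneg _) (by positivity)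

lemma inner_policyGrad (h : SmoothBounded pol φ Cφ Lφ) (hγ0 : 0 ≤ γ) (hγ1 : γ < 1)
    (θ d : Vec p) :
    inner ℝ (policyGrad γ M pol k θ) d = (1 / (1 - γ)) *
      ∫ x, Q γ M pol k θ x * inner ℝ (score pol θ x) d ∂(visitation γ M pol k θ) := by
  have := isProb_visitation M pol k hγ0 hγ1 θ
  rw [policyGrad, real_inner_smul_left, real_inner_comm, ← integral_inner]
  · simp_rw [inner_smul_right, real_inner_comm d]
  · exact integrable_of_bound ((measurable_Q θ).smul (measurable_score_right h θ))
      (norm_Q_smul_score_le h hγ0 hγ1 θ)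

/-- The constant of the quadratic remainder of `J`. -/
noncomputable def remainderConst (γ Cφ Lφ : ℝ) : ℝ :=
  (4 * (1 / (1 - γ)) ^ 2 * Cφ ^ 2 + 1 / (1 - γ) * (3 * Cφ ^ 2 + Lφ)) * (1 / (1 - γ) + 1)

lemma integral_sub_of_bound {X : Type*} [MeasurableSpace X] {μ : Measure X}
    [IsProbabilityMeasure μ] {f g : X → ℝ} (hf : Measurable f) (hg : Measurable g) {C D : ℝ}
    (hC : ∀ x, |f x| ≤ C) (hD : ∀ x, |g x| ≤ D) :
    ∫ x, (f x - g x) ∂μ = ∫ x, f x ∂μ - ∫ x, g x ∂μ :=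
  integral_sub (integrable_of_bound hf hC) (integrable_of_bound hg hD)

lemma integral_add_of_bound {X : Type*} [MeasurableSpace X] {μ : Measure X}
    [IsProbabilityMeasure μ] {f g : X → ℝ} (hf : Measurable f) (hg : Measurable g) {C D : ℝ}
    (hC : ∀ x, |f x| ≤ C) (hD : ∀ x, |g x| ≤ D) :
    ∫ x, (f x + g x) ∂μ = ∫ x, f x ∂μ + ∫ x, g x ∂μ :=
  integral_add (integrable_of_bound hf hC) (integrable_of_bound hg hD)

/-- Subtracting the Bellman equations leaves γ times the averaged change of the state value. That
change splits into the mean of Q_{θ+d} − Q_θ under the new policy, which the contraction absorbs,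
and the effect of changing the policy in the mean of Q_θ. -/
lemma abs_Q_sub_le (h : SmoothBounded pol φ Cφ Lφ) (hγ0 : 0 ≤ γ) (hγ1 : γ < 1)
    (hCφ : 0 ≤ Cφ) (θ d : Vec p) (x : S × A) :
    |Q γ M pol k (θ + d) x - Q γ M pol k θ x| ≤ 2 * (1 / (1 - γ)) ^ 2 * Cφ * ‖d‖ := by
  have hb := fun θ x => abs_Q_le (M := M) (pol := pol) (k := k) hγ0 hγ1 θ x
  have hg : 0 < 1 - γ := by linarith
  have key := abs_le_of_contraction (h := fun x => Q γ M pol k (θ + d) x - Q γ M pol k θ x)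
    (M := 1 / (1 - γ) + 1 / (1 - γ)) (c := 1 / (1 - γ) * (2 * Cφ * ‖d‖)) hγ1
    (fun x => (abs_sub _ _).trans (add_le_add (hb _ x) (hb _ x))) ?_ x
  · refine key.trans (le_of_eq ?_); ring
  intro m hm x
  rw [Q_eq hγ0 hγ1 (θ + d) x, Q_eq hγ0 hγ1 θ x, add_sub_add_left_eq_sub, ← mul_sub,
    ← integral_sub_of_bound (measurable_integral_policy (measurable_Q _) _)
      (measurable_integral_policy (measurable_Q _) _) (fun s => abs_integral_le_bound fun a => hb _ _)
      (fun s => abs_integral_le_bound fun a => hb _ _), abs_mul, abs_of_nonneg hγ0]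
  have h1 : ∀ s, |∫ a, Q γ M pol k (θ + d) (s, a) ∂(policyKernel pol (θ + d) s) -
      ∫ a, Q γ M pol k θ (s, a) ∂(policyKernel pol θ s)| ≤
      m + 1 / (1 - γ) * (2 * Cφ * ‖d‖) := fun s => by
    have e1 := abs_integral_policy_sub_le h θ d s (measurable_section (measurable_Q (M := M)
      (γ := γ) (k := k) θ) s) (fun a => hb θ (s, a))
    have e2 := abs_integral_le_bound (μ := policyKernel pol (θ + d) s) fun a => hm (s, a)
    rw [integral_sub_of_bound (measurable_section (measurable_Q _) s)
      (measurable_section (measurable_Q _) s) (fun a => hb _ (s, a)) (fun a => hb _ (s, a))] at e2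
    have := (abs_add_le _ _).trans (add_le_add e2 e1)
    rwa [sub_add_sub_cancel] at this
  have h2 := abs_integral_le_bound (μ := M.trans k x) h1
  have h3 : 0 ≤ 1 / (1 - γ) * (2 * Cφ * ‖d‖) := by positivity
  nlinarith

/-- The increment D of Q and the perturbation F = Q⟨ψ, d⟩ satisfy the resolvent equation of F up to
a second order error R in the state values. Hence D + F is close to the resolvent U of F, and U
averaged over the initial law is exactly ⟨`policyGrad`, d⟩. No derivative is taken under an
integral. -/
lemma abs_J_sub_sub_le (h : SmoothBounded pol φ Cφ Lφ) (hγ0 : 0 ≤ γ) (hγ1 : γ < 1)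
    (hCφ : 0 ≤ Cφ) (hLφ : 0 ≤ Lφ) (θ d : Vec p) :
    |J γ M pol k (θ + d) - J γ M pol k θ - inner ℝ (policyGrad γ M pol k θ) d| ≤
      remainderConst γ Cφ Lφ * ‖d‖ ^ 2 := by
  have hg : 0 < 1 - γ := by linarith
  set b := 1 / (1 - γ) with hbdef
  have hb0 : 0 ≤ b := by positivity
  have hQ := fun θ x => abs_Q_le (M := M) (pol := pol) (k := k) hγ0 hγ1 θ x
  have mQ := fun θ => measurable_Q (M := M) (pol := pol) (k := k) (γ := γ) θ
  let D : S × A → ℝ := fun x => Q γ M pol k (θ + d) x - Q γ M pol k θ x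
  let F : S × A → ℝ := fun x => Q γ M pol k θ x * inner ℝ (score pol θ x) d
  let V : Vec p → S → ℝ := fun η s => ∫ a, Q γ M pol k η (s, a) ∂(policyKernel pol η s)
  let W : S → ℝ := fun s => ∫ a, (D (s, a) + F (s, a)) ∂(policyKernel pol θ s)
  let R : S → ℝ := fun s => V (θ + d) s - V θ s - W s
  let U : S × A → ℝ := resolvent γ M pol k θ F
  -- The first part is the change of policy applied to D, of size 2b²Cφ‖d‖ · 2Cφ‖d‖; the second is
  -- the second order error of the policy change applied to Q_θ, with |Q_θ| ≤ b.
  set c := (4 * b ^ 2 * Cφ ^ 2 + b * (3 * Cφ ^ 2 + Lφ)) * ‖d‖ ^ 2 with hc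
  have hD : ∀ x, |D x| ≤ 2 * b ^ 2 * Cφ * ‖d‖ := abs_Q_sub_le h hγ0 hγ1 hCφ θ d
  have hF : ∀ x, |F x| ≤ b * (Cφ * ‖d‖) := fun x => by
    rw [abs_mul]
    exact mul_le_mul (hQ θ x) (abs_inner_score_le h θ d x) (abs_nonneg _) hb0
  have mD : Measurable D := (mQ _).sub (mQ _)
  have mF : Measurable F := (mQ θ).mul ((measurable_score_right h θ).inner measurable_const)
  have hV : ∀ η s, |V η s| ≤ b := fun η s => abs_integral_le_bound fun a => hQ _ _
  have mV : ∀ η, Measurable (V η) := fun η => measurable_integral_policy (mQ η) η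
  have hDF : ∀ x, |D x + F x| ≤ 2 * b ^ 2 * Cφ * ‖d‖ + b * (Cφ * ‖d‖) := fun x =>
    (abs_add_le _ _).trans (add_le_add (hD x) (hF x))
  have hW : ∀ s, |W s| ≤ 2 * b ^ 2 * Cφ * ‖d‖ + b * (Cφ * ‖d‖) := fun s =>
    abs_integral_le_bound fun a => hDF _
  have mW : Measurable W := measurable_integral_policy (mD.add mF) θ
  have hU : ∀ x, |U x| ≤ b * (Cφ * ‖d‖) / (1 - γ) := abs_resolvent_le M pol k hγ0 hγ1 hF θ
  have mU : Measurable U := measurable_resolvent_right mF θ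
  have mR : Measurable R := ((mV _).sub (mV _)).sub mW
  have hR : ∀ s, |R s| ≤ c := fun s => by
    have e1 := abs_integral_policy_sub_le h θ d s (measurable_section mD s) (fun a => hD (s, a))
    have e2 := abs_integral_policy_sub_sub_le h hLφ θ d s (measurable_section (mQ θ) s)
      (fun a => hQ θ (s, a))
    have e3 : R s = (∫ a, D (s, a) ∂(policyKernel pol (θ + d) s) -
        ∫ a, D (s, a) ∂(policyKernel pol θ s)) +
        (∫ a, Q γ M pol k θ (s, a) ∂(policyKernel pol (θ + d) s) -
          ∫ a, Q γ M pol k θ (s, a) ∂(policyKernel pol θ s) -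
          ∫ a, Q γ M pol k θ (s, a) * inner ℝ (score pol θ (s, a)) d ∂(policyKernel pol θ s)) := by
      have e4 : W s = ∫ a, D (s, a) ∂(policyKernel pol θ s) +
          ∫ a, F (s, a) ∂(policyKernel pol θ s) :=
        integral_add_of_bound (measurable_section mD s) (measurable_section mF s)
          (fun a => hD (s, a)) (fun a => hF (s, a))
      have e5 : ∫ a, D (s, a) ∂(policyKernel pol (θ + d) s) = V (θ + d) s -
          ∫ a, Q γ M pol k θ (s, a) ∂(policyKernel pol (θ + d) s) :=
        integral_sub_of_bound (measurable_section (mQ _) s) (measurable_section (mQ _) s)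
          (fun a => hQ _ (s, a)) (fun a => hQ _ (s, a))
      simp only [R]
      rw [e4, e5]
      simp only [V, F]
      ring
    rw [e3]
    refine (abs_add_le _ _).trans ((add_le_add e1 e2).trans (le_of_eq ?_))
    rw [hc]; ring
  have hVR : ∀ s, V (θ + d) s - V θ s = W s + R s := fun s => by simp only [R]; ring
  have hint : ∀ (μ : Measure S) [IsProbabilityMeasure μ],
      ∫ s, V (θ + d) s ∂μ - ∫ s, V θ s ∂μ = ∫ s, W s ∂μ + ∫ s, R s ∂μ := fun μ _ => by
    rw [← integral_sub_of_bound (mV _) (mV _) (hV _) (hV _), ← integral_add_of_bound mW mR hW hR]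
    simp_rw [hVR]
  have hUx : ∀ x, U x = F x + γ * ∫ s, ∫ a, U (s, a) ∂(policyKernel pol θ s) ∂(M.trans k x) :=
    fun x => by
      rw [← integral_chain M pol k mU hU]
      exact resolvent_eq M pol k hγ0 hγ1 mF hF θ x
  let H : S × A → ℝ := fun x => D x + F x - U x
  have mH : Measurable H := (mD.add mF).sub mU
  have hHbd : ∀ x, |H x| ≤ 2 * b ^ 2 * Cφ * ‖d‖ + b * (Cφ * ‖d‖) + b * (Cφ * ‖d‖) / (1 - γ) :=
    fun x => (abs_sub _ _).trans (add_le_add (hDF x) (hU x))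
  have hWU : ∀ s, W s - ∫ a, U (s, a) ∂(policyKernel pol θ s) =
      ∫ a, H (s, a) ∂(policyKernel pol θ s) := fun s =>
    (integral_sub_of_bound (measurable_section (mD.add mF) s) (measurable_section mU s)
      (fun a => hDF _) (fun a => hU _)).symm
  have mUs : Measurable fun s => ∫ a, U (s, a) ∂(policyKernel pol θ s) :=
    measurable_integral_policy mU θ
  have hWUint : ∀ (μ : Measure S) [IsProbabilityMeasure μ],
      ∫ s, W s ∂μ - ∫ s, ∫ a, U (s, a) ∂(policyKernel pol θ s) ∂μ =
        ∫ s, ∫ a, H (s, a) ∂(policyKernel pol θ s) ∂μ := fun μ _ => by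
    rw [← integral_sub_of_bound mW mUs hW (fun s => abs_integral_le_bound fun a => hU _)]
    simp_rw [hWU]
  -- Both D + F and U have source F, so it cancels: H = γP(EH + R), with P the transition and E the
  -- mean over actions under θ. Contraction then bounds H by the size of R.
  have hH : ∀ x, |H x| ≤ c / (1 - γ) := by
    refine abs_le_of_contraction hγ1 hHbd fun m hm x => ?_
    have e1 : H x = γ * (∫ s, ∫ a, H (s, a) ∂(policyKernel pol θ s) ∂(M.trans k x) +
        ∫ s, R s ∂(M.trans k x)) := by
      have e2 : D x = γ * (∫ s, V (θ + d) s ∂(M.trans k x) - ∫ s, V θ s ∂(M.trans k x)) := by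
        simp only [D, V]
        rw [Q_eq hγ0 hγ1 (θ + d) x, Q_eq hγ0 hγ1 θ x]; ring
      rw [hint] at e2
      simp only [H]
      rw [e2, hUx x, ← hWUint]
      ring
    have h1 := abs_integral_le_bound (μ := M.trans k x) (f := fun s =>
      ∫ a, H (s, a) ∂(policyKernel pol θ s)) fun s => abs_integral_le_bound fun a => hm (s, a)
    have h2 := abs_integral_le_bound (μ := M.trans k x) hR
    rw [e1, abs_mul, abs_of_nonneg hγ0]
    have h3 := (abs_add_le _ _).trans (add_le_add h1 h2)
    have h4 : 0 ≤ c := by positivity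
    nlinarith
  have hJ : J γ M pol k (θ + d) - J γ M pol k θ - inner ℝ (policyGrad γ M pol k θ) d =
      ∫ s, ∫ a, H (s, a) ∂(policyKernel pol θ s) ∂(M.init k) + ∫ s, R s ∂(M.init k) := by
    rw [J_eq hγ0 hγ1, J_eq hγ0 hγ1, inner_policyGrad h hγ0 hγ1,
      integral_visitation_eq hγ0 hγ1 mF hF, ← hWUint, hint]
    ring
  rw [hJ]
  have h1 := abs_integral_le_bound (μ := M.init k) (f := fun s =>
      ∫ a, H (s, a) ∂(policyKernel pol θ s)) fun s => abs_integral_le_bound fun a => hH (s, a)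
  have h2 := abs_integral_le_bound (μ := M.init k) hR
  refine (abs_add_le _ _).trans ((add_le_add h1 h2).trans (le_of_eq ?_))
  rw [remainderConst, hc, ← hbdef, hbdef]
  ring

lemma remainderConst_nonneg (hγ1 : γ < 1) (hLφ : 0 ≤ Lφ) :
    0 ≤ remainderConst γ Cφ Lφ := by
  have hg : 0 < 1 - γ := by linarith
  unfold remainderConst; positivity

lemma hasGradientAt_J (h : SmoothBounded pol φ Cφ Lφ) (hγ0 : 0 ≤ γ) (hγ1 : γ < 1)
    (hCφ : 0 ≤ Cφ) (hLφ : 0 ≤ Lφ) (θ : Vec p) :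
    HasGradientAt (J γ M pol k) (policyGrad γ M pol k θ) θ :=
  hasGradientAt_of_quadratic (abs_J_sub_sub_le h hγ0 hγ1 hCφ hLφ) θ

lemma norm_gradient_J_sub_le (h : SmoothBounded pol φ Cφ Lφ) (hγ0 : 0 ≤ γ) (hγ1 : γ < 1)
    (hCφ : 0 ≤ Cφ) (hLφ : 0 ≤ Lφ) (k : Fin K) (θ θ' : Vec p) :
    ‖gradient (J γ M pol k) θ - gradient (J γ M pol k) θ'‖ ≤
      6 * remainderConst γ Cφ Lφ * ‖θ - θ'‖ := by
  rw [(hasGradientAt_J h hγ0 hγ1 hCφ hLφ θ).gradient, (hasGradientAt_J h hγ0 hγ1 hCφ hLφ θ').gradient]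
  exact norm_sub_le_of_quadratic (remainderConst_nonneg hγ1 hLφ)
    (abs_J_sub_sub_le h hγ0 hγ1 hCφ hLφ) θ θ'

lemma norm_gradient_J_le (h : SmoothBounded pol φ Cφ Lφ) (hγ0 : 0 ≤ γ) (hγ1 : γ < 1)
    (hCφ : 0 ≤ Cφ) (hLφ : 0 ≤ Lφ) (k : Fin K) (θ : Vec p) :
    ‖gradient (J γ M pol k) θ‖ ≤ 1 / (1 - γ) * (1 / (1 - γ) * Cφ) := by
  have := isProb_visitation M pol k hγ0 hγ1 θ
  have hg : 0 < 1 - γ := by linarith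
  rw [(hasGradientAt_J h hγ0 hγ1 hCφ hLφ θ).gradient, policyGrad, norm_smul,
    Real.norm_of_nonneg (by positivity)]
  exact mul_le_mul_of_nonneg_left (norm_integral_le_bound (norm_Q_smul_score_le h hγ0 hγ1 θ))
    (by positivity)

lemma gradLip_le (h : SmoothBounded pol φ Cφ Lφ) (hγ0 : 0 ≤ γ) (hγ1 : γ < 1)
    (hCφ : 0 ≤ Cφ) (hLφ : 0 ≤ Lφ) : gradLip γ M pol ≤ 6 * remainderConst γ Cφ Lφ :=
  csInf_le ⟨0, fun _ hL => hL.1⟩ ⟨mul_nonneg (by norm_num) (remainderConst_nonneg hγ1 hLφ),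
    norm_gradient_J_sub_le h hγ0 hγ1 hCφ hLφ⟩

lemma gradLip_nonneg : 0 ≤ gradLip γ M pol := Real.sInf_nonneg fun _ hL => hL.1

/-- The infimum is attained because the admissible set is nonempty by `norm_gradient_J_sub_le`; for
an empty set `sInf` would give the default value 0. -/
lemma norm_gradient_sub_le_gradLip (h : SmoothBounded pol φ Cφ Lφ) (hγ0 : 0 ≤ γ) (hγ1 : γ < 1)
    (hCφ : 0 ≤ Cφ) (hLφ : 0 ≤ Lφ) (k : Fin K) (θ θ' : Vec p) :
    ‖gradient (J γ M pol k) θ - gradient (J γ M pol k) θ'‖ ≤ gradLip γ M pol * ‖θ - θ'‖ := by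
  rcases (norm_nonneg (θ - θ')).eq_or_lt with h0 | h0
  · have : θ = θ' := sub_eq_zero.1 (norm_eq_zero.1 h0.symm)
    simp [this]
  · rw [← div_le_iff₀ h0]
    refine le_csInf ⟨_, mul_nonneg (by norm_num) (remainderConst_nonneg hγ1 hLφ),
      norm_gradient_J_sub_le h hγ0 hγ1 hCφ hLφ⟩ fun L hL => ?_
    rw [div_le_iff₀ h0]
    exact hL.2 k θ θ'

lemma J_mem_Icc (hγ0 : 0 ≤ γ) (hγ1 : γ < 1) (θ : Vec p) :
    0 ≤ J γ M pol k θ ∧ J γ M pol k θ ≤ 1 / (1 - γ) := by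
  refine ⟨tsum_nonneg fun t => mul_nonneg (pow_nonneg hγ0 t)
    (integral_nonneg fun x => (M.reward_mem k x).1), ?_⟩
  rw [J_eq hγ0 hγ1]
  exact (le_abs_self _).trans (abs_integral_le_bound fun s => abs_integral_le_bound fun a =>
    abs_Q_le hγ0 hγ1 θ _)

end PolicyGradient

/-! ### Almost sure statements under mixtures, sums of integrals, the harmonic sum. -/

section Generic

variable {X Y : Type*} [MeasurableSpace X] [MeasurableSpace Y]

lemma ae_bind {μ : Measure X} {κ : X → Measure Y} (hκ : Measurable κ) {E : Set Y}
    (hE : MeasurableSet E) (h : ∀ᵐ x ∂μ, ∀ᵐ y ∂(κ x), y ∈ E) : ∀ᵐ y ∂(μ.bind κ), y ∈ E := by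
  change μ.bind κ Eᶜ = 0
  rw [Measure.bind_apply hE.compl hκ.aemeasurable, lintegral_eq_zero_iff
    (f := fun x => κ x Eᶜ) ((Measure.measurable_coe hE.compl).comp hκ)]
  exact h

lemma integral_tsum_of_bound {μ : Measure X} [IsProbabilityMeasure μ] {g : ℕ → X → ℝ}
    {a : ℕ → ℝ} (ha : Summable a) (hg : ∀ t, Measurable (g t)) (hC : ∀ t x, |g t x| ≤ a t) :
    ∫ x, ∑' t, g t x ∂μ = ∑' t, ∫ x, g t x ∂μ := by
  rw [← integral_tsum_of_summable_integral_norm]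
  · exact fun t => integrable_of_bound (hg t) (hC t)
  · refine Summable.of_norm_bounded ha fun t => norm_integral_le_bound fun x => ?_
    rw [norm_norm]; exact hC t x

/-- Telescoping 1/(N + 1) ≤ 1/√(N + 1) ≤ 2(√(N + 1) − √N). This is weaker than a logarithm but
suffices for a rate 1/√N after division by N. -/
lemma sum_one_div_succ_le (N : ℕ) :
    ∑ j ∈ Finset.range N, 1 / ((j : ℝ) + 1) ≤ 2 * Real.sqrt N := by
  induction N with
  | zero => simp
  | succ N ih =>
    rw [Finset.sum_range_succ]
    refine (add_le_add_left ih _).trans ?_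
    push_cast
    set a := Real.sqrt N with ha
    set b := Real.sqrt ((N : ℝ) + 1) with hb
    have ha2 : a ^ 2 = N := Real.sq_sqrt (Nat.cast_nonneg N)
    have hb2 : b ^ 2 = N + 1 := Real.sq_sqrt (by positivity)
    have ha0 : 0 ≤ a := Real.sqrt_nonneg _
    have hb1 : 1 ≤ b := Real.one_le_sqrt.2 (by simp)
    have hab : a ≤ b := Real.sqrt_le_sqrt (by linarith)
    have h1 : 1 / ((N : ℝ) + 1) ≤ 2 * (b - a) := by
      rw [← hb2, div_le_iff₀ (by positivity)]
      nlinarith [mul_nonneg (sub_nonneg.2 hab) (show 0 ≤ 2 * b ^ 2 - a - b by nlinarith)]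
    linarith

end Generic

/-! ### The critic step as a measurable kernel, in both sampling modes. -/

section Critic

variable {K p q : ℕ} {S A : Type*} [MeasurableSpace S] [MeasurableSpace A]
  {M : MultiTaskMDP K S A} {pol : PolicyClass p S A} {φ : Fin K → S × A → Vec q}
  {Cφ Lφ γ B lamA : ℝ} {k : Fin K}

lemma measurable_proj_ball (hB : 0 ≤ B) :
    Measurable (proj (Metric.closedBall (0 : Vec q) B)) :=
  measurable_proj ⟨0, by simpa using hB⟩ Metric.isClosed_closedBall (convex_closedBall _ _)

lemma proj_ball_mem (hB : 0 ≤ B) (w : Vec q) :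
    ‖proj (Metric.closedBall (0 : Vec q) B) w‖ ≤ B := by
  simpa using (proj_spec (C := Metric.closedBall (0 : Vec q) B) ⟨0, by simpa using hB⟩
    Metric.isClosed_closedBall (convex_closedBall _ _) w).1

lemma proj_ball_of_norm_le {w : Vec q} (hw : ‖w‖ ≤ B) :
    proj (Metric.closedBall (0 : Vec q) B) w = w :=
  proj_of_mem Metric.isClosed_closedBall (convex_closedBall _ _) (by simpa using hw)

/-- The temporal difference direction `δ φ(s, a)`. -/
noncomputable def tdDir (γ : ℝ) (M : MultiTaskMDP K S A) (φ : Fin K → S × A → Vec q)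
    (k : Fin K) (w : Vec q) (x y : S × A) : Vec q :=
  (M.reward k x + γ * inner ℝ (φ k y) w - inner ℝ (φ k x) w) • φ k x

lemma tdUpdate_eq (j : ℕ) (w : Vec q) (x y : S × A) :
    tdUpdate γ B lamA M φ k j w x y = proj (Metric.closedBall 0 B)
      (w + (1 / (2 * lamA * (j + 1))) • tdDir γ M φ k w x y) := by
  rw [tdUpdate, tdDir, smul_smul]

lemma measurable_tdDir (hφ : Measurable (φ k)) :
    Measurable fun z : Vec q × (S × A) × (S × A) => tdDir γ M φ k z.1 z.2.1 z.2.2 := by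
  have := M.reward_measurable k
  unfold tdDir
  fun_prop

lemma measurable_tdUpdate (hB : 0 ≤ B) (hφ : Measurable (φ k)) (j : ℕ) :
    Measurable fun z : Vec q × (S × A) × (S × A) =>
      tdUpdate γ B lamA M φ k j z.1 z.2.1 z.2.2 := by
  simp_rw [tdUpdate_eq]
  exact (measurable_proj_ball hB).comp
    (measurable_fst.add ((measurable_tdDir hφ).const_smul (1 / (2 * lamA * ((j : ℝ) + 1)))))

/-- The joint law of the TD successor of `x` and of the next pair of the critic loop. -/
noncomputable def pairLaw (γ : ℝ) (M : MultiTaskMDP K S A) (pol : PolicyClass p S A) (k : Fin K)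
    (θ : Vec p) (x : S × A) : CriticSampling → Measure ((S × A) × (S × A))
  | .trajectory => (chain M pol k θ x).map fun y => (y, y)
  | .independent => (chain M pol k θ x).prod (visitation γ M pol k θ)

lemma isProb_pairLaw (hγ0 : 0 ≤ γ) (hγ1 : γ < 1) (mode : CriticSampling) (θ : Vec p)
    (x : S × A) : IsProbabilityMeasure (pairLaw γ M pol k θ x mode) := by
  have := isProb_visitation M pol k hγ0 hγ1 θ
  cases mode
  · exact Measure.isProbabilityMeasure_map (by fun_prop)
  · unfold pairLaw; infer_instance

lemma measurable_pairLaw (hγ0 : 0 ≤ γ) (hγ1 : γ < 1) (mode : CriticSampling) :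
    Measurable fun z : Vec p × (S × A) => pairLaw γ M pol k z.1 z.2 mode := by
  cases mode
  · exact measurable_map_param (measurable_chain M pol k) (fun _ => inferInstance)
      (f := fun _ y => (y, y)) (by fun_prop)
  · exact measurable_prod_param (measurable_chain M pol k) (fun _ => inferInstance)
      ((measurable_visitation γ M pol k).comp measurable_fst)
      (fun z => isProb_visitation M pol k hγ0 hγ1 z.1)

lemma map_fst_pairLaw (hγ0 : 0 ≤ γ) (hγ1 : γ < 1) (mode : CriticSampling) (θ : Vec p)
    (x : S × A) : (pairLaw γ M pol k θ x mode).map Prod.fst = chain M pol k θ x := by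
  have := isProb_visitation M pol k hγ0 hγ1 θ
  cases mode
  · rw [pairLaw, Measure.map_map measurable_fst (by fun_prop)]
    exact Measure.map_id
  · rw [pairLaw, Measure.map_fst_prod]; simp

/-- Writing both modes through `pairLaw` lets one Lyapunov argument serve them; only the solution of
the Poisson equation will depend on the mode. -/
lemma criticStep_eq (hB : 0 ≤ B) (hφ : Measurable (φ k)) (mode : CriticSampling) (θ : Vec p)
    (j : ℕ) (v : Vec q × (S × A)) :
    criticStep γ B lamA M pol φ k θ j v mode = (pairLaw γ M pol k θ v.2 mode).map fun y =>
      (tdUpdate γ B lamA M φ k j v.1 v.2 y.1, y.2) := by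
  cases mode
  · have : Measurable fun y : (S × A) × (S × A) =>
        (tdUpdate γ B lamA M φ k j v.1 v.2 y.1, y.2) :=
      ((measurable_tdUpdate hB hφ j).comp (f := fun y : (S × A) × (S × A) => (v.1, v.2, y.1))
        (by fun_prop)).prodMk measurable_snd
    rw [pairLaw, Measure.map_map this (by fun_prop)]
    rfl
  · rfl

lemma measurable_criticStep (hγ0 : 0 ≤ γ) (hγ1 : γ < 1) (hB : 0 ≤ B) (hφ : Measurable (φ k))
    (mode : CriticSampling) (j : ℕ) : Measurable fun z : Vec p × (Vec q × (S × A)) =>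
      criticStep γ B lamA M pol φ k z.1 j z.2 mode := by
  simp_rw [criticStep_eq hB hφ]
  refine measurable_map_param (μ := fun z : Vec p × (Vec q × (S × A)) =>
      pairLaw γ M pol k z.1 z.2.2 mode) ((measurable_pairLaw hγ0 hγ1 mode).comp
      (f := fun z : Vec p × (Vec q × (S × A)) => (z.1, z.2.2)) (by fun_prop))
    (fun z => isProb_pairLaw hγ0 hγ1 mode _ _)
    (f := fun z y => (tdUpdate γ B lamA M φ k j z.2.1 z.2.2 y.1, y.2)) ?_
  exact ((measurable_tdUpdate hB hφ j).comp
    (f := fun w : (Vec p × (Vec q × (S × A))) × ((S × A) × (S × A)) =>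
      (w.1.2.1, w.1.2.2, w.2.1)) (by fun_prop)).prodMk (by fun_prop)

lemma isProb_criticStep (hγ0 : 0 ≤ γ) (hγ1 : γ < 1) (hB : 0 ≤ B) (hφ : Measurable (φ k))
    (mode : CriticSampling) (θ : Vec p) (j : ℕ) (v : Vec q × (S × A)) :
    IsProbabilityMeasure (criticStep γ B lamA M pol φ k θ j v mode) := by
  have := isProb_pairLaw (M := M) (pol := pol) (k := k) hγ0 hγ1 mode θ v.2
  rw [criticStep_eq hB hφ]
  exact Measure.isProbabilityMeasure_map (((measurable_tdUpdate hB hφ j).comp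
    (f := fun y : (S × A) × (S × A) => (v.1, v.2, y.1)) (by fun_prop)).prodMk
    measurable_snd).aemeasurable

lemma criticLaw_aux (hγ0 : 0 ≤ γ) (hγ1 : γ < 1) (hB : 0 ≤ B) (hφ : Measurable (φ k))
    (mode : CriticSampling) (j : ℕ) :
    (∀ z : Vec p × Vec q,
      IsProbabilityMeasure (criticLaw γ B lamA M pol φ mode k z.1 z.2 j)) ∧
    Measurable fun z : Vec p × Vec q => criticLaw γ B lamA M pol φ mode k z.1 z.2 j := by
  induction j with
  | zero =>
    have h := fun z : Vec p × Vec q => isProb_visitation M pol k hγ0 hγ1 z.1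
    refine ⟨fun z => ?_, ?_⟩
    · have := h z
      exact Measure.isProbabilityMeasure_map (by fun_prop)
    · exact measurable_map_param ((measurable_visitation γ M pol k).comp measurable_fst) h
        (f := fun z x => (z.2, x)) (by fun_prop)
  | succ j ih =>
    have hm := measurable_criticStep (M := M) (pol := pol) (lamA := lamA) hγ0 hγ1 hB hφ mode j
    refine ⟨fun z => ?_, ?_⟩
    · have := ih.1 z
      exact isProb_bind (hm.comp (f := fun v => (z.1, v)) (by fun_prop))
        fun v => isProb_criticStep hγ0 hγ1 hB hφ mode _ _ _
    · exact measurable_bind_param ih.2 ih.1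
        (κ := fun z v => criticStep γ B lamA M pol φ k z.1 j v mode)
        (hm.comp (f := fun y : (Vec p × Vec q) × (Vec q × (S × A)) => (y.1.1, y.2))
          (by fun_prop))

end Critic

/-! ### Lyapunov estimate for one TD step. -/

section CriticConvergence

variable {K p q : ℕ} {S A : Type*} [MeasurableSpace S] [MeasurableSpace A]
  {M : MultiTaskMDP K S A} {pol : PolicyClass p S A} {φ : Fin K → S × A → Vec q}
  {Cφ Lφ γ B lamA : ℝ} {k : Fin K}

lemma norm_tdDir_le (hγ0 : 0 ≤ γ) (hγ1 : γ < 1) (hCφ : 0 ≤ Cφ) (hB : 0 ≤ B)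
    (hφ : ∀ x, ‖φ k x‖ ≤ Cφ) {w : Vec q} (hw : ‖w‖ ≤ B) (x y : S × A) :
    ‖tdDir γ M φ k w x y‖ ≤ (1 + 2 * Cφ * B) * Cφ := by
  have h1 : ∀ z, |inner ℝ (φ k z) w| ≤ Cφ * B := fun z =>
    (abs_real_inner_le_norm _ _).trans (mul_le_mul (hφ z) hw (norm_nonneg _) hCφ)
  have h2 := abs_reward_le M k x
  rw [tdDir, norm_smul, Real.norm_eq_abs]
  refine mul_le_mul ?_ (hφ x) (norm_nonneg _) (by positivity)
  have h3 := abs_le.1 (h1 x)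
  have h4 : |γ * inner ℝ (φ k y) w| ≤ Cφ * B := by
    rw [abs_mul, abs_of_nonneg hγ0]
    nlinarith [h1 y, abs_nonneg (inner ℝ (φ k y) w)]
  have h4 := abs_le.1 h4
  have h2 := abs_le.1 h2
  rw [abs_le]
  constructor <;> linarith

lemma norm_tdDir_sub_le (hγ0 : 0 ≤ γ) (hγ1 : γ < 1) (hCφ : 0 ≤ Cφ)
    (hφ : ∀ x, ‖φ k x‖ ≤ Cφ) (w w' : Vec q) (x y : S × A) :
    ‖tdDir γ M φ k w x y - tdDir γ M φ k w' x y‖ ≤ 2 * Cφ ^ 2 * ‖w - w'‖ := by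
  have h1 : ∀ z, |inner ℝ (φ k z) (w - w')| ≤ Cφ * ‖w - w'‖ := fun z =>
    (abs_real_inner_le_norm _ _).trans (mul_le_mul_of_nonneg_right (hφ z) (norm_nonneg _))
  have h2 : tdDir γ M φ k w x y - tdDir γ M φ k w' x y =
      (γ * inner ℝ (φ k y) (w - w') - inner ℝ (φ k x) (w - w')) • φ k x := by
    rw [tdDir, tdDir, ← sub_smul, inner_sub_right, inner_sub_right]; congr 1; ring
  rw [h2, norm_smul, Real.norm_eq_abs]
  have h3 : |γ * inner ℝ (φ k y) (w - w')| ≤ Cφ * ‖w - w'‖ := by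
    rw [abs_mul, abs_of_nonneg hγ0]
    nlinarith [h1 y, abs_nonneg (inner ℝ (φ k y) (w - w'))]
  calc _ ≤ (Cφ * ‖w - w'‖ + Cφ * ‖w - w'‖) * Cφ :=
        mul_le_mul ((abs_sub _ _).trans (add_le_add h3 (h1 x))) (hφ x) (norm_nonneg _)
          (by positivity)
    _ = _ := by ring

/-- The expected TD drift `⟨w - w*, E[δ φ | (s, a) = x]⟩`. -/
noncomputable def tdDrift (γ : ℝ) (M : MultiTaskMDP K S A) (pol : PolicyClass p S A)
    (φ : Fin K → S × A → Vec q) (k : Fin K) (θ : Vec p) (ws w : Vec q) (x : S × A) : ℝ :=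
  ∫ y, inner ℝ (w - ws) (tdDir γ M φ k w x y) ∂(chain M pol k θ x)

/-- The drift `tdDrift` averaged over the visitation distribution. -/
noncomputable def tdMeanDrift (γ : ℝ) (M : MultiTaskMDP K S A) (pol : PolicyClass p S A)
    (φ : Fin K → S × A → Vec q) (k : Fin K) (θ : Vec p) (ws w : Vec q) : ℝ :=
  ∫ x, tdDrift γ M pol φ k θ ws w x ∂(visitation γ M pol k θ)

lemma measurable_tdDrift (hφ : Measurable (φ k)) (θ : Vec p) (ws : Vec q) :
    Measurable fun z : Vec q × (S × A) => tdDrift γ M pol φ k θ ws z.1 z.2 := by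
  have := (measurable_tdDir (M := M) (γ := γ) hφ).comp
    (f := fun z : (Vec q × (S × A)) × (S × A) => (z.1.1, z.1.2, z.2)) (by fun_prop)
  exact measurable_integral_param (μ := fun z : Vec q × (S × A) => chain M pol k θ z.2)
    ((Kernel.measurable _).comp measurable_snd) (fun _ => inferInstance)
    (f := fun z y => inner ℝ (z.1 - ws) (tdDir γ M φ k z.1 z.2 y))
    ((measurable_fst.fst.sub_const ws).inner this)

/-- A nonzero kernel vector v would give 0 = vᵀAv ≤ −λ_A‖v‖² < 0. Invertibility is what makes the
inverse in `tdLimit` genuine. -/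
lemma solvable_det_ne_zero (hlam : 0 < lamA) (hsol : Solvable γ M pol φ lamA) (θ : Vec p) :
    (tdMatrix γ M pol φ k θ).det ≠ 0 := by
  intro h0
  obtain ⟨v, hv, hv'⟩ := Matrix.exists_mulVec_eq_zero_iff.2 h0
  have := hsol k θ v
  rw [hv', dotProduct_zero] at this
  have h1 : 0 < v ⬝ᵥ v := by
    rcases (Finset.sum_nonneg fun i _ => mul_self_nonneg (v i)).eq_or_lt with h | h
    · exact absurd (dotProduct_self_eq_zero.1 h.symm) hv
    · exact h
  nlinarith

lemma tdMatrix_mulVec_tdLimit (hlam : 0 < lamA) (hsol : Solvable γ M pol φ lamA) (θ : Vec p) :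
    (tdMatrix γ M pol φ k θ).mulVec (tdLimit γ M pol φ k θ).ofLp = -tdVector γ M pol φ k θ := by
  have hdet := solvable_det_ne_zero (k := k) hlam hsol θ
  rw [tdLimit, Matrix.mulVec_neg, Matrix.mulVec_mulVec,
    Matrix.mul_nonsing_inv _ (isUnit_iff_ne_zero.2 hdet), Matrix.one_mulVec]

lemma inner_tdDir (v w : Vec q) (x y : S × A) :
    inner ℝ v (tdDir γ M φ k w x y) = ∑ i, v i * (φ k x i * M.reward k x +
      ∑ j, (φ k x i * (γ * φ k y j - φ k x j)) * w j) := by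
  have h : γ * inner ℝ (φ k y) w - inner ℝ (φ k x) w = ∑ j, (γ * φ k y j - φ k x j) * w j := by
    simp only [PiLp.inner_apply, RCLike.inner_apply, conj_trivial, Finset.mul_sum,
      ← Finset.sum_sub_distrib]
    exact Finset.sum_congr rfl fun j _ => by ring
  rw [tdDir, inner_smul_right, add_sub_assoc, h, PiLp.inner_apply, Finset.mul_sum]
  refine Finset.sum_congr rfl fun i _ => ?_
  simp only [RCLike.inner_apply, conj_trivial, mul_assoc, ← Finset.mul_sum]
  ring

lemma abs_coord_le {n : ℕ} (v : Vec n) (i : Fin n) : |v i| ≤ ‖v‖ := by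
  simpa using PiLp.norm_apply_le v i

lemma tdMeanDrift_eq (hγ0 : 0 ≤ γ) (hγ1 : γ < 1) (hCφ : 0 ≤ Cφ) (hφm : Measurable (φ k))
    (hφ : ∀ x, ‖φ k x‖ ≤ Cφ) (θ : Vec p) (ws w : Vec q) :
    tdMeanDrift γ M pol φ k θ ws w = ∑ i, (w - ws) i *
      (tdVector γ M pol φ k θ i + ((tdMatrix γ M pol φ k θ).mulVec w.ofLp) i) := by
  have := isProb_visitation M pol k hγ0 hγ1 θ
  have hτ : IsProbabilityMeasure (transitionLaw γ M pol k θ) := by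
    unfold transitionLaw; infer_instance
  have hc : ∀ x i, |φ k x i| ≤ Cφ := fun x i => (abs_coord_le _ i).trans (hφ x)
  have mc : ∀ i, Measurable fun x => φ k x i := fun i => by fun_prop
  have mr := M.reward_measurable k
  have m1 : ∀ i, Measurable fun x => φ k x i * M.reward k x := fun i => (mc i).mul mr
  have b1 : ∀ i x, |φ k x i * M.reward k x| ≤ Cφ * 1 := fun i x => by
    rw [abs_mul]; exact mul_le_mul (hc x i) (abs_reward_le M k x) (abs_nonneg _) hCφ
  have m2 : ∀ i j, Measurable fun z : (S × A) × (S × A) =>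
      φ k z.1 i * (γ * φ k z.2 j - φ k z.1 j) := fun i j => by fun_prop
  have b2 : ∀ i j (z : (S × A) × (S × A)),
      |φ k z.1 i * (γ * φ k z.2 j - φ k z.1 j)| ≤ Cφ * (Cφ + Cφ) := fun i j z => by
    rw [abs_mul]
    refine mul_le_mul (hc _ i) ((abs_sub _ _).trans (add_le_add ?_ (hc _ _))) (abs_nonneg _) hCφ
    rw [abs_mul, abs_of_nonneg hγ0]
    nlinarith [hc z.2 j, abs_nonneg (φ k z.2 j)]
  have i1 : ∀ i, Integrable (fun z : (S × A) × (S × A) => φ k z.1 i * M.reward k z.1)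
      (transitionLaw γ M pol k θ) := fun i =>
    integrable_of_bound ((m1 i).comp measurable_fst) (fun z => b1 i z.1)
  have i2 : ∀ i j, Integrable (fun z : (S × A) × (S × A) =>
      φ k z.1 i * (γ * φ k z.2 j - φ k z.1 j) * w j) (transitionLaw γ M pol k θ) := fun i j =>
    (integrable_of_bound (m2 i j) (b2 i j)).mul_const _
  have i3 : ∀ i, Integrable (fun z : (S × A) × (S × A) => (w - ws) i *
      (φ k z.1 i * M.reward k z.1 + ∑ j, φ k z.1 i * (γ * φ k z.2 j - φ k z.1 j) * w j))
      (transitionLaw γ M pol k θ) := fun i =>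
    ((i1 i).add (integrable_finsetSum _ fun j _ => i2 i j)).const_mul _
  have e1 : tdMeanDrift γ M pol φ k θ ws w =
      ∫ z, inner ℝ (w - ws) (tdDir γ M φ k w z.1 z.2) ∂(transitionLaw γ M pol k θ) := by
    rw [transitionLaw, Measure.integral_compProd]
    · rfl
    · simp_rw [inner_tdDir]
      exact integrable_finsetSum _ fun i _ => i3 i
  have e2 : ∀ i, ∫ z, φ k z.1 i * M.reward k z.1 ∂(transitionLaw γ M pol k θ) =
      tdVector γ M pol φ k θ i := fun i => by
    rw [transitionLaw, Measure.integral_compProd]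
    · simp [tdVector]
    · exact i1 i
  rw [e1]
  simp_rw [inner_tdDir]
  rw [integral_finsetSum _ fun i _ => i3 i]
  refine Finset.sum_congr rfl fun i _ => ?_
  rw [integral_const_mul, integral_add (i1 i) (integrable_finsetSum _ fun j _ => i2 i j), e2,
    integral_finsetSum _ fun j _ => i2 i j]
  simp_rw [integral_mul_const]
  rfl

/-- By Aw* + b = 0 the mean TD direction b + Aw equals A(w − w*), so the mean drift is the quadratic
form bounded by solvability. -/
lemma tdMeanDrift_le (hγ0 : 0 ≤ γ) (hγ1 : γ < 1) (hCφ : 0 ≤ Cφ) (hφm : Measurable (φ k))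
    (hφ : ∀ x, ‖φ k x‖ ≤ Cφ) (hlam : 0 < lamA) (hsol : Solvable γ M pol φ lamA)
    (θ : Vec p) (w : Vec q) :
    tdMeanDrift γ M pol φ k θ (tdLimit γ M pol φ k θ) w ≤
      -lamA * ‖w - tdLimit γ M pol φ k θ‖ ^ 2 := by
  have h := hsol k θ (w - tdLimit γ M pol φ k θ).ofLp
  have h2 : (w - tdLimit γ M pol φ k θ).ofLp ⬝ᵥ (w - tdLimit γ M pol φ k θ).ofLp =
      ‖w - tdLimit γ M pol φ k θ‖ ^ 2 := by
    rw [EuclideanSpace.real_norm_sq_eq]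
    exact Finset.sum_congr rfl fun i _ => (sq _).symm
  rw [h2] at h
  refine le_trans (le_of_eq ?_) h
  rw [tdMeanDrift_eq hγ0 hγ1 hCφ hφm hφ, WithLp.ofLp_sub, Matrix.mulVec_sub,
    tdMatrix_mulVec_tdLimit hlam hsol]
  refine Finset.sum_congr rfl fun i _ => ?_
  simp only [Pi.sub_apply, Pi.neg_apply]
  ring

/-- The constant of one step of the critic recursion. -/
noncomputable def criticStepConst (Cφ B lamA Lu : ℝ) : ℝ :=
  ((1 + 2 * Cφ * B) * Cφ) ^ 2 / (4 * lamA ^ 2) + Lu * ((1 + 2 * Cφ * B) * Cφ) / (2 * lamA ^ 2)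

/-- The Lyapunov function of the critic, corrected by the solution `u` of a Poisson equation. -/
noncomputable def criticPotential (B lamA : ℝ) (ws : Vec q) (u : Vec q → S × A → ℝ) (j : ℕ)
    (v : Vec q × (S × A)) : ℝ :=
  j * ‖proj (Metric.closedBall 0 B) v.1 - ws‖ ^ 2 +
    1 / lamA * u (proj (Metric.closedBall 0 B) v.1) v.2

lemma measurable_criticPotential (hB : 0 ≤ B) (ws : Vec q) {u : Vec q → S × A → ℝ}
    (hu : Measurable fun z : Vec q × (S × A) => u z.1 z.2) (j : ℕ) :
    Measurable (criticPotential B lamA ws u j) := by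
  have hP : Measurable fun v : Vec q × (S × A) => proj (Metric.closedBall 0 B) v.1 :=
    (measurable_proj_ball hB).comp measurable_fst
  exact (((hP.sub_const ws).norm.pow_const 2).const_mul _).add
    ((hu.comp (hP.prodMk measurable_snd)).const_mul _)

lemma norm_ball_sub_sq_le {w ws : Vec q} (hw : ‖w‖ ≤ B) (hws : ‖ws‖ ≤ B) :
    ‖w - ws‖ ^ 2 ≤ 4 * B ^ 2 := by
  have h1 : ‖w - ws‖ ≤ 2 * B := (norm_sub_le _ _).trans (by linarith)
  nlinarith [norm_nonneg (w - ws)]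

omit [MeasurableSpace S] [MeasurableSpace A] in
-- The projection inside `criticPotential` keeps it bounded where u is not controlled, which gives
-- integrability everywhere. It is the identity at all iterates after the first step.
lemma abs_criticPotential_le (hB : 0 ≤ B) (hlam : 0 < lamA) {ws : Vec q} (hws : ‖ws‖ ≤ B)
    {u : Vec q → S × A → ℝ} {Ub : ℝ} (hub : ∀ w x, ‖w‖ ≤ B → |u w x| ≤ Ub) (j : ℕ)
    (v : Vec q × (S × A)) :
    |criticPotential B lamA ws u j v| ≤ j * (4 * B ^ 2) + 1 / lamA * Ub := by
  have h := proj_ball_mem hB v.1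
  refine (abs_add_le _ _).trans (add_le_add ?_ ?_)
  · rw [abs_of_nonneg (by positivity)]
    exact mul_le_mul_of_nonneg_left (norm_ball_sub_sq_le h hws) (Nat.cast_nonneg j)
  · rw [abs_mul, abs_of_pos (by positivity)]
    exact mul_le_mul_of_nonneg_left (hub _ _ h) (by positivity)

/-- The step size satisfies (j + 1) · 2α = 1/λ_A, so the weighted drift has the constant factor
1/λ_A and its mean part is at most −‖w − w*‖². This lowers the weight from j + 1 to j. What remains
is (j + 1)α²G² from the squared TD direction and LuαG/λ_A from moving w inside u, both of order 1/(j
+ 1). -/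
lemma integral_criticPotential_step (hγ0 : 0 ≤ γ) (hγ1 : γ < 1) (hCφ : 0 ≤ Cφ)
    (hφm : Measurable (φ k)) (hφ : ∀ x, ‖φ k x‖ ≤ Cφ) (hB : 0 ≤ B) (hlam : 0 < lamA)
    (mode : CriticSampling) (θ : Vec p) {ws : Vec q} (hws : ‖ws‖ ≤ B)
    {u : Vec q → S × A → ℝ} {Ub Lu : ℝ} (hLu : 0 ≤ Lu)
    (hu : Measurable fun z : Vec q × (S × A) => u z.1 z.2)
    (hub : ∀ w x, ‖w‖ ≤ B → |u w x| ≤ Ub)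
    (hul : ∀ w w' x, ‖w‖ ≤ B → ‖w'‖ ≤ B → |u w x - u w' x| ≤ Lu * ‖w - w'‖)
    (hpois : ∀ w x, ‖w‖ ≤ B → u w x = tdDrift γ M pol φ k θ ws w x -
      tdMeanDrift γ M pol φ k θ ws w + ∫ z, u w z.2 ∂(pairLaw γ M pol k θ x mode))
    (hmean : ∀ w, tdMeanDrift γ M pol φ k θ ws w ≤ -lamA * ‖w - ws‖ ^ 2)
    (j : ℕ) (v : Vec q × (S × A)) (hv : ‖v.1‖ ≤ B) :
    ∫ v', criticPotential B lamA ws u (j + 1) v'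
        ∂(criticStep γ B lamA M pol φ k θ j v mode) ≤
      criticPotential B lamA ws u j v + criticStepConst Cφ B lamA Lu * (1 / ((j : ℝ) + 1)) := by
  obtain ⟨w, x⟩ := v
  simp only at hv
  have hpp := isProb_pairLaw (M := M) (pol := pol) (k := k) hγ0 hγ1 mode θ x
  set α : ℝ := 1 / (2 * lamA * ((j : ℝ) + 1)) with hα
  set G : ℝ := (1 + 2 * Cφ * B) * Cφ with hG
  have hj : (0 : ℝ) < (j : ℝ) + 1 := by positivity
  have hα0 : 0 < α := by positivity
  have hG0 : 0 ≤ G := by positivity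
  have hg := fun y => norm_tdDir_le (M := M) hγ0 hγ1 hCφ hB hφ hv x y
  have mupd : Measurable fun y : (S × A) × (S × A) => tdUpdate γ B lamA M φ k j w x y.1 :=
    (measurable_tdUpdate hB hφm j).comp (f := fun y : (S × A) × (S × A) => (w, x, y.1))
      (by fun_prop)
  have mg : Measurable fun y => tdDir γ M φ k w x y := (measurable_tdDir hφm).comp
    (f := fun y : S × A => (w, x, y)) (by fun_prop)
  have hupd : ∀ y, ‖tdUpdate γ B lamA M φ k j w x y‖ ≤ B := fun y => by
    rw [tdUpdate_eq]; exact proj_ball_mem hB _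
  have hsq : ∀ y, ‖tdUpdate γ B lamA M φ k j w x y - ws‖ ^ 2 ≤
      ‖w - ws‖ ^ 2 + 2 * α * inner ℝ (w - ws) (tdDir γ M φ k w x y) + α ^ 2 * G ^ 2 := fun y => by
    have h1 : ‖tdUpdate γ B lamA M φ k j w x y - ws‖ ≤ ‖(w - ws) + α • tdDir γ M φ k w x y‖ := by
      rw [tdUpdate_eq, ← hα, sub_add_eq_add_sub]
      exact norm_proj_sub_le Metric.isClosed_closedBall (convex_closedBall _ _) _
        (by simpa using hws)
    have h2 := pow_le_pow_left₀ (norm_nonneg _) h1 2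
    rw [norm_add_sq_real, inner_smul_right, norm_smul, Real.norm_of_nonneg hα0.le, mul_pow] at h2
    have h3 : α ^ 2 * ‖tdDir γ M φ k w x y‖ ^ 2 ≤ α ^ 2 * G ^ 2 :=
      mul_le_mul_of_nonneg_left (pow_le_pow_left₀ (norm_nonneg _) (hg y) 2) (by positivity)
    linarith
  have hmove : ∀ y, ‖tdUpdate γ B lamA M φ k j w x y - w‖ ≤ α * G := fun y => by
    rw [tdUpdate_eq, ← hα]
    refine (norm_proj_sub_le Metric.isClosed_closedBall (convex_closedBall _ _) _
      (by simpa using hv)).trans ?_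
    rw [add_sub_cancel_left, norm_smul, Real.norm_of_nonneg hα0.le]
    exact mul_le_mul_of_nonneg_left (hg y) hα0.le
  rw [criticStep_eq hB hφm, integral_map (mupd.prodMk measurable_snd).aemeasurable
    (measurable_criticPotential hB ws hu _).aestronglyMeasurable]
  set c0 : ℝ := ((j : ℝ) + 1) * (‖w - ws‖ ^ 2 + α ^ 2 * G ^ 2) + 1 / lamA * (Lu * (α * G)) with hc0
  have hinner : ∀ y, |inner ℝ (w - ws) (tdDir γ M φ k w x y)| ≤ ‖w - ws‖ * G := fun y =>
    (abs_real_inner_le_norm _ _).trans (mul_le_mul_of_nonneg_left (hg y) (norm_nonneg _))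
  have mi : Measurable fun y => inner ℝ (w - ws) (tdDir γ M φ k w x y) :=
    measurable_const.inner mg
  have ii : Integrable (fun y : (S × A) × (S × A) => inner ℝ (w - ws) (tdDir γ M φ k w x y.1))
      (pairLaw γ M pol k θ x mode) :=
    integrable_of_bound (mi.comp measurable_fst) fun y => hinner y.1
  have iu : Integrable (fun y : (S × A) × (S × A) => u w y.2) (pairLaw γ M pol k θ x mode) :=
    integrable_of_bound (hu.comp (f := fun y : (S × A) × (S × A) => (w, y.2)) (by fun_prop))
      fun y => hub w y.2 hv
  calc _ ≤ ∫ y, (c0 + 1 / lamA * inner ℝ (w - ws) (tdDir γ M φ k w x y.1) + 1 / lamA * u w y.2)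
        ∂(pairLaw γ M pol k θ x mode) := by
        refine integral_mono (integrable_of_bound ((measurable_criticPotential hB ws hu (j + 1)).comp
          (mupd.prodMk measurable_snd)) fun y => abs_criticPotential_le hB hlam hws hub _ _)
          (((integrable_const _).add (ii.const_mul _)).add (iu.const_mul _)) fun y => ?_
        simp only [criticPotential]
        rw [proj_ball_of_norm_le (hupd y.1)]
        have h1 := mul_le_mul_of_nonneg_left (hsq y.1) hj.le
        have h2 := (abs_le.1 (hul _ w y.2 (hupd y.1) hv)).2
        have h3 := h2.trans (mul_le_mul_of_nonneg_left (hmove y.1) hLu)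
        have h4 : 1 / lamA * u (tdUpdate γ B lamA M φ k j w x y.1) y.2 ≤
            1 / lamA * (u w y.2 + Lu * (α * G)) :=
          mul_le_mul_of_nonneg_left (by linarith) (by positivity)
        have h5 : ((j : ℝ) + 1) * (2 * α) = 1 / lamA := by rw [hα]; field_simp
        have h6 : ((j : ℝ) + 1) * (2 * α * inner ℝ (w - ws) (tdDir γ M φ k w x y.1)) =
            1 / lamA * inner ℝ (w - ws) (tdDir γ M φ k w x y.1) := by rw [← h5]; ring
        push_cast
        rw [hc0]
        linarith
    _ = c0 + 1 / lamA * tdDrift γ M pol φ k θ ws w x +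
        1 / lamA * ∫ y, u w y.2 ∂(pairLaw γ M pol k θ x mode) := by
        have h1 : ∫ y, inner ℝ (w - ws) (tdDir γ M φ k w x y.1) ∂(pairLaw γ M pol k θ x mode) =
            tdDrift γ M pol φ k θ ws w x := by
          rw [tdDrift, ← map_fst_pairLaw (M := M) (pol := pol) (k := k) hγ0 hγ1 mode θ x,
            integral_map measurable_fst.aemeasurable mi.aestronglyMeasurable]
        have i12 : Integrable (fun y : (S × A) × (S × A) =>
            c0 + 1 / lamA * inner ℝ (w - ws) (tdDir γ M φ k w x y.1))
            (pairLaw γ M pol k θ x mode) := (integrable_const _).add (ii.const_mul _)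
        rw [integral_add i12 (iu.const_mul _), integral_add (integrable_const _) (ii.const_mul _),
          integral_const_mul, integral_const_mul, h1]
        simp
    _ ≤ _ := by
        have h1 := hpois w x hv
        have h2 := hmean w
        simp only [criticPotential]
        rw [proj_ball_of_norm_le hv, criticStepConst, ← hG]
        -- The Poisson equation trades the drift at x plus the transported corrector for u(w, x)
        -- plus the mean drift.
        have h3 : 1 / lamA * (tdDrift γ M pol φ k θ ws w x +
            ∫ y, u w y.2 ∂(pairLaw γ M pol k θ x mode)) ≤
            1 / lamA * (u w x - lamA * ‖w - ws‖ ^ 2) :=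
          mul_le_mul_of_nonneg_left (by linarith) (by positivity)
        have h4 : 1 / lamA * (u w x - lamA * ‖w - ws‖ ^ 2) = 1 / lamA * u w x - ‖w - ws‖ ^ 2 := by
          field_simp
        have h5 : ((j : ℝ) + 1) * (α ^ 2 * G ^ 2) + 1 / lamA * (Lu * (α * G)) =
            (G ^ 2 / (4 * lamA ^ 2) + Lu * G / (2 * lamA ^ 2)) * (1 / ((j : ℝ) + 1)) := by
          rw [hα]; field_simp; ring
        rw [hc0]
        linarith

end CriticConvergence

/-! ### Critic error: telescoping and Poisson equations. -/

section CriticError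

variable {K p q : ℕ} {S A : Type*} [MeasurableSpace S] [MeasurableSpace A]
  {M : MultiTaskMDP K S A} {pol : PolicyClass p S A} {φ : Fin K → S × A → Vec q}
  {Cφ Lφ γ B lamA m ρ : ℝ} {k : Fin K}

lemma ae_criticLaw_norm_le (hγ0 : 0 ≤ γ) (hγ1 : γ < 1) (hB : 0 ≤ B) (hφm : Measurable (φ k))
    (mode : CriticSampling) (θ : Vec p) (w₀ : Vec q) (j : ℕ) :
    ∀ᵐ v ∂(criticLaw γ B lamA M pol φ mode k θ w₀ (j + 1)), ‖v.1‖ ≤ B := by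
  have hms := (measurable_criticStep (M := M) (pol := pol) (lamA := lamA) hγ0 hγ1 hB hφm mode j).comp
    (f := fun v => (θ, v)) (by fun_prop)
  have hE : MeasurableSet {v : Vec q × (S × A) | ‖v.1‖ ≤ B} :=
    measurableSet_le measurable_fst.norm measurable_const
  refine ae_bind hms hE (ae_of_all _ fun v => ?_)
  have hmu : Measurable fun y : (S × A) × (S × A) =>
      (tdUpdate γ B lamA M φ k j v.1 v.2 y.1, y.2) :=
    ((measurable_tdUpdate hB hφm j).comp (f := fun y : (S × A) × (S × A) => (v.1, v.2, y.1))
      (by fun_prop)).prodMk measurable_snd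
  simp only [Function.comp_apply]
  rw [criticStep_eq hB hφm]
  refine (ae_map_iff hmu.aemeasurable hE).2 (ae_of_all _ fun y => ?_)
  simp only [tdUpdate_eq]
  exact proj_ball_mem hB _

lemma criticStepConst_nonneg {Lu : ℝ} (hCφ : 0 ≤ Cφ) (hB : 0 ≤ B) (hLu : 0 ≤ Lu) :
    0 ≤ criticStepConst Cφ B lamA Lu := by
  unfold criticStepConst; positivity

/-- Summing the one-step bound gives N · E‖w_N − w*‖² ≤ const + 2·`criticStepConst`·√N, to be
divided by N. -/
lemma critic_error_of_poisson (hγ0 : 0 ≤ γ) (hγ1 : γ < 1) (hCφ : 0 ≤ Cφ)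
    (hφm : Measurable (φ k)) (hφ : ∀ x, ‖φ k x‖ ≤ Cφ) (hB : 0 ≤ B) (hlam : 0 < lamA)
    (mode : CriticSampling) (θ : Vec p) {ws : Vec q} (hws : ‖ws‖ ≤ B)
    {u : Vec q → S × A → ℝ} {Ub Lu : ℝ} (hUb : 0 ≤ Ub) (hLu : 0 ≤ Lu)
    (hu : Measurable fun z : Vec q × (S × A) => u z.1 z.2)
    (hub : ∀ w x, ‖w‖ ≤ B → |u w x| ≤ Ub)
    (hul : ∀ w w' x, ‖w‖ ≤ B → ‖w'‖ ≤ B → |u w x - u w' x| ≤ Lu * ‖w - w'‖)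
    (hpois : ∀ w x, ‖w‖ ≤ B → u w x = tdDrift γ M pol φ k θ ws w x -
      tdMeanDrift γ M pol φ k θ ws w + ∫ z, u w z.2 ∂(pairLaw γ M pol k θ x mode))
    (hmean : ∀ w, tdMeanDrift γ M pol φ k θ ws w ≤ -lamA * ‖w - ws‖ ^ 2)
    (w₀ : Vec q) {N : ℕ} (hN : 1 ≤ N) :
    ∫ v, ‖v.1 - ws‖ ^ 2 ∂(criticLaw γ B lamA M pol φ mode k θ w₀ N) ≤
      (4 * B ^ 2 + 2 / lamA * Ub + 2 * criticStepConst Cφ B lamA Lu) / Real.sqrt N := by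
  set μ := criticLaw γ B lamA M pol φ mode k θ w₀ with hμ
  set Φ := criticPotential (S := S) (A := A) B lamA ws u with hΦ
  set Cs := criticStepConst Cφ B lamA Lu with hCs
  have hCs0 : 0 ≤ Cs := criticStepConst_nonneg hCφ hB hLu
  have hp : ∀ j, IsProbabilityMeasure (μ j) := fun j =>
    (criticLaw_aux (M := M) (pol := pol) (lamA := lamA) hγ0 hγ1 hB hφm mode j).1 (θ, w₀)
  have mΦ : ∀ j, Measurable (Φ j) := measurable_criticPotential hB ws hu
  have bΦ := abs_criticPotential_le (S := S) (A := A) hB hlam hws hub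
  have iΦ : ∀ j, Integrable (Φ j) (μ j) := fun j => integrable_of_bound (mΦ j) (bΦ j)
  have hms := fun j => (measurable_criticStep (M := M) (pol := pol) (lamA := lamA)
    hγ0 hγ1 hB hφm mode j).comp (f := fun v => (θ, v)) (by fun_prop)
  have key : ∀ j, ∫ v, Φ (j + 1) v ∂(μ (j + 1)) ≤ 4 * B ^ 2 + 1 / lamA * Ub +
      Cs * ∑ i ∈ Finset.range (j + 1), 1 / ((i : ℝ) + 1) := fun j => by
    induction j with
    | zero =>
      -- The recursion starts at j = 1, since the warm start w₀ may lie outside the ball; after one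
      -- projection the trivial bound on the potential is available.
      have h := (le_abs_self _).trans (abs_integral_le_bound (μ := μ 1) (bΦ 1))
      simp only [zero_add, Finset.sum_range_one]
      simp only [Nat.cast_one, one_mul] at h
      refine h.trans (le_add_of_nonneg_right ?_)
      positivity
    | succ j ih =>
      have e : ∫ v, Φ (j + 1 + 1) v ∂(μ (j + 1 + 1)) =
          ∫ v, ∫ v', Φ (j + 1 + 1) v' ∂(criticStep γ B lamA M pol φ k θ (j + 1) v mode)
            ∂(μ (j + 1)) :=
        integral_bind_of_bound (hms (j + 1))
          (fun v => isProb_criticStep hγ0 hγ1 hB hφm mode θ (j + 1) v) (mΦ _) (bΦ _)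
      rw [e, Finset.sum_range_succ]
      have h1 : ∫ v, ∫ v', Φ (j + 1 + 1) v' ∂(criticStep γ B lamA M pol φ k θ (j + 1) v mode)
          ∂(μ (j + 1)) ≤ ∫ v, (Φ (j + 1) v + Cs * (1 / (((j + 1 : ℕ) : ℝ) + 1))) ∂(μ (j + 1)) := by
        refine integral_mono_ae ?_ ((iΦ (j + 1)).add (integrable_const _)) ?_
        · exact integrable_of_bound (measurable_integral_param (hms (j + 1))
            (fun v => isProb_criticStep hγ0 hγ1 hB hφm mode θ (j + 1) v) (f := fun _ v' => Φ _ v')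
            ((mΦ _).comp measurable_snd)) fun v =>
              have := isProb_criticStep (M := M) (pol := pol) (lamA := lamA) hγ0 hγ1 hB hφm mode θ
                (j + 1) v
              norm_integral_le_bound (bΦ (j + 1 + 1))
        · filter_upwards [ae_criticLaw_norm_le hγ0 hγ1 hB hφm mode θ w₀ j] with v hv
          exact integral_criticPotential_step hγ0 hγ1 hCφ hφm hφ hB hlam mode θ hws hLu hu hub hul
            hpois hmean (j + 1) v hv
      rw [integral_add (iΦ (j + 1)) (integrable_const _)] at h1
      simp only [integral_const, probReal_univ, smul_eq_mul, one_mul] at h1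
      linarith
  obtain ⟨n, rfl⟩ : ∃ n, N = n + 1 := ⟨N - 1, by omega⟩
  have hball := ae_criticLaw_norm_le (M := M) (pol := pol) (lamA := lamA) hγ0 hγ1 hB hφm mode θ w₀ n
  have hlow : ((n + 1 : ℕ) : ℝ) * ∫ v, ‖v.1 - ws‖ ^ 2 ∂(μ (n + 1)) - 1 / lamA * Ub ≤
      ∫ v, Φ (n + 1) v ∂(μ (n + 1)) := by
    have i1 : Integrable (fun v : Vec q × (S × A) => ‖v.1 - ws‖ ^ 2) (μ (n + 1)) :=
      Integrable.of_bound ((measurable_fst.sub_const ws).norm.pow_const 2).aestronglyMeasurable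
        (4 * B ^ 2) (by
          filter_upwards [hball] with v hv
          rw [Real.norm_of_nonneg (by positivity)]
          exact norm_ball_sub_sq_le hv hws)
    have h1 : ∫ v, (((n + 1 : ℕ) : ℝ) * ‖v.1 - ws‖ ^ 2 - 1 / lamA * Ub) ∂(μ (n + 1)) ≤
        ∫ v, Φ (n + 1) v ∂(μ (n + 1)) := by
      refine integral_mono_ae ((i1.const_mul _).sub (integrable_const _)) (iΦ _) ?_
      filter_upwards [hball] with v hv
      simp only [hΦ, criticPotential]
      rw [proj_ball_of_norm_le hv]
      have h2 := (abs_le.1 (hub v.1 v.2 hv)).1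
      have h3 : 1 / lamA * (-Ub) ≤ 1 / lamA * u v.1 v.2 :=
        mul_le_mul_of_nonneg_left h2 (by positivity)
      linarith
    rw [integral_sub (i1.const_mul _) (integrable_const _), integral_const_mul] at h1
    simpa using h1
  have h1 := key n
  have h2 := sum_one_div_succ_le (n + 1)
  set s := Real.sqrt ((n + 1 : ℕ) : ℝ) with hs
  have hs2 : s ^ 2 = ((n + 1 : ℕ) : ℝ) := Real.sq_sqrt (Nat.cast_nonneg _)
  have hs1 : 1 ≤ s := Real.one_le_sqrt.2 (by push_cast; linarith [Nat.cast_nonneg (α := ℝ) n])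
  set I := ∫ v, ‖v.1 - ws‖ ^ 2 ∂(μ (n + 1)) with hI
  rw [le_div_iff₀ (by positivity)]
  -- Here s = √N, so the left side is N·I; s ≥ 1 lets the terms without a root be multiplied by s as
  -- well.
  have h3 : s * (I * s) ≤ s * (4 * B ^ 2 + 2 / lamA * Ub + 2 * Cs) := by
    have h4 : s * (I * s) = ((n + 1 : ℕ) : ℝ) * I := by rw [← hs2]; ring
    have h5 : Cs * ∑ i ∈ Finset.range (n + 1), 1 / ((i : ℝ) + 1) ≤ Cs * (2 * s) :=
      mul_le_mul_of_nonneg_left h2 hCs0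
    have h6 : 0 ≤ 4 * B ^ 2 + 2 / lamA * Ub := by positivity
    have h7 : 2 / lamA * Ub = 1 / lamA * Ub + 1 / lamA * Ub := by ring
    rw [h4]
    nlinarith
  exact le_of_mul_le_mul_left h3 (by positivity)

lemma abs_tdDrift_le (hγ0 : 0 ≤ γ) (hγ1 : γ < 1) (hCφ : 0 ≤ Cφ)
    (hφ : ∀ x, ‖φ k x‖ ≤ Cφ) (hB : 0 ≤ B) (θ : Vec p) {ws w : Vec q} (hws : ‖ws‖ ≤ B)
    (hw : ‖w‖ ≤ B) (x : S × A) :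
    |tdDrift γ M pol φ k θ ws w x| ≤ 2 * B * ((1 + 2 * Cφ * B) * Cφ) := by
  refine abs_integral_le_bound fun y => (abs_real_inner_le_norm _ _).trans ?_
  exact mul_le_mul ((norm_sub_le _ _).trans (by linarith))
    (norm_tdDir_le hγ0 hγ1 hCφ hB hφ hw x y) (norm_nonneg _) (by positivity)

lemma abs_tdDrift_sub_le (hγ0 : 0 ≤ γ) (hγ1 : γ < 1) (hCφ : 0 ≤ Cφ) (hφm : Measurable (φ k))
    (hφ : ∀ x, ‖φ k x‖ ≤ Cφ) (hB : 0 ≤ B) (θ : Vec p) {ws w w' : Vec q} (hws : ‖ws‖ ≤ B)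
    (hw : ‖w‖ ≤ B) (hw' : ‖w'‖ ≤ B) (x : S × A) :
    |tdDrift γ M pol φ k θ ws w x - tdDrift γ M pol φ k θ ws w' x| ≤
      ((1 + 2 * Cφ * B) * Cφ + 4 * B * Cφ ^ 2) * ‖w - w'‖ := by
  have mg : ∀ w, Measurable fun y => inner ℝ (w - ws) (tdDir γ M φ k w x y) := fun w =>
    measurable_const.inner ((measurable_tdDir hφm).comp (f := fun y : S × A => (w, x, y))
      (by fun_prop))
  have bg : ∀ w, ‖w‖ ≤ B → ∀ y, |inner ℝ (w - ws) (tdDir γ M φ k w x y)| ≤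
      2 * B * ((1 + 2 * Cφ * B) * Cφ) := fun w hw y => (abs_real_inner_le_norm _ _).trans
    (mul_le_mul ((norm_sub_le _ _).trans (by linarith))
      (norm_tdDir_le hγ0 hγ1 hCφ hB hφ hw x y) (norm_nonneg _) (by positivity))
  rw [tdDrift, tdDrift, ← integral_sub_of_bound (mg w) (mg w') (bg w hw) (bg w' hw')]
  refine abs_integral_le_bound fun y => ?_
  have e : inner ℝ (w - ws) (tdDir γ M φ k w x y) - inner ℝ (w' - ws) (tdDir γ M φ k w' x y) =
      inner ℝ (w - w') (tdDir γ M φ k w x y) +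
      inner ℝ (w' - ws) (tdDir γ M φ k w x y - tdDir γ M φ k w' x y) := by
    simp only [inner_sub_left, inner_sub_right]; ring
  rw [e]
  have h1 := (abs_real_inner_le_norm (w - w') (tdDir γ M φ k w x y)).trans
    (mul_le_mul_of_nonneg_left (norm_tdDir_le hγ0 hγ1 hCφ hB hφ hw x y) (norm_nonneg _))
  have h2 := (abs_real_inner_le_norm (w' - ws) (tdDir γ M φ k w x y - tdDir γ M φ k w' x y)).trans
    (mul_le_mul ((norm_sub_le w' ws).trans (add_le_add hw' hws))
      (norm_tdDir_sub_le hγ0 hγ1 hCφ hφ w w' x y) (norm_nonneg _) (by positivity))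
  refine (abs_add_le _ _).trans ((add_le_add h1 h2).trans (le_of_eq (by ring)))

/-- Ergodicity is assumed from a starting state, but here a pair is given: one transition is spent
to reach a fresh state, which costs a factor 1/ρ. The summand 1 covers t = 0. -/
lemma abs_integral_chainIter_le (hγ0 : 0 ≤ γ) (hγ1 : γ < 1) (hm : 0 < m) (hρ0 : 0 < ρ)
    (herg : UniformlyErgodic γ M pol m ρ)
    (θ : Vec p) {f : S × A → ℝ} (hf : Measurable f) {F : ℝ} (hF : ∀ x, |f x| ≤ F)
    (h0 : ∫ x, f x ∂(visitation γ M pol k θ) = 0) (t : ℕ) (x : S × A) :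
    |∫ y, f y ∂(chainIter M pol k θ t x)| ≤ F * (1 + 2 * m / ρ) * ρ ^ t := by
  have hF0 : 0 ≤ F := (abs_nonneg _).trans (hF x)
  have := isProb_visitation M pol k hγ0 hγ1 θ
  cases t with
  | zero =>
    refine (abs_integral_le_bound hF).trans ?_
    have : 0 ≤ F * (2 * m / ρ) := by positivity
    simp only [pow_zero, mul_one]
    linarith
  | succ t =>
    have e : chainIter M pol k θ (t + 1) x = (M.trans k x).bind (lawFromState M pol k θ t) := by
      rw [chainIter_succ', chain, ← Kernel.comp_assoc, Kernel.comp_apply]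
      rfl
    rw [e, integral_bind_of_bound (Kernel.measurable _) (fun _ => inferInstance) hf hF]
    have h1 : ∀ s, |∫ y, f y ∂(lawFromState M pol k θ t s)| ≤ 2 * F * (m * ρ ^ t) := fun s => by
      have := abs_integral_sub_le (μ := lawFromState M pol k θ t s)
        (ν := visitation γ M pol k θ) (herg k θ s t) hf hF
      rwa [h0, sub_zero] at this
    refine (abs_integral_le_bound h1).trans ?_
    have h2 : 0 ≤ F * ρ ^ (t + 1) := by positivity
    have h3 : 2 * F * (m * ρ ^ t) = F * (2 * m / ρ) * ρ ^ (t + 1) := by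
      rw [pow_succ]; field_simp
    rw [h3]; linarith

/-- Solution of the Poisson equation of the chain, as the undiscounted resolvent. -/
lemma poisson_solution (hγ0 : 0 ≤ γ) (hγ1 : γ < 1) (hm : 0 < m) (hρ0 : 0 < ρ) (hρ1 : ρ < 1)
    (herg : UniformlyErgodic γ M pol m ρ)
    (θ : Vec p) {f : S × A → ℝ} (hf : Measurable f) {F : ℝ} (hF : ∀ x, |f x| ≤ F)
    (h0 : ∫ x, f x ∂(visitation γ M pol k θ) = 0) :
    (∀ x, |resolvent 1 M pol k θ f x| ≤ F * ((1 + 2 * m / ρ) / (1 - ρ))) ∧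
    (∀ x, Summable fun t : ℕ => (1 : ℝ) ^ t * ∫ y, f y ∂(chainIter M pol k θ t x)) ∧
    (∀ x, resolvent 1 M pol k θ f x =
      f x + ∫ y, resolvent 1 M pol k θ f y ∂(chain M pol k θ x)) := by
  have hb := abs_integral_chainIter_le (k := k) hγ0 hγ1 hm hρ0 herg θ hf hF h0
  have hgs := (hasSum_geometric_of_lt_one hρ0.le hρ1).mul_left (F * (1 + 2 * m / ρ))
  have hsum : ∀ x, Summable fun t : ℕ => (1 : ℝ) ^ t * ∫ y, f y ∂(chainIter M pol k θ t x) :=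
    fun x => by
      simp only [one_pow, one_mul]
      exact Summable.of_norm_bounded hgs.summable fun t => hb t x
  refine ⟨fun x => ?_, hsum, fun x => ?_⟩
  · have h2 : F * ((1 + 2 * m / ρ) / (1 - ρ)) = F * (1 + 2 * m / ρ) * (1 - ρ)⁻¹ := by ring
    rw [h2, ← Real.norm_eq_abs]
    refine tsum_of_norm_bounded hgs fun t => ?_
    rw [one_pow, one_mul]
    exact hb t x
  · rw [resolvent, (hsum x).tsum_eq_zero_add]
    simp only [resolvent, one_pow, one_mul]
    rw [integral_tsum_of_bound hgs.summable
      (g := fun t y => ∫ z, f z ∂(chainIter M pol k θ t y))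
      (fun t => measurable_integral_param (Kernel.measurable _) (fun _ => inferInstance)
        (f := fun _ y => f y) (hf.comp measurable_snd)) hb]
    congr 1
    · simp only [chainIter, Kernel.id_apply, integral_dirac' _ _ hf.stronglyMeasurable]
    · congr 1; ext t
      rw [integral_chainIter_succ M pol k hf hF]

/-- The constant of the critic error bound. -/
noncomputable def criticConst (Cφ B lamA m ρ : ℝ) : ℝ :=
  4 * B ^ 2 + 2 / lamA * (4 * B * ((1 + 2 * Cφ * B) * Cφ) * ((1 + 2 * m / ρ) / (1 - ρ))) +
    2 * criticStepConst Cφ B lamA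
      (2 * ((1 + 2 * Cφ * B) * Cφ + 4 * B * Cφ ^ 2) * ((1 + 2 * m / ρ) / (1 - ρ)))

lemma critic_error (hγ0 : 0 ≤ γ) (hγ1 : γ < 1) (hCφ : 0 ≤ Cφ) (hB : 0 ≤ B) (hlam : 0 < lamA)
    (hm : 0 < m) (hρ0 : 0 < ρ) (hρ1 : ρ < 1) (hφm : Measurable (φ k)) (hφ : ∀ x, ‖φ k x‖ ≤ Cφ)
    (mode : CriticSampling) (herg : mode = .trajectory → UniformlyErgodic γ M pol m ρ)
    (hsol : Solvable γ M pol φ lamA) (θ : Vec p) (hws : ‖tdLimit γ M pol φ k θ‖ ≤ B)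
    (w₀ : Vec q) {N : ℕ} (hN : 1 ≤ N) :
    ∫ v, ‖v.1 - tdLimit γ M pol φ k θ‖ ^ 2 ∂(criticLaw γ B lamA M pol φ mode k θ w₀ N) ≤
      criticConst Cφ B lamA m ρ / Real.sqrt N := by
  have := isProb_visitation M pol k hγ0 hγ1 θ
  set ws := tdLimit γ M pol φ k θ with hwsdef
  set G : ℝ := (1 + 2 * Cφ * B) * Cφ with hG
  set R : ℝ := (1 + 2 * m / ρ) / (1 - ρ) with hR
  have hρ' : 0 < 1 - ρ := by linarith
  have hR1 : 1 ≤ R := by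
    rw [hR, le_div_iff₀ hρ']
    have : 0 ≤ 2 * m / ρ := by positivity
    linarith
  have hG0 : 0 ≤ G := by positivity
  let f : Vec q → S × A → ℝ := fun w x =>
    tdDrift γ M pol φ k θ ws w x - tdMeanDrift γ M pol φ k θ ws w
  have hd := fun w (hw : ‖w‖ ≤ B) x => abs_tdDrift_le (M := M) (pol := pol) hγ0 hγ1 hCφ hφ hB θ
    hws hw x
  have hdl := fun w w' (hw : ‖w‖ ≤ B) (hw' : ‖w'‖ ≤ B) x =>
    abs_tdDrift_sub_le (M := M) (pol := pol) hγ0 hγ1 hCφ hφm hφ hB θ hws hw hw' x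
  have md : Measurable fun z : Vec q × (S × A) => tdDrift γ M pol φ k θ ws z.1 z.2 :=
    measurable_tdDrift hφm θ ws
  have mdw : ∀ w, Measurable (tdDrift γ M pol φ k θ ws w) := fun w =>
    md.comp (f := fun x => (w, x)) (by fun_prop)
  have mmean : Measurable (tdMeanDrift γ M pol φ k θ ws) :=
    measurable_integral_param measurable_const (fun _ => inferInstance) md
  have mf : Measurable fun z : Vec q × (S × A) => f z.1 z.2 := md.sub (mmean.comp measurable_fst)
  have mfw : ∀ w, Measurable (f w) := fun w => mf.comp (f := fun x => (w, x)) (by fun_prop)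
  have hmd : ∀ w, ‖w‖ ≤ B → |tdMeanDrift γ M pol φ k θ ws w| ≤ 2 * B * G := fun w hw =>
    abs_integral_le_bound (hd w hw)
  have hf : ∀ w x, ‖w‖ ≤ B → |f w x| ≤ 4 * B * G := fun w x hw =>
    (abs_sub _ _).trans ((add_le_add (hd w hw x) (hmd w hw)).trans (le_of_eq (by ring)))
  have hfl : ∀ w w' x, ‖w‖ ≤ B → ‖w'‖ ≤ B → |f w x - f w' x| ≤
      2 * (G + 4 * B * Cφ ^ 2) * ‖w - w'‖ := fun w w' x hw hw' => by
    have h1 : |tdMeanDrift γ M pol φ k θ ws w - tdMeanDrift γ M pol φ k θ ws w'| ≤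
        (G + 4 * B * Cφ ^ 2) * ‖w - w'‖ := by
      rw [tdMeanDrift, tdMeanDrift,
        ← integral_sub_of_bound (mdw w) (mdw w') (hd w hw) (hd w' hw')]
      exact abs_integral_le_bound (hdl w w' hw hw')
    have h2 : f w x - f w' x = (tdDrift γ M pol φ k θ ws w x - tdDrift γ M pol φ k θ ws w' x) -
        (tdMeanDrift γ M pol φ k θ ws w - tdMeanDrift γ M pol φ k θ ws w') := by
      simp only [f]; ring
    rw [h2]
    exact (abs_sub _ _).trans ((add_le_add (hdl w w' hw hw' x) h1).trans (le_of_eq (by ring)))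
  have hf0 : ∀ w, ‖w‖ ≤ B → ∫ x, f w x ∂(visitation γ M pol k θ) = 0 := fun w hw => by
    have := integral_sub_of_bound (μ := visitation γ M pol k θ) (mdw w)
      (measurable_const (a := tdMeanDrift γ M pol φ k θ ws w)) (hd w hw) (fun _ => hmd w hw)
    simp only [f]
    rw [this]
    simp [tdMeanDrift]
  have hmean := tdMeanDrift_le (M := M) (pol := pol) hγ0 hγ1 hCφ hφm hφ hlam hsol θ
  cases mode with
  -- The next pair is a fresh draw from the visitation law, under which f(w, ·) has mean zero, so u
  -- = f solves the Poisson equation. The factor R ≥ 1 only brings the constants to those of the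
  -- other mode.
  | independent =>
    refine critic_error_of_poisson (u := f) hγ0 hγ1 hCφ hφm hφ hB hlam _ θ hws (by positivity)
      (by positivity) mf (fun w x hw => (hf w x hw).trans (le_mul_of_one_le_right (by positivity) hR1))
      (fun w w' x hw hw' => (hfl w w' x hw hw').trans (mul_le_mul_of_nonneg_right
        (le_mul_of_one_le_right (by positivity) hR1) (norm_nonneg _))) (fun w x hw => ?_)
      hmean w₀ hN
    have : ∫ z, f w z.2 ∂(pairLaw γ M pol k θ x .independent) = 0 := by
      rw [pairLaw, integral_fun_snd]
      simp [hf0 w hw]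
    rw [this, add_zero]
  | trajectory =>
    have herg := herg rfl
    have hP := fun w (hw : ‖w‖ ≤ B) => poisson_solution (k := k) hγ0 hγ1 hm hρ0 hρ1 herg θ (mfw w)
      (fun x => hf w x hw) (hf0 w hw)
    refine critic_error_of_poisson (u := fun w => resolvent 1 M pol k θ (f w)) hγ0 hγ1 hCφ hφm hφ hB
      hlam _ θ hws (by positivity) (by positivity) ?_ (fun w x hw => (hP w hw).1 x)
      (fun w w' x hw hw' => ?_) (fun w x hw => ?_) hmean w₀ hN
    · refine Measurable.tsum fun t => ?_
      refine (measurable_integral_param (μ := fun z : Vec q × (S × A) => chainIter M pol k θ t z.2)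
        ((Kernel.measurable _).comp measurable_snd) (fun _ => inferInstance)
        (f := fun z y => f z.1 y) ?_).const_mul _
      exact mf.comp (f := fun z : (Vec q × (S × A)) × (S × A) => (z.1.1, z.2)) (by fun_prop)
    -- The solution is linear in f, so its Lipschitz bound in w is the sup bound applied to the
    -- centred function f(w, ·) − f(w', ·).
    · have h1 := poisson_solution (k := k) hγ0 hγ1 hm hρ0 hρ1 herg θ ((mfw w).sub (mfw w'))
        (F := 2 * (G + 4 * B * Cφ ^ 2) * ‖w - w'‖) (fun x => hfl w w' x hw hw') (by
          have := integral_sub_of_bound (μ := visitation γ M pol k θ) (mfw w) (mfw w')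
            (fun x => hf w x hw) (fun x => hf w' x hw')
          simp only [Pi.sub_apply]
          rw [this, hf0 w hw, hf0 w' hw', sub_zero])
      have h2 : resolvent 1 M pol k θ (f w) x - resolvent 1 M pol k θ (f w') x =
          resolvent 1 M pol k θ (f w - f w') x := by
        simp only [resolvent]
        rw [← ((hP w hw).2.1 x).tsum_sub ((hP w' hw').2.1 x)]
        congr 1; ext t
        rw [← mul_sub, ← integral_sub_of_bound (mfw w) (mfw w')
            (fun x => hf w x hw) (fun x => hf w' x hw')]
        rfl
      rw [h2]
      refine (h1.1 x).trans (le_of_eq ?_)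
      ring
    · have h1 := (hP w hw).2.2 x
      have h2 : ∫ z, resolvent 1 M pol k θ (f w) z.2 ∂(pairLaw γ M pol k θ x .trajectory) =
          ∫ y, resolvent 1 M pol k θ (f w) y ∂(chain M pol k θ x) := by
        have hmr : Measurable (resolvent 1 M pol k θ (f w)) := measurable_resolvent_right (mfw w) θ
        exact integral_map (φ := fun y : S × A => (y, y))
          (f := fun z => resolvent 1 M pol k θ (f w) z.2) (by fun_prop)
          (hmr.comp measurable_snd).aestronglyMeasurable
      rw [h2]
      exact h1

end CriticError

/-! ### Mean and second moment of batch averages. -/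

section Batch

variable {p : ℕ} {Y : Type*} [MeasurableSpace Y]

lemma integral_apply {n : ℕ} {μ : Measure Y} {X : Y → Vec n} (hX : Integrable X μ) (c : Fin n) :
    (∫ y, X y ∂μ) c = ∫ y, X y c ∂μ :=
  ((EuclideanSpace.proj c : Vec n →L[ℝ] ℝ).integral_comp_comm hX).symm

lemma integral_pi_eval {ι E : Type*} [Fintype ι] [NormedAddCommGroup E] [NormedSpace ℝ E]
    [MeasurableSpace E] [BorelSpace E] [SecondCountableTopology E] {Z : ι → Type*}
    [∀ i, MeasurableSpace (Z i)] {μ : ∀ i, Measure (Z i)} [∀ i, IsProbabilityMeasure (μ i)] (i : ι)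
    {f : Z i → E} (hf : Measurable f) : ∫ b, f (b i) ∂(Measure.pi μ) = ∫ y, f y ∂(μ i) := by
  have h := measurePreserving_eval μ i
  rw [← h.map_eq, integral_map h.measurable.aemeasurable hf.aestronglyMeasurable]

variable {μ : Measure Y} [IsProbabilityMeasure μ] {X : Y → Vec p} {σ : ℝ} {N : ℕ}

omit [MeasurableSpace Y] in
lemma norm_average_le (hσ : ∀ y, ‖X y‖ ≤ σ) (hN : 1 ≤ N) (b : Fin N → Y) :
    ‖(1 / (N : ℝ)) • ∑ i, X (b i)‖ ≤ σ := by
  have hN' : (0 : ℝ) < N := by exact_mod_cast hN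
  rw [norm_smul, Real.norm_of_nonneg (by positivity), one_div, inv_mul_le_iff₀ hN']
  refine (norm_sum_le_of_le _ fun i _ => hσ (b i)).trans (by simp)

lemma integral_average (hX : Measurable X) (hσ : ∀ y, ‖X y‖ ≤ σ) (hN : 1 ≤ N) :
    ∫ b, (1 / (N : ℝ)) • ∑ i, X (b i) ∂(Measure.pi fun _ : Fin N => μ) = ∫ y, X y ∂μ := by
  have hN' : (N : ℝ) ≠ 0 := by positivity
  have hi : ∀ i, Integrable (fun b : Fin N → Y => X (b i)) (Measure.pi fun _ : Fin N => μ) :=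
    fun i => integrable_of_bound (hX.comp (measurable_pi_apply i)) fun b => hσ (b i)
  rw [integral_smul, integral_finsetSum _ fun i _ => hi i]
  simp_rw [integral_pi_eval (μ := fun _ : Fin N => μ) _ hX]
  rw [Finset.sum_const, Finset.card_univ, Fintype.card_fin, ← Nat.cast_smul_eq_nsmul ℝ, smul_smul,
    one_div, inv_mul_cancel₀ hN', one_smul]

/-- Coordinate by coordinate, variances of independent samples add, so the average has the squared
mean plus 1/N times the variance; over all coordinates the variance is at most σ². -/
lemma integral_norm_average_sq_le (hX : Measurable X) (hσ : ∀ y, ‖X y‖ ≤ σ) (hN : 1 ≤ N) :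
    ∫ b, ‖(1 / (N : ℝ)) • ∑ i, X (b i)‖ ^ 2 ∂(Measure.pi fun _ : Fin N => μ) ≤
      ‖∫ y, X y ∂μ‖ ^ 2 + σ ^ 2 / N := by
  have hN' : (0 : ℝ) < N := by exact_mod_cast hN
  have hXi := integrable_of_bound (μ := μ) hX hσ
  have mc : ∀ c, Measurable fun y => X y c := fun c => by fun_prop
  have bc : ∀ c y, |X y c| ≤ σ := fun c y => (abs_coord_le _ c).trans (hσ y)
  have lc : ∀ c, MemLp (fun y => X y c) 2 μ := fun c =>
    MemLp.of_bound (mc c).aestronglyMeasurable σ (ae_of_all _ (bc c))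
  set P : Measure (Fin N → Y) := Measure.pi fun _ : Fin N => μ with hP
  set s : Fin p → (Fin N → Y) → ℝ := fun c => ∑ i, fun b => X (b i) c with hs
  have sapp : ∀ c b, s c b = ∑ i, X (b i) c := fun c b => by simp [hs]
  have ms : ∀ c, Measurable (s c) := fun c => by
    have : s c = fun b => ∑ i, X (b i) c := funext (sapp c)
    rw [this]
    exact Finset.measurable_sum _ fun i _ => (mc c).comp (measurable_pi_apply i)
  have bs : ∀ c b, |s c b| ≤ N * σ := fun c b => by
    rw [sapp]
    refine (Finset.abs_sum_le_sum_abs _ _).trans ((Finset.sum_le_sum fun i _ => bc c (b i)).trans ?_)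
    simp
  have hsI : ∀ c, ∫ b, s c b ∂P = N * (∫ y, X y ∂μ) c := fun c => by
    have hi : ∀ i, Integrable (fun b : Fin N → Y => X (b i) c) P :=
      fun i => integrable_of_bound ((mc c).comp (measurable_pi_apply i)) fun b => bc c (b i)
    simp_rw [sapp]
    rw [integral_finsetSum _ fun i _ => hi i, integral_apply hXi]
    simp_rw [hP, integral_pi_eval (μ := fun _ : Fin N => μ) _ (mc c)]
    simp
  have hvar : ∀ c, ∫ b, s c b ^ 2 ∂P = N * (∫ y, X y c ^ 2 ∂μ - (∫ y, X y ∂μ) c ^ 2) +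
      (N * (∫ y, X y ∂μ) c) ^ 2 := fun c => by
    have h1 : Var[s c; P] = ∑ i : Fin N, Var[fun y => X y c; μ] :=
      variance_sum_pi (Ω := fun _ : Fin N => Y) (μ := fun _ => μ) (X := fun _ y => X y c)
        (fun _ => lc c)
    have h2 := variance_eq_sub (μ := P) (X := s c)
      (MemLp.of_bound (ms c).aestronglyMeasurable _ (ae_of_all _ (bs c)))
    have h3 := variance_eq_sub (lc c)
    simp only [Finset.sum_const, Finset.card_univ, Fintype.card_fin, nsmul_eq_mul] at h1
    rw [h1, h3] at h2
    simp only [Pi.pow_apply] at h2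
    rw [hsI, ← integral_apply hXi] at h2
    linarith
  have hnorm : ∀ b : Fin N → Y, ‖(1 / (N : ℝ)) • ∑ i, X (b i)‖ ^ 2 =
      (1 / (N : ℝ) ^ 2) * ∑ c, s c b ^ 2 := fun b => by
    rw [EuclideanSpace.real_norm_sq_eq, Finset.mul_sum]
    refine Finset.sum_congr rfl fun c _ => ?_
    rw [sapp, PiLp.smul_apply, WithLp.ofLp_sum, Finset.sum_apply, smul_eq_mul]
    ring
  simp_rw [hnorm]
  rw [integral_const_mul, integral_finsetSum _ fun c _ =>
    integrable_of_bound ((ms c).pow_const 2) (C := (N * σ) ^ 2) fun b => by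
      rw [norm_pow]; exact pow_le_pow_left₀ (norm_nonneg _) (bs c b) 2]
  simp_rw [hvar]
  have hsum : ∑ c, ∫ y, X y c ^ 2 ∂μ ≤ σ ^ 2 := by
    rw [← integral_finsetSum _ fun c _ =>
      integrable_of_bound ((mc c).pow_const 2) (C := σ ^ 2) fun b => by
        rw [norm_pow]; exact pow_le_pow_left₀ (norm_nonneg _) (bc c b) 2]
    refine (le_abs_self _).trans (abs_integral_le_bound fun y => ?_)
    rw [← EuclideanSpace.real_norm_sq_eq, abs_of_nonneg (by positivity)]
    exact pow_le_pow_left₀ (norm_nonneg _) (hσ y) 2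
  rw [EuclideanSpace.real_norm_sq_eq, Finset.sum_add_distrib, ← Finset.mul_sum,
    Finset.sum_sub_distrib]
  simp_rw [mul_pow]
  rw [← Finset.mul_sum]
  set T := ∑ c, (∫ y, X y ∂μ) c ^ 2
  have hT : 0 ≤ T := Finset.sum_nonneg fun c _ => sq_nonneg _
  have : 1 / (N : ℝ) ^ 2 * (N * (∑ c, ∫ y, X y c ^ 2 ∂μ - T) + N ^ 2 * T) =
      T + (∑ c, ∫ y, X y c ^ 2 ∂μ - T) / N := by
    field_simp
    ring
  rw [this]
  gcongr
  linarith

end Batch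

/-! ### Joint descent of the weight step and the actor step. -/

section OneStep

variable {K p : ℕ} {Ω₁ Ω₂ : Type*} [MeasurableSpace Ω₁] [MeasurableSpace Ω₂]

lemma integral_inner_prod {μ : Measure Ω₁} {ν : Measure Ω₂} [IsProbabilityMeasure μ]
    [IsProbabilityMeasure ν] {a : Ω₁ → Vec p} {c : Ω₂ → Vec p} (ha : Measurable a)
    (hc : Measurable c) {C D : ℝ} (hC : ∀ x, ‖a x‖ ≤ C) (hD : ∀ x, ‖c x‖ ≤ D) :
    ∫ z, inner ℝ (a z.1) (c z.2) ∂(μ.prod ν) = inner ℝ (∫ x, a x ∂μ) (∫ y, c y ∂ν) := by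
  rw [integral_prod]
  · have h1 : ∀ x, ∫ y, inner ℝ (a x) (c y) ∂ν = inner ℝ (a x) (∫ y, c y ∂ν) := fun x =>
      integral_inner (integrable_of_bound hc hD) _
    simp_rw [h1, real_inner_comm (∫ y, c y ∂ν)]
    exact integral_inner (integrable_of_bound ha hC) _
  · refine integrable_of_bound (C := C * D)
      ((ha.comp measurable_fst).inner (hc.comp measurable_snd)) fun z => ?_
    exact (norm_inner_le_norm _ _).trans (mul_le_mul (hC _) (hD _) (norm_nonneg _)
      ((norm_nonneg _).trans (hC z.1)))

lemma measurable_proj_simplex {l : Vec K} (hl : l ∈ simplex K) : Measurable (proj (simplex K)) :=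
  measurable_proj ⟨l, hl⟩ (isClosed_simplex K) (convex_simplex K)

lemma norm_simplex_sub_sq_le {l l' : Vec K} (hl : l ∈ simplex K) (hl' : l' ∈ simplex K) :
    ‖l - l'‖ ^ 2 ≤ 4 := by
  have := norm_ball_sub_sq_le (norm_simplex_le_one hl) (norm_simplex_le_one hl')
  linarith

/-- Balance of ‖v‖²: the weight step gives −2, its quadratic term at most 1/8 by `hcσ`, the
smoothness term of the actor at most 1 because κLβ ≤ 1, and Young's inequality for the bias 1/2. The
total is −3/8. The cross terms ⟨v, ∑ l_k h_k⟩ and κ⟨v, g⟩ meet only in their difference, for any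
comparison weights l. -/
lemma one_step_descent {μ₁ : Measure Ω₁} {μ₂ : Measure Ω₂} [IsProbabilityMeasure μ₁]
    [IsProbabilityMeasure μ₂] {G : Ω₁ → Fin K → Vec p} {D : Ω₂ → Vec p} {σ N₁ N₂ : ℝ}
    (hG : ∀ k, Measurable fun ω => G ω k) (hGσ : ∀ ω k, ‖G ω k‖ ≤ σ) (hD : Measurable D)
    (hDσ : ∀ ω, ‖D ω‖ ≤ σ) {h : Fin K → Vec p} (hGh : ∀ k, ∫ ω, G ω k ∂μ₁ = h k) {u l : Vec K}
    (hu : u ∈ simplex K) (hl : l ∈ simplex K) {v : Vec p} (hv : v = ∑ k, u k • h k)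
    (hG2 : ∫ ω, ‖∑ k, u k • G ω k‖ ^ 2 ∂μ₁ ≤ ‖v‖ ^ 2 + σ ^ 2 / N₁) (hDv : ∫ ω, D ω ∂μ₂ = v)
    (hD2 : ∫ ω, ‖D ω‖ ^ 2 ∂μ₂ ≤ ‖v‖ ^ 2 + σ ^ 2 / N₂)
    {F : Vec p → ℝ} {g θ : Vec p} {L β c κ b : ℝ} (hF : Measurable F) (hFb : ∀ x, |F x| ≤ b)
    (hβ : 0 < β) (hc : 0 < c) (hκ0 : 0 < κ) (hκ1 : κ ≤ 1) (hL : 0 ≤ L) (hβL : β * L ≤ 1)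
    (hcσ : c * (K * σ ^ 2) ≤ 1 / 8)
    (hdesc : ∀ d, F θ + inner ℝ g d - L / 2 * ‖d‖ ^ 2 ≤ F (θ + d)) :
    ∫ ω, (1 / c * min (‖fcUpdate c u (G ω.1.1) (G ω.1.2) - l‖ ^ 2) 4 -
        2 * κ / β * F (θ + β • D ω.2)) ∂((μ₁.prod μ₁).prod μ₂) + 3 / 8 * ‖v‖ ^ 2 ≤
      1 / c * min (‖u - l‖ ^ 2) 4 - 2 * κ / β * F θ + κ * L * β * σ ^ 2 / N₂ +
        c * K * σ ^ 4 / N₁ + 2 * ‖∑ k, l k • h k - κ • g‖ ^ 2 := by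
  have hσ0 : 0 ≤ σ := by
    obtain ⟨ω⟩ := nonempty_of_isProbabilityMeasure μ₂
    exact (norm_nonneg _).trans (hDσ ω)
  let a : Ω₁ → Vec p := fun ω => ∑ k, u k • G ω k
  have ma : Measurable a := Finset.measurable_sum _ fun k _ => (hG k).const_smul (u k)
  have ha : ∀ ω, ‖a ω‖ ≤ σ := fun ω => norm_sum_smul_le hu (hGσ ω)
  have hav : ∫ ω, a ω ∂μ₁ = v := by
    have hi : ∀ k, Integrable (fun ω => u k • G ω k) μ₁ := fun k =>
      (integrable_of_bound (hG k) fun ω => hGσ ω k).smul (u k)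
    simp only [a]
    rw [integral_finsetSum _ fun k _ => hi k]
    simp_rw [integral_smul, hGh]
    exact hv.symm
  let z : Ω₁ × Ω₁ → Vec K := fun ω => WithLp.toLp 2 fun k => inner ℝ (a ω.1) (G ω.2 k)
  have mz : Measurable z := (WithLp.measurable_toLp 2 _).comp (measurable_pi_lambda _ fun k =>
    (ma.comp measurable_fst).inner ((hG k).comp measurable_snd))
  have hz : ∀ ω, ‖z ω‖ ^ 2 ≤ K * σ ^ 2 * ‖a ω.1‖ ^ 2 := fun ω => by
    rw [EuclideanSpace.real_norm_sq_eq]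
    calc _ ≤ ∑ _k : Fin K, σ ^ 2 * ‖a ω.1‖ ^ 2 := Finset.sum_le_sum fun k _ => by
          have h1 := (abs_real_inner_le_norm (a ω.1) (G ω.2 k)).trans
            (mul_le_mul_of_nonneg_left (hGσ ω.2 k) (norm_nonneg _))
          have h2 := pow_le_pow_left₀ (abs_nonneg _) h1 2
          rw [sq_abs] at h2
          simp only [z]
          linarith
      _ = _ := by simp; ring
  have hupd : ∀ ω : Ω₁ × Ω₁, fcUpdate c u (G ω.1) (G ω.2) = proj (simplex K) (u - c • z ω) :=
    fun ω => rfl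
  have hlam : ∀ ω : Ω₁ × Ω₁, ‖fcUpdate c u (G ω.1) (G ω.2) - l‖ ^ 2 ≤
      ‖u - l‖ ^ 2 - 2 * c * inner ℝ (u - l) (z ω) + c ^ 2 * (K * σ ^ 2 * ‖a ω.1‖ ^ 2) := fun ω => by
    have h1 : ‖fcUpdate c u (G ω.1) (G ω.2) - l‖ ≤ ‖(u - l) - c • z ω‖ := by
      rw [hupd, sub_right_comm]
      exact norm_proj_sub_le (isClosed_simplex K) (convex_simplex K) _ hl
    have h2 := pow_le_pow_left₀ (norm_nonneg _) h1 2
    rw [norm_sub_sq_real (u - l) (c • z ω), inner_smul_right, norm_smul,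
      Real.norm_of_nonneg hc.le, mul_pow] at h2
    have h3 : c ^ 2 * ‖z ω‖ ^ 2 ≤ c ^ 2 * (K * σ ^ 2 * ‖a ω.1‖ ^ 2) :=
      mul_le_mul_of_nonneg_left (hz ω) (by positivity)
    linarith
  have iz : ∀ k, Integrable (fun ω : Ω₁ × Ω₁ => (u - l) k * inner ℝ (a ω.1) (G ω.2 k))
      (μ₁.prod μ₁) := fun k => by
    refine (integrable_of_bound (C := σ * σ)
      ((ma.comp measurable_fst).inner ((hG k).comp measurable_snd)) fun ω => ?_).const_mul _
    exact (norm_inner_le_norm _ _).trans (mul_le_mul (ha _) (hGσ _ _) (norm_nonneg _) hσ0)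
  have hinner : ∀ ω, inner ℝ (u - l) (z ω) = ∑ k, (u - l) k * inner ℝ (a ω.1) (G ω.2 k) :=
    fun ω => by
      simp only [PiLp.inner_apply, RCLike.inner_apply, conj_trivial, z]
      exact Finset.sum_congr rfl fun k _ => mul_comm _ _
  have iinner : Integrable (fun ω => inner ℝ (u - l) (z ω)) (μ₁.prod μ₁) := by
    simp_rw [hinner]; exact integrable_finsetSum _ fun k _ => iz k
  -- Independence of the two batches factorizes the mean of ⟨a, G_k⟩ into ⟨v, h_k⟩. A single batch
  -- would add a variance term here.
  have hzint : ∫ ω, inner ℝ (u - l) (z ω) ∂(μ₁.prod μ₁) =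
      ‖v‖ ^ 2 - inner ℝ v (∑ k, l k • h k) := by
    simp_rw [hinner]
    rw [integral_finsetSum _ fun k _ => iz k]
    simp_rw [integral_const_mul, integral_inner_prod ma (hG _) ha (fun ω => hGσ ω _), hav, hGh]
    rw [← real_inner_self_eq_norm_sq, ← inner_sub_right]
    -- Only the v inside the difference is expanded, so that v − ∑ l_k h_k combines to ∑ (u − l)_k
    -- h_k while the other factor stays v.
    nth_rewrite 3 [hv]
    rw [← Finset.sum_sub_distrib, inner_sum]
    refine Finset.sum_congr rfl fun k _ => ?_
    rw [← sub_smul, inner_smul_right]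
    rfl
  have ia2 : Integrable (fun ω => ‖a ω‖ ^ 2) μ₁ :=
    integrable_of_bound (C := σ ^ 2) (ma.norm.pow_const 2) fun ω => by
      rw [norm_pow, norm_norm]; exact pow_le_pow_left₀ (norm_nonneg _) (ha ω) 2
  have iD : Integrable D μ₂ := integrable_of_bound hD hDσ
  have iD2 : Integrable (fun ω => ‖D ω‖ ^ 2) μ₂ :=
    integrable_of_bound (C := σ ^ 2) (hD.norm.pow_const 2) fun ω => by
      rw [norm_pow, norm_norm]; exact pow_le_pow_left₀ (norm_nonneg _) (hDσ ω) 2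
  have igD : Integrable (fun ω => inner ℝ g (D ω)) μ₂ := iD.const_inner g
  let f₁ : Ω₁ × Ω₁ → ℝ := fun ω => 1 / c * (‖u - l‖ ^ 2 - 2 * c * inner ℝ (u - l) (z ω) +
    c ^ 2 * (K * σ ^ 2 * ‖a ω.1‖ ^ 2))
  let f₂ : Ω₂ → ℝ := fun ω => 2 * κ / β * (F θ + β * inner ℝ g (D ω) -
    L / 2 * β ^ 2 * ‖D ω‖ ^ 2)
  have ia2' : Integrable (fun ω : Ω₁ × Ω₁ => ‖a ω.1‖ ^ 2) (μ₁.prod μ₁) := ia2.comp_fst μ₁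
  have if₁a : Integrable (fun ω : Ω₁ × Ω₁ => ‖u - l‖ ^ 2 - 2 * c * inner ℝ (u - l) (z ω))
    (μ₁.prod μ₁) := (integrable_const _).sub (iinner.const_mul _)
  have if₁b : Integrable (fun ω : Ω₁ × Ω₁ => c ^ 2 * (K * σ ^ 2 * ‖a ω.1‖ ^ 2))
    (μ₁.prod μ₁) := (ia2'.const_mul _).const_mul _
  have if₁ : Integrable f₁ (μ₁.prod μ₁) := (if₁a.add if₁b).const_mul _
  have if₂a : Integrable (fun ω => F θ + β * inner ℝ g (D ω)) μ₂ :=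
    (integrable_const _).add (igD.const_mul _)
  have if₂b : Integrable (fun ω => L / 2 * β ^ 2 * ‖D ω‖ ^ 2) μ₂ := iD2.const_mul _
  have if₂ : Integrable f₂ μ₂ := (if₂a.sub if₂b).const_mul _
  have e₁ : ∫ ω, f₁ ω ∂(μ₁.prod μ₁) = 1 / c * (‖u - l‖ ^ 2 -
      2 * c * (‖v‖ ^ 2 - inner ℝ v (∑ k, l k • h k)) +
      c ^ 2 * (K * σ ^ 2 * ∫ ω, ‖a ω‖ ^ 2 ∂μ₁)) := by
    simp only [f₁]
    rw [integral_const_mul, integral_add if₁a if₁b, integral_sub (integrable_const _)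
      (iinner.const_mul _), integral_const_mul, integral_const_mul, integral_const_mul, hzint,
      integral_fun_fst (fun ω => ‖a ω‖ ^ 2)]
    simp
  have e₂ : ∫ ω, f₂ ω ∂μ₂ = 2 * κ / β * (F θ + β * inner ℝ g v -
      L / 2 * β ^ 2 * ∫ ω, ‖D ω‖ ^ 2 ∂μ₂) := by
    simp only [f₂]
    rw [integral_const_mul, integral_sub if₂a if₂b, integral_add (integrable_const _)
      (igD.const_mul _), integral_const_mul, integral_const_mul, integral_inner iD, hDv]
    simp
  have hpt : ∀ ω : (Ω₁ × Ω₁) × Ω₂, 1 / c * min (‖fcUpdate c u (G ω.1.1) (G ω.1.2) - l‖ ^ 2) 4 -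
      2 * κ / β * F (θ + β • D ω.2) ≤ f₁ ω.1 - f₂ ω.2 := fun ω => by
    refine sub_le_sub (mul_le_mul_of_nonneg_left ((min_le_left _ _).trans (hlam ω.1))
      (by positivity)) (mul_le_mul_of_nonneg_left ?_ (by positivity))
    have := hdesc (β • D ω.2)
    rw [inner_smul_right, norm_smul, Real.norm_of_nonneg hβ.le, mul_pow] at this
    linarith
  have mupd : Measurable fun ω : (Ω₁ × Ω₁) × Ω₂ => fcUpdate c u (G ω.1.1) (G ω.1.2) := by
    simp_rw [hupd]
    exact (measurable_proj_simplex hu).comp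
      (((mz.comp measurable_fst).const_smul c).const_sub u)
  have iL : Integrable (fun ω : (Ω₁ × Ω₁) × Ω₂ =>
      1 / c * min (‖fcUpdate c u (G ω.1.1) (G ω.1.2) - l‖ ^ 2) 4 -
      2 * κ / β * F (θ + β • D ω.2)) ((μ₁.prod μ₁).prod μ₂) := by
    refine Integrable.sub (Integrable.const_mul ?_ _) (Integrable.const_mul ?_ _)
    · refine integrable_of_bound (C := 4)
        (((mupd.sub_const l).norm.pow_const 2).min measurable_const) fun ω => ?_
      rw [Real.norm_of_nonneg (by positivity)]
      exact min_le_right _ _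
    · exact integrable_of_bound (hF.comp (((hD.comp measurable_snd).const_smul β).const_add θ))
        fun ω => hFb _
  have hmono := integral_mono iL ((if₁.comp_fst μ₂).sub (if₂.comp_snd (μ₁.prod μ₁))) hpt
  simp only [Pi.sub_apply] at hmono
  rw [integral_sub (if₁.comp_fst μ₂) (if₂.comp_snd (μ₁.prod μ₁)), integral_fun_fst,
    integral_fun_snd, e₁, e₂] at hmono
  simp only [probReal_univ, one_smul] at hmono
  rw [min_eq_left (norm_simplex_sub_sq_le hu hl)]
  set I₁ := ∫ ω, ‖a ω‖ ^ 2 ∂μ₁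
  set I₂ := ∫ ω, ‖D ω‖ ^ 2 ∂μ₂
  set hb := ∑ k, l k • h k
  have hyoung : 2 * inner ℝ v (hb - κ • g) ≤ 1 / 2 * ‖v‖ ^ 2 + 2 * ‖hb - κ • g‖ ^ 2 := by
    have := real_inner_le_norm v (hb - κ • g)
    nlinarith [sq_nonneg (‖v‖ - 2 * ‖hb - κ • g‖)]
  rw [inner_sub_right, inner_smul_right, real_inner_comm g v] at hyoung
  have t1 : 1 / c * (‖u - l‖ ^ 2 - 2 * c * (‖v‖ ^ 2 - inner ℝ v hb) + c ^ 2 * (K * σ ^ 2 * I₁)) =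
      1 / c * ‖u - l‖ ^ 2 - 2 * (‖v‖ ^ 2 - inner ℝ v hb) + c * (K * σ ^ 2) * I₁ := by
    field_simp
  have t2 : 2 * κ / β * (F θ + β * inner ℝ g v - L / 2 * β ^ 2 * I₂) =
      2 * κ / β * F θ + 2 * κ * inner ℝ g v - κ * L * β * I₂ := by
    field_simp
  rw [t1, t2] at hmono
  have t3 : c * (K * σ ^ 2) * I₁ ≤ 1 / 8 * ‖v‖ ^ 2 + c * K * σ ^ 4 / N₁ := by
    have h1 : c * (K * σ ^ 2) * I₁ ≤ c * (K * σ ^ 2) * (‖v‖ ^ 2 + σ ^ 2 / N₁) :=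
      mul_le_mul_of_nonneg_left hG2 (by positivity)
    have h2 : c * (K * σ ^ 2) * ‖v‖ ^ 2 ≤ 1 / 8 * ‖v‖ ^ 2 :=
      mul_le_mul_of_nonneg_right hcσ (by positivity)
    have h3 : c * (K * σ ^ 2) * (σ ^ 2 / N₁) = c * K * σ ^ 4 / N₁ := by ring
    linarith
  have t4 : κ * L * β * I₂ ≤ ‖v‖ ^ 2 + κ * L * β * σ ^ 2 / N₂ := by
    have h1 : κ * L * β * I₂ ≤ κ * L * β * (‖v‖ ^ 2 + σ ^ 2 / N₂) :=
      mul_le_mul_of_nonneg_left hD2 (by positivity)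
    have h2 : κ * L * β ≤ 1 := by
      have : 0 ≤ β * L := by positivity
      nlinarith
    have h3 := mul_le_mul_of_nonneg_right h2 (sq_nonneg ‖v‖)
    have h4 : κ * L * β * (σ ^ 2 / N₂) = κ * L * β * σ ^ 2 / N₂ := by ring
    linarith
  linarith

end OneStep

/-! ### Laws of the algorithm and bias of the gradient estimates. -/

section Algorithm

variable {K p q : ℕ} {S A : Type*} [MeasurableSpace S] [MeasurableSpace A]
  {M : MultiTaskMDP K S A} {pol : PolicyClass p S A} {φ : Fin K → S × A → Vec q}
  {Cφ Lφ γ B lamA m ρ : ℝ}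

lemma isProb_batchLaw (hγ0 : 0 ≤ γ) (hγ1 : γ < 1) (θ : Vec p) (N : ℕ) :
    IsProbabilityMeasure (batchLaw γ M pol θ N) := by
  have := fun k => isProb_visitation M pol k hγ0 hγ1 θ
  unfold batchLaw; infer_instance

lemma measurable_batchLaw (hγ0 : 0 ≤ γ) (hγ1 : γ < 1) (N : ℕ) :
    Measurable fun θ : Vec p => batchLaw γ M pol θ N := by
  have h := fun θ k => isProb_visitation M pol k hγ0 hγ1 θ
  refine measurable_pi_param (fun _ => measurable_pi_param (fun k => measurable_visitation γ M pol k)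
    fun k θ => h θ k) fun _ θ => ?_
  have := h θ
  infer_instance

lemma measurable_smul_fun {Z E : Type*} [MeasurableSpace Z] [NormedAddCommGroup E]
    [NormedSpace ℝ E] [MeasurableSpace E] [BorelSpace E] [SecondCountableTopology E]
    {f : Z → ℝ} {g : Z → E} (hf : Measurable f) (hg : Measurable g) :
    Measurable fun z => f z • g z := hf.smul hg

/-- One summand of the gradient estimate of task `k`. -/
noncomputable def gradSample (pol : PolicyClass p S A) (φ : Fin K → S × A → Vec q) (θ : Vec p)
    (w : Fin K → Vec q) (k : Fin K) (y : Fin K → S × A) : Vec p :=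
  inner ℝ (φ k (y k)) (w k) • score pol θ (y k)

/-- The mean of the gradient estimate of task `k`. -/
noncomputable def meanGrad (γ : ℝ) (M : MultiTaskMDP K S A) (pol : PolicyClass p S A)
    (φ : Fin K → S × A → Vec q) (θ : Vec p) (k : Fin K) (w : Vec q) : Vec p :=
  ∫ x, inner ℝ (φ k x) w • score pol θ x ∂(visitation γ M pol k θ)

lemma measurable_gradEst {Z : Type*} [MeasurableSpace Z] (h : SmoothBounded pol φ Cφ Lφ)
    (hφ : ∀ k, Measurable (φ k)) {N : ℕ} {θ : Z → Vec p} {w : Z → Fin K → Vec q}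
    {b : Z → Fin N → Fin K → S × A} (hθ : Measurable θ) (hw : Measurable w) (hb : Measurable b)
    (k : Fin K) : Measurable fun z => gradEst pol φ (θ z) (w z) (b z) k := by
  have hbk : ∀ i, Measurable fun z => b z i k := fun i =>
    (measurable_pi_apply k).comp ((measurable_pi_apply i).comp hb)
  have hwk : Measurable fun z => w z k := (measurable_pi_apply k).comp hw
  have hsum : Measurable fun z =>
      ∑ i, inner ℝ (φ k (b z i k)) (w z k) • score pol (θ z) (b z i k) := by
    refine Finset.measurable_sum _ fun i _ => ?_
    have h1 := ((hφ k).comp (hbk i)).inner (𝕜 := ℝ) hwk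
    have h2 := (measurable_score h).comp (hθ.prodMk (hbk i))
    exact measurable_smul_fun h1 h2
  exact hsum.const_smul (1 / (N : ℝ))

lemma measurable_fcUpdate {Z : Type*} [MeasurableSpace Z] {c : ℝ} {l : Vec K} (hl : l ∈ simplex K)
    {u : Z → Vec K} {g g' : Z → Fin K → Vec p} (hu : Measurable u)
    (hg : ∀ k, Measurable fun z => g z k) (hg' : ∀ k, Measurable fun z => g' z k) :
    Measurable fun z => fcUpdate c (u z) (g z) (g' z) := by
  have hs : Measurable fun z => ∑ i, u z i • g z i :=
    Finset.measurable_sum _ fun i _ => by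
      have h1 : Measurable fun z => u z i := by fun_prop
      exact measurable_smul_fun h1 (hg i)
  exact (measurable_proj_simplex hl).comp (hu.sub
    (((WithLp.measurable_toLp 2 _).comp (measurable_pi_lambda _ fun k =>
      hs.inner (hg' k))).const_smul c))

/-- The law of the three batches of one iteration. -/
noncomputable def batchesLaw (γ : ℝ) (M : MultiTaskMDP K S A) (pol : PolicyClass p S A)
    (par : Params) (θ : Vec p) : Measure (((Fin par.NFC → Fin K → S × A) ×
      (Fin par.NFC → Fin K → S × A)) × (Fin par.Nactor → Fin K → S × A)) :=
  ((batchLaw γ M pol θ par.NFC).prod (batchLaw γ M pol θ par.NFC)).prod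
    (batchLaw γ M pol θ par.Nactor)

/-- The state after one iteration, given the critic output and the batches. -/
noncomputable def nextState (pol : PolicyClass p S A) (φ : Fin K → S × A → Vec q) (par : Params)
    (x : State K p q) (w : Fin K → Vec q) (b : ((Fin par.NFC → Fin K → S × A) ×
      (Fin par.NFC → Fin K → S × A)) × (Fin par.Nactor → Fin K → S × A)) : State K p q :=
  (x.1 + par.β • ∑ k, x.2.2 k • gradEst pol φ x.1 w b.2 k, w,
    fcUpdate par.c x.2.2 (gradEst pol φ x.1 w b.1.1) (gradEst pol φ x.1 w b.1.2))

/-- The law of the critic outputs of all tasks. -/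
noncomputable def criticsLaw (γ B lamA : ℝ) (M : MultiTaskMDP K S A) (pol : PolicyClass p S A)
    (φ : Fin K → S × A → Vec q) (mode : CriticSampling) (N : ℕ) (x : State K p q) :
    Measure (Fin K → Vec q) :=
  Measure.pi fun k => (criticLaw γ B lamA M pol φ mode k x.1 (x.2.1 k) N).map Prod.fst

lemma iterLaw_eq (mode : CriticSampling) (par : Params) (x : State K p q) :
    iterLaw γ B lamA M pol φ mode par x =
      (criticsLaw γ B lamA M pol φ mode par.Ncritic x).bind fun w =>
        (batchesLaw γ M pol par x.1).map (nextState pol φ par x w) := rfl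

lemma isProb_batchesLaw (hγ0 : 0 ≤ γ) (hγ1 : γ < 1) (par : Params) (θ : Vec p) :
    IsProbabilityMeasure (batchesLaw γ M pol par θ) := by
  have := fun N => isProb_batchLaw (M := M) (pol := pol) hγ0 hγ1 θ N
  unfold batchesLaw; infer_instance

lemma measurable_batchesLaw (hγ0 : 0 ≤ γ) (hγ1 : γ < 1) (par : Params) :
    Measurable (batchesLaw γ M pol par) := by
  have h := fun N => measurable_batchLaw (M := M) (pol := pol) hγ0 hγ1 N
  have hp := fun N θ => isProb_batchLaw (M := M) (pol := pol) hγ0 hγ1 θ N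
  refine measurable_prod_param (measurable_prod_param (h _) (hp _) (h _) (hp _)) (fun θ => ?_)
    (h _) (hp _)
  have := fun N => hp N θ
  infer_instance

lemma isProb_criticLaw_fst (hγ0 : 0 ≤ γ) (hγ1 : γ < 1) (hB : 0 ≤ B) (hφ : ∀ k, Measurable (φ k))
    (mode : CriticSampling) (N : ℕ) (θ : Vec p) (w : Vec q) (k : Fin K) :
    IsProbabilityMeasure ((criticLaw γ B lamA M pol φ mode k θ w N).map Prod.fst) := by
  have := (criticLaw_aux (M := M) (pol := pol) (lamA := lamA) hγ0 hγ1 hB (hφ k) mode N).1 (θ, w)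
  exact Measure.isProbabilityMeasure_map measurable_fst.aemeasurable

lemma isProb_criticsLaw (hγ0 : 0 ≤ γ) (hγ1 : γ < 1) (hB : 0 ≤ B) (hφ : ∀ k, Measurable (φ k))
    (mode : CriticSampling) (N : ℕ) (x : State K p q) :
    IsProbabilityMeasure (criticsLaw γ B lamA M pol φ mode N x) := by
  have := fun k => isProb_criticLaw_fst (M := M) (pol := pol) (lamA := lamA) hγ0 hγ1 hB hφ mode N
    x.1 (x.2.1 k) k
  unfold criticsLaw; infer_instance

lemma measurable_criticsLaw (hγ0 : 0 ≤ γ) (hγ1 : γ < 1) (hB : 0 ≤ B) (hφ : ∀ k, Measurable (φ k))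
    (mode : CriticSampling) (N : ℕ) :
    Measurable (criticsLaw γ B lamA M pol φ mode N) := by
  refine measurable_pi_param (μ := fun k (x : State K p q) =>
    (criticLaw γ B lamA M pol φ mode k x.1 (x.2.1 k) N).map Prod.fst) (fun k => ?_)
    fun k x => isProb_criticLaw_fst hγ0 hγ1 hB hφ mode N x.1 (x.2.1 k) k
  exact (Measure.measurable_map _ measurable_fst).comp
    ((criticLaw_aux (M := M) (pol := pol) (lamA := lamA) hγ0 hγ1 hB (hφ k) mode N).2.comp
      (f := fun x : State K p q => (x.1, x.2.1 k)) (by fun_prop))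

lemma measurable_nextState_comp {Z : Type*} [MeasurableSpace Z] (h : SmoothBounded pol φ Cφ Lφ)
    (hφ : ∀ k, Measurable (φ k)) {l : Vec K} (hl : l ∈ simplex K) (par : Params)
    {x : Z → State K p q} {w : Z → Fin K → Vec q} {b b' : Z → Fin par.NFC → Fin K → S × A}
    {d : Z → Fin par.Nactor → Fin K → S × A} (hx : Measurable x) (hw : Measurable w)
    (hb : Measurable b) (hb' : Measurable b') (hd : Measurable d) :
    Measurable fun z => nextState pol φ par (x z) (w z) ((b z, b' z), d z) := by
  have m1 : ∀ k, Measurable fun z => gradEst pol φ (x z).1 (w z) (d z) k := fun k =>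
    measurable_gradEst h hφ hx.fst hw hd k
  have m2 : ∀ k, Measurable fun z => gradEst pol φ (x z).1 (w z) (b z) k := fun k =>
    measurable_gradEst h hφ hx.fst hw hb k
  have m3 : ∀ k, Measurable fun z => gradEst pol φ (x z).1 (w z) (b' z) k := fun k =>
    measurable_gradEst h hφ hx.fst hw hb' k
  have m4 : Measurable fun z => ∑ k, (x z).2.2 k • gradEst pol φ (x z).1 (w z) (d z) k :=
    Finset.measurable_sum _ fun k _ => by
      have h1 : Measurable fun z => (x z).2.2 k := by fun_prop
      exact measurable_smul_fun h1 (m1 k)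
  have m5 : Measurable fun z => (x z).1 + par.β • ∑ k, (x z).2.2 k •
      gradEst pol φ (x z).1 (w z) (d z) k :=
    Measurable.add hx.fst (m4.const_smul par.β)
  have m6 := measurable_fcUpdate (c := par.c) hl hx.snd.snd m2 m3
  exact m5.prodMk (hw.prodMk m6)

lemma measurable_nextState (h : SmoothBounded pol φ Cφ Lφ) (hφ : ∀ k, Measurable (φ k))
    {l : Vec K} (hl : l ∈ simplex K) (par : Params) :
    Measurable fun z : (State K p q × (Fin K → Vec q)) × (((Fin par.NFC → Fin K → S × A) ×
      (Fin par.NFC → Fin K → S × A)) × (Fin par.Nactor → Fin K → S × A)) =>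
      nextState pol φ par z.1.1 z.1.2 z.2 :=
  measurable_nextState_comp h hφ hl par measurable_fst.fst measurable_fst.snd
    measurable_snd.fst.fst measurable_snd.fst.snd measurable_snd.snd

lemma measurable_stepKernel (h : SmoothBounded pol φ Cφ Lφ) (hφ : ∀ k, Measurable (φ k))
    (hγ0 : 0 ≤ γ) (hγ1 : γ < 1) {l : Vec K} (hl : l ∈ simplex K) (par : Params) :
    Measurable fun z : State K p q × (Fin K → Vec q) =>
      (batchesLaw γ M pol par z.1.1).map (nextState pol φ par z.1 z.2) :=
  measurable_map_param (μ := fun z : State K p q × (Fin K → Vec q) => batchesLaw γ M pol par z.1.1)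
    ((measurable_batchesLaw hγ0 hγ1 par).comp measurable_fst.fst)
    (fun z => isProb_batchesLaw hγ0 hγ1 par z.1.1)
    (f := fun z b => nextState pol φ par z.1 z.2 b) (measurable_nextState h hφ hl par)

lemma isProb_stepKernel (h : SmoothBounded pol φ Cφ Lφ) (hφ : ∀ k, Measurable (φ k))
    (hγ0 : 0 ≤ γ) (hγ1 : γ < 1) {l : Vec K} (hl : l ∈ simplex K) (par : Params)
    (x : State K p q) (w : Fin K → Vec q) :
    IsProbabilityMeasure ((batchesLaw γ M pol par x.1).map (nextState pol φ par x w)) := by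
  have := isProb_batchesLaw (M := M) (pol := pol) hγ0 hγ1 par x.1
  exact Measure.isProbabilityMeasure_map ((measurable_nextState h hφ hl par).comp
    (f := fun b => ((x, w), b)) (by fun_prop)).aemeasurable

lemma measurable_iterLaw (h : SmoothBounded pol φ Cφ Lφ) (hφ : ∀ k, Measurable (φ k))
    (hγ0 : 0 ≤ γ) (hγ1 : γ < 1) (hB : 0 ≤ B) {l : Vec K} (hl : l ∈ simplex K)
    (mode : CriticSampling) (par : Params) :
    Measurable (iterLaw γ B lamA M pol φ mode par) :=
  measurable_bind_param (measurable_criticsLaw hγ0 hγ1 hB hφ mode par.Ncritic)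
    (isProb_criticsLaw hγ0 hγ1 hB hφ mode par.Ncritic)
    (κ := fun x w => (batchesLaw γ M pol par x.1).map (nextState pol φ par x w))
    (measurable_stepKernel h hφ hγ0 hγ1 hl par)

lemma isProb_iterLaw (h : SmoothBounded pol φ Cφ Lφ) (hφ : ∀ k, Measurable (φ k))
    (hγ0 : 0 ≤ γ) (hγ1 : γ < 1) (hB : 0 ≤ B) {l : Vec K} (hl : l ∈ simplex K)
    (mode : CriticSampling) (par : Params) (x : State K p q) :
    IsProbabilityMeasure (iterLaw γ B lamA M pol φ mode par x) := by
  have := isProb_criticsLaw (M := M) (pol := pol) (lamA := lamA) hγ0 hγ1 hB hφ mode par.Ncritic x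
  exact isProb_bind (μ := criticsLaw γ B lamA M pol φ mode par.Ncritic x)
    ((measurable_stepKernel h hφ hγ0 hγ1 hl par).comp
    (f := fun w => (x, w)) (by fun_prop)) fun w => isProb_stepKernel h hφ hγ0 hγ1 hl par x w

lemma isProb_runLaw (h : SmoothBounded pol φ Cφ Lφ) (hφ : ∀ k, Measurable (φ k))
    (hγ0 : 0 ≤ γ) (hγ1 : γ < 1) (hB : 0 ≤ B) {l : Vec K} (hl : l ∈ simplex K)
    (mode : CriticSampling) (par : Params) (x₀ : State K p q) (t : ℕ) :
    IsProbabilityMeasure (runLaw γ B lamA M pol φ mode par x₀ t) := by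
  induction t with
  | zero => unfold runLaw; infer_instance
  | succ t ih =>
    exact isProb_bind (measurable_iterLaw h hφ hγ0 hγ1 hB hl mode par)
      (isProb_iterLaw h hφ hγ0 hγ1 hB hl mode par)

lemma measurableSet_state_simplex :
    MeasurableSet {x : State K p q | x.2.2 ∈ simplex K} :=
  measurable_snd.snd (isClosed_simplex K).measurableSet

lemma ae_runLaw_simplex (h : SmoothBounded pol φ Cφ Lφ) (hφ : ∀ k, Measurable (φ k))
    (hγ0 : 0 ≤ γ) (hγ1 : γ < 1) (hB : 0 ≤ B) (mode : CriticSampling)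
    (par : Params) {x₀ : State K p q} (hx₀ : x₀.2.2 ∈ simplex K) (t : ℕ) :
    ∀ᵐ x ∂(runLaw γ B lamA M pol φ mode par x₀ t), x.2.2 ∈ simplex K := by
  cases t with
  | zero => exact (ae_dirac_iff measurableSet_state_simplex).2 hx₀
  | succ t =>
    refine ae_bind (measurable_iterLaw h hφ hγ0 hγ1 hB hx₀ mode par) measurableSet_state_simplex
      (ae_of_all _ fun x => ?_)
    refine ae_bind ((measurable_stepKernel h hφ hγ0 hγ1 hx₀ par).comp
      (f := fun w => (x, w)) (by fun_prop)) measurableSet_state_simplex (ae_of_all _ fun w => ?_)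
    refine (ae_map_iff ((measurable_nextState h hφ hx₀ par).comp
      (f := fun b => ((x, w), b)) (by fun_prop)).aemeasurable measurableSet_state_simplex).2
      (ae_of_all _ fun b => ?_)
    exact (proj_spec ⟨_, hx₀⟩ (isClosed_simplex K) (convex_simplex K) _).1

lemma norm_gradSample_le (h : SmoothBounded pol φ Cφ Lφ) (hCφ : 0 ≤ Cφ) (hB : 0 ≤ B) (θ : Vec p)
    {w : Fin K → Vec q} (hw : ∀ k, ‖w k‖ ≤ B) (k : Fin K) (y : Fin K → S × A) :
    ‖gradSample pol φ θ w k y‖ ≤ Cφ ^ 2 * B := by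
  rw [gradSample, norm_smul]
  calc _ ≤ Cφ * B * Cφ := mul_le_mul ((norm_inner_le_norm _ _).trans
        (mul_le_mul (h.2.2.1 k _) (hw k) (norm_nonneg _) hCφ)) (h.2.1 θ _) (norm_nonneg _)
        (by positivity)
    _ = _ := by ring

lemma measurable_gradSample (h : SmoothBounded pol φ Cφ Lφ) (hφ : ∀ k, Measurable (φ k))
    (θ : Vec p) (w : Fin K → Vec q) (k : Fin K) : Measurable (gradSample pol φ θ w k) :=
  measurable_smul_fun (((hφ k).comp (measurable_pi_apply k)).inner measurable_const)
    ((measurable_score_right h θ).comp (measurable_pi_apply k))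

lemma integral_gradSample (h : SmoothBounded pol φ Cφ Lφ) (hφ : ∀ k, Measurable (φ k))
    (hγ0 : 0 ≤ γ) (hγ1 : γ < 1) (θ : Vec p) (w : Fin K → Vec q) (k : Fin K) :
    ∫ y, gradSample pol φ θ w k y ∂(Measure.pi fun k => visitation γ M pol k θ) =
      meanGrad γ M pol φ θ k (w k) := by
  have := fun k => isProb_visitation M pol k hγ0 hγ1 θ
  exact integral_pi_eval (μ := fun k => visitation γ M pol k θ) k
    (f := fun x => inner ℝ (φ k x) (w k) • score pol θ x)
    (measurable_smul_fun ((hφ k).inner measurable_const) (measurable_score_right h θ))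

/-- One draw is a tuple with a pair for each task, so the weighted combination is an average of N
i.i.d. vectors. For u in the simplex these are bounded like a single task, so the variance carries
no factor K. -/
lemma sum_smul_gradEst (θ : Vec p) (w : Fin K → Vec q) (u : Vec K) {N : ℕ}
    (b : Fin N → Fin K → S × A) : ∑ k, u k • gradEst pol φ θ w b k =
      (1 / (N : ℝ)) • ∑ i, ∑ k, u k • gradSample pol φ θ w k (b i) := by
  simp only [gradEst, gradSample]
  rw [Finset.sum_comm, Finset.smul_sum]
  refine Finset.sum_congr rfl fun k _ => ?_
  rw [smul_comm, Finset.smul_sum]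

/-- The errors `E[∇̃J^k | w] - (1 - γ) ∇J^k`. -/
noncomputable def gradError (γ : ℝ) (M : MultiTaskMDP K S A) (pol : PolicyClass p S A)
    (φ : Fin K → S × A → Vec q) (θ : Vec p) (k : Fin K) (w : Vec q) : Vec p :=
  meanGrad γ M pol φ θ k w - (1 - γ) • gradient (J γ M pol k) θ

/-- Jensen's inequality from ‖a‖² = E⟨a, f⟩ ≤ ½E‖f‖² + ½‖a‖² with a the mean. -/
lemma norm_integral_sq_le {X : Type*} [MeasurableSpace X] {μ : Measure X} [IsProbabilityMeasure μ]
    {f : X → Vec p} (hf : Measurable f) {C : ℝ} (hC : ∀ x, ‖f x‖ ≤ C) :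
    ‖∫ x, f x ∂μ‖ ^ 2 ≤ ∫ x, ‖f x‖ ^ 2 ∂μ := by
  set a := ∫ x, f x ∂μ
  have i1 : Integrable (fun x => ‖f x‖ ^ 2) μ :=
    integrable_of_bound (C := C ^ 2) (hf.norm.pow_const 2) fun x => by
      rw [norm_pow, norm_norm]; exact pow_le_pow_left₀ (norm_nonneg _) (hC x) 2
  have h1 : ∫ x, inner ℝ a (f x) ∂μ = ‖a‖ ^ 2 := by
    rw [integral_inner (integrable_of_bound hf hC), real_inner_self_eq_norm_sq]
  have h2 : ∫ x, inner ℝ a (f x) ∂μ ≤ ∫ x, (1 / 2 * ‖f x‖ ^ 2 + 1 / 2 * ‖a‖ ^ 2) ∂μ := by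
    refine integral_mono ((integrable_of_bound hf hC).const_inner a)
      ((i1.const_mul _).add (integrable_const _)) fun x => ?_
    have := real_inner_le_norm a (f x)
    simp only
    nlinarith [sq_nonneg (‖a‖ - ‖f x‖)]
  rw [integral_add (i1.const_mul _) (integrable_const _), integral_const_mul, h1] at h2
  simp only [integral_const, probReal_univ, smul_eq_mul, one_mul] at h2
  linarith

lemma abs_approx_le (h : SmoothBounded pol φ Cφ Lφ) (hCφ : 0 ≤ Cφ) (hγ0 : 0 ≤ γ) (hγ1 : γ < 1)
    (θ : Vec p) (k : Fin K) {w : Vec q} {D : ℝ} (hw : ‖w‖ ≤ D) (x : S × A) :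
    |inner ℝ (φ k x) w - Q γ M pol k θ x| ≤ Cφ * D + 1 / (1 - γ) :=
  (abs_sub _ _).trans (add_le_add ((abs_real_inner_le_norm _ _).trans
    (mul_le_mul (h.2.2.1 k x) hw (norm_nonneg _) hCφ)) (abs_Q_le hγ0 hγ1 θ x))

lemma measurable_approx_error (hφ : ∀ k, Measurable (φ k)) (θ : Vec p) (k : Fin K) (w : Vec q) :
    Measurable fun x => inner ℝ (φ k x) w - Q γ M pol k θ x :=
  ((hφ k).inner measurable_const).sub (measurable_Q θ)

/-- The integral is the product of two equal roots; one is bounded by `epsApp` and the other by D,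
which is why ε_app enters linearly. The uniform bound D also makes the supremum in `epsApp` a true
one, since an unbounded real `⨆` has the default value 0. -/
lemma integral_approx_sq_le (h : SmoothBounded pol φ Cφ Lφ) (hCφ : 0 ≤ Cφ) (hB : 0 ≤ B)
    (hγ0 : 0 ≤ γ) (hγ1 : γ < 1)
    (hw : ∀ k θ, ‖tdLimit γ M pol φ k θ‖ ≤ B) (θ : Vec p) (k : Fin K) :
    ∫ x, (inner ℝ (φ k x) (tdLimit γ M pol φ k θ) - Q γ M pol k θ x) ^ 2
      ∂(visitation γ M pol k θ) ≤ (Cφ * B + 1 / (1 - γ)) * epsApp γ M pol φ := by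
  have hp := fun k θ => isProb_visitation M pol k hγ0 hγ1 θ
  have hg : 0 < 1 - γ := by linarith
  set D := Cφ * B + 1 / (1 - γ)
  have hD : 0 ≤ D := by positivity
  let I : Vec p × Fin K → ℝ := fun i => ∫ x,
    (inner ℝ (φ i.2 x) (tdLimit γ M pol φ i.2 i.1) - Q γ M pol i.2 i.1 x) ^ 2
      ∂(visitation γ M pol i.2 i.1)
  have hI : ∀ i, Real.sqrt (I i) ≤ D := fun i => by
    have := hp i.2 i.1
    refine Real.sqrt_le_iff.2 ⟨hD, (le_abs_self _).trans (abs_integral_le_bound fun x => ?_)⟩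
    rw [abs_of_nonneg (sq_nonneg _), ← sq_abs]
    exact pow_le_pow_left₀ (abs_nonneg _) (abs_approx_le h hCφ hγ0 hγ1 _ _ (hw _ _) x) 2
  have hsup : Real.sqrt (I (θ, k)) ≤ epsApp γ M pol φ :=
    le_ciSup (f := fun i => Real.sqrt (I i)) ⟨D, Set.forall_mem_range.2 hI⟩ (θ, k)
  have h0 : 0 ≤ I (θ, k) := integral_nonneg fun x => sq_nonneg _
  calc I (θ, k) = Real.sqrt (I (θ, k)) * Real.sqrt (I (θ, k)) := (Real.mul_self_sqrt h0).symm
    _ ≤ D * epsApp γ M pol φ := mul_le_mul (hI _) hsup (Real.sqrt_nonneg _) hD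

/-- By the policy gradient formula the bias is E[(φᵀw − Q)ψ]. Jensen, ‖ψ‖ ≤ Cφ, and the splitting of
φᵀw − Q at the TD limit separate the critic error from the approximation error. -/
lemma norm_gradError_sq_le (h : SmoothBounded pol φ Cφ Lφ) (hφ : ∀ k, Measurable (φ k))
    (hCφ : 0 ≤ Cφ) (hLφ : 0 ≤ Lφ) (hB : 0 ≤ B) (hγ0 : 0 ≤ γ) (hγ1 : γ < 1)
    (hws : ∀ k θ, ‖tdLimit γ M pol φ k θ‖ ≤ B) (θ : Vec p) (k : Fin K) (w : Vec q) :
    ‖gradError γ M pol φ θ k w‖ ^ 2 ≤ Cφ ^ 2 * (2 * Cφ ^ 2 * ‖w - tdLimit γ M pol φ k θ‖ ^ 2 +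
      2 * ((Cφ * B + 1 / (1 - γ)) * epsApp γ M pol φ)) := by
  have := isProb_visitation M pol k hγ0 hγ1 θ
  have hg : (1 - γ) ≠ 0 := by linarith
  set ws := tdLimit γ M pol φ k θ
  have ms := measurable_score_right h θ
  have hb := fun w => abs_approx_le (M := M) (θ := θ) (k := k) h hCφ hγ0 hγ1 (le_refl ‖w‖)
  have me := fun w => measurable_approx_error (M := M) (pol := pol) (γ := γ) hφ θ k w
  have hD0 : ∀ w : Vec q, 0 ≤ Cφ * ‖w‖ + 1 / (1 - γ) := fun w => by
    have : 0 < 1 - γ := by linarith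
    positivity
  have e1 : gradError γ M pol φ θ k w =
      ∫ x, (inner ℝ (φ k x) w - Q γ M pol k θ x) • score pol θ x ∂(visitation γ M pol k θ) := by
    rw [gradError, (hasGradientAt_J h hγ0 hγ1 hCφ hLφ θ).gradient, policyGrad, smul_smul,
      mul_one_div_cancel hg, one_smul, meanGrad, ← integral_sub]
    · simp_rw [sub_smul]
    · refine integrable_of_bound (C := Cφ * ‖w‖ * Cφ)
        (measurable_smul_fun ((hφ k).inner measurable_const) ms) fun x => ?_
      rw [norm_smul]
      exact mul_le_mul ((norm_inner_le_norm _ _).trans (mul_le_mul_of_nonneg_right (h.2.2.1 k x)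
        (norm_nonneg _))) (h.2.1 θ x) (norm_nonneg _) (by positivity)
    · exact integrable_of_bound (measurable_smul_fun (measurable_Q θ) ms) (norm_Q_smul_score_le h hγ0 hγ1 θ)
  have isq : ∀ w, Integrable (fun x => (inner ℝ (φ k x) w - Q γ M pol k θ x) ^ 2)
      (visitation γ M pol k θ) := fun w =>
    integrable_of_bound (C := (Cφ * ‖w‖ + 1 / (1 - γ)) ^ 2) ((me w).pow_const 2) fun x => by
      rw [norm_pow]; exact pow_le_pow_left₀ (norm_nonneg _) (hb w x) 2
  rw [e1]
  refine (norm_integral_sq_le (measurable_smul_fun (me w) ms) (C := (Cφ * ‖w‖ + 1 / (1 - γ)) * Cφ)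
    fun x => ?_).trans ?_
  · rw [norm_smul]
    exact mul_le_mul (hb w x) (h.2.1 θ x) (norm_nonneg _) (hD0 w)
  have h2 := integral_approx_sq_le h hCφ hB hγ0 hγ1 hws θ k
  calc ∫ x, ‖(inner ℝ (φ k x) w - Q γ M pol k θ x) • score pol θ x‖ ^ 2 ∂(visitation γ M pol k θ)
      ≤ ∫ x, Cφ ^ 2 * (2 * Cφ ^ 2 * ‖w - ws‖ ^ 2 +
          2 * (inner ℝ (φ k x) ws - Q γ M pol k θ x) ^ 2) ∂(visitation γ M pol k θ) := by
        refine integral_mono (integrable_of_bound (C := ((Cφ * ‖w‖ + 1 / (1 - γ)) * Cφ) ^ 2)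
          ((measurable_smul_fun (me w) ms).norm.pow_const 2) fun x => ?_)
          (((integrable_const _).add ((isq ws).const_mul 2)).const_mul _) fun x => ?_
        · rw [norm_pow, norm_norm, norm_smul]
          exact pow_le_pow_left₀ (by positivity)
            (mul_le_mul (hb w x) (h.2.1 θ x) (norm_nonneg _) (hD0 w)) 2
        · simp only
          rw [norm_smul, mul_pow, Real.norm_eq_abs, sq_abs, mul_comm]
          refine mul_le_mul (pow_le_pow_left₀ (norm_nonneg _) (h.2.1 θ x) 2) ?_ (sq_nonneg _)
            (sq_nonneg _)
          have h3 : (inner ℝ (φ k x) (w - ws)) ^ 2 ≤ (Cφ * ‖w - ws‖) ^ 2 := by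
            rw [← sq_abs]
            exact pow_le_pow_left₀ (abs_nonneg _) ((abs_real_inner_le_norm _ _).trans
              (mul_le_mul_of_nonneg_right (h.2.2.1 k x) (norm_nonneg _))) 2
          have h4 : inner ℝ (φ k x) w = inner ℝ (φ k x) (w - ws) + inner ℝ (φ k x) ws := by
            rw [inner_sub_right]; ring
          rw [h4]
          nlinarith [sq_nonneg (inner ℝ (φ k x) (w - ws) -
            (inner ℝ (φ k x) ws - Q γ M pol k θ x))]
    _ = Cφ ^ 2 * (2 * Cφ ^ 2 * ‖w - ws‖ ^ 2 + 2 * ∫ x,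
          (inner ℝ (φ k x) ws - Q γ M pol k θ x) ^ 2 ∂(visitation γ M pol k θ)) := by
        rw [integral_const_mul, integral_add (integrable_const _) ((isq ws).const_mul 2),
          integral_const_mul (2 : ℝ), integral_const, probReal_univ, one_smul]
    _ ≤ _ := by gcongr

lemma norm_sum_smul_sq_le {E : Type*} [NormedAddCommGroup E] [NormedSpace ℝ E] {l : Vec K}
    (hl : l ∈ simplex K) (e : Fin K → E) : ‖∑ k, l k • e k‖ ^ 2 ≤ ∑ k, ‖e k‖ ^ 2 := by
  have h0 : 0 ≤ ∑ k, ‖e k‖ ^ 2 := Finset.sum_nonneg fun k _ => sq_nonneg _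
  have := norm_sum_smul_le hl (g := e) (C := Real.sqrt (∑ k, ‖e k‖ ^ 2)) fun k =>
    Real.le_sqrt_of_sq_le (Finset.single_le_sum (f := fun k => ‖e k‖ ^ 2)
      (fun k _ => sq_nonneg _) (Finset.mem_univ k))
  calc _ ≤ Real.sqrt (∑ k, ‖e k‖ ^ 2) ^ 2 := pow_le_pow_left₀ (norm_nonneg _) this 2
    _ = _ := Real.sq_sqrt h0

end Algorithm

/-! ### The Lyapunov function of the algorithm and its conditional decrease. -/

section Convergence

variable {K p q : ℕ} {S A : Type*} [MeasurableSpace S] [MeasurableSpace A]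
  {M : MultiTaskMDP K S A} {pol : PolicyClass p S A} {φ : Fin K → S × A → Vec q}
  {Cφ Lφ γ B lamA m ρ : ℝ}

/-- The scalarized objective `lᵀ J`. -/
noncomputable def weightedJ (γ : ℝ) (M : MultiTaskMDP K S A) (pol : PolicyClass p S A)
    (l : Vec K) (θ : Vec p) : ℝ :=
  ∑ k, l k * J γ M pol k θ

lemma measurable_weightedJ (h : SmoothBounded pol φ Cφ Lφ) (hγ0 : 0 ≤ γ) (hγ1 : γ < 1)
    (hCφ : 0 ≤ Cφ) (hLφ : 0 ≤ Lφ) (l : Vec K) : Measurable (weightedJ γ M pol l) := by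
  refine Finset.measurable_sum _ fun k _ => Measurable.const_mul ?_ _
  have hd : Differentiable ℝ (J γ M pol k) := fun θ =>
    (hasGradientAt_J h hγ0 hγ1 hCφ hLφ θ).differentiableAt
  exact hd.continuous.measurable

lemma weightedJ_nonneg (hγ0 : 0 ≤ γ) (hγ1 : γ < 1) {l : Vec K} (hl : l ∈ simplex K) (θ : Vec p) :
    0 ≤ weightedJ γ M pol l θ :=
  Finset.sum_nonneg fun k _ => mul_nonneg (hl.1 k) (J_mem_Icc hγ0 hγ1 θ).1

lemma weightedJ_le (hγ0 : 0 ≤ γ) (hγ1 : γ < 1) {l : Vec K} (hl : l ∈ simplex K) (θ : Vec p) :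
    weightedJ γ M pol l θ ≤ 1 / (1 - γ) := by
  calc weightedJ γ M pol l θ ≤ ∑ k, l k * (1 / (1 - γ)) := Finset.sum_le_sum fun k _ =>
        mul_le_mul_of_nonneg_left (J_mem_Icc hγ0 hγ1 θ).2 (hl.1 k)
    _ = 1 / (1 - γ) := by rw [← Finset.sum_mul, hl.2, one_mul]

lemma weightedJ_descent (h : SmoothBounded pol φ Cφ Lφ) (hγ0 : 0 ≤ γ) (hγ1 : γ < 1)
    (hCφ : 0 ≤ Cφ) (hLφ : 0 ≤ Lφ) {l : Vec K} (hl : l ∈ simplex K) (θ d : Vec p) :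
    weightedJ γ M pol l θ + inner ℝ (weightedGrad γ M pol l θ) d -
      gradLip γ M pol / 2 * ‖d‖ ^ 2 ≤ weightedJ γ M pol l (θ + d) := by
  have h1 : ∑ k, l k * (J γ M pol k θ + inner ℝ (gradient (J γ M pol k) θ) d -
      gradLip γ M pol / 2 * ‖d‖ ^ 2) ≤ weightedJ γ M pol l (θ + d) := by
    refine Finset.sum_le_sum fun k _ => mul_le_mul_of_nonneg_left ?_ (hl.1 k)
    have := (abs_le.1 (abs_sub_inner_gradient_le (f := J γ M pol k)
      (fun θ => (hasGradientAt_J h hγ0 hγ1 hCφ hLφ θ).differentiableAt)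
      (norm_gradient_sub_le_gradLip h hγ0 hγ1 hCφ hLφ k) θ d)).1
    linarith
  refine le_trans (le_of_eq ?_) h1
  simp only [mul_sub, mul_add, Finset.sum_sub_distrib, Finset.sum_add_distrib, weightedJ,
    weightedGrad, sum_inner, real_inner_smul_left]
  rw [← Finset.sum_mul, hl.2, one_mul]

/-- The Lyapunov function of the algorithm with comparison weights `l`. -/
noncomputable def potential (γ : ℝ) (M : MultiTaskMDP K S A) (pol : PolicyClass p S A)
    (par : Params) (l : Vec K) (x : State K p q) : ℝ :=
  1 / par.c * min (‖x.2.2 - l‖ ^ 2) 4 - 2 * (1 - γ) / par.β * weightedJ γ M pol l x.1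

lemma measurable_potential (h : SmoothBounded pol φ Cφ Lφ) (hγ0 : 0 ≤ γ) (hγ1 : γ < 1)
    (hCφ : 0 ≤ Cφ) (hLφ : 0 ≤ Lφ) (par : Params) (l : Vec K) :
    Measurable (potential (q := q) γ M pol par l) := by
  have h1 : Measurable fun x : State K p q => ‖x.2.2 - l‖ ^ 2 := by fun_prop
  have h2 : Measurable fun x : State K p q => weightedJ γ M pol l x.1 :=
    (measurable_weightedJ h hγ0 hγ1 hCφ hLφ l).comp measurable_fst
  exact ((h1.min measurable_const).const_mul _).sub (h2.const_mul _)

lemma potential_ge (hγ0 : 0 ≤ γ) (hγ1 : γ < 1) {par : Params} (hβ : 0 < par.β) (hc : 0 < par.c)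
    {l : Vec K} (hl : l ∈ simplex K) (x : State K p q) :
    -(2 / par.β) ≤ potential γ M pol par l x := by
  have hg : 0 < 1 - γ := by linarith
  have h1 : 0 ≤ 1 / par.c * min (‖x.2.2 - l‖ ^ 2) 4 := by positivity
  have h2 : 2 * (1 - γ) / par.β * weightedJ γ M pol l x.1 ≤
      2 * (1 - γ) / par.β * (1 / (1 - γ)) :=
    mul_le_mul_of_nonneg_left (weightedJ_le hγ0 hγ1 hl _) (by positivity)
  have h3 : 2 * (1 - γ) / par.β * (1 / (1 - γ)) = 2 / par.β := by field_simp
  unfold potential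
  linarith

lemma potential_le (hγ0 : 0 ≤ γ) (hγ1 : γ < 1) {par : Params} (hβ : 0 < par.β) (hc : 0 < par.c)
    {l : Vec K} (hl : l ∈ simplex K) (x : State K p q) :
    potential γ M pol par l x ≤ 1 / par.c * 4 := by
  have hg : 0 < 1 - γ := by linarith
  have h1 : 1 / par.c * min (‖x.2.2 - l‖ ^ 2) 4 ≤ 1 / par.c * 4 :=
    mul_le_mul_of_nonneg_left (min_le_right _ _) (by positivity)
  have h2 : 0 ≤ 2 * (1 - γ) / par.β * weightedJ γ M pol l x.1 :=
    mul_nonneg (by positivity) (weightedJ_nonneg hγ0 hγ1 hl _)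
  unfold potential
  linarith

/-- Taking the initial weights as comparison weights removes the distance term at time 0. -/
lemma potential_self_le (hγ0 : 0 ≤ γ) (hγ1 : γ < 1) {par : Params} (hβ : 0 < par.β)
    {l : Vec K} (hl : l ∈ simplex K) (θ : Vec p) (w : Fin K → Vec q) :
    potential γ M pol par l (θ, w, l) ≤ 0 := by
  have hg : 0 < 1 - γ := by linarith
  have h2 : 0 ≤ 2 * (1 - γ) / par.β * weightedJ γ M pol l θ :=
    mul_nonneg (by positivity) (weightedJ_nonneg hγ0 hγ1 hl _)
  simp only [potential, sub_self, norm_zero]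
  norm_num
  exact h2

/-- The truncation at 4 makes the potential bounded on all states, hence integrable. It changes
nothing on the simplex, where squared distances are at most 4. -/
lemma abs_potential_le (hγ0 : 0 ≤ γ) (hγ1 : γ < 1) {par : Params} (hβ : 0 < par.β) (hc : 0 < par.c)
    {l : Vec K} (hl : l ∈ simplex K) (x : State K p q) :
    ‖potential γ M pol par l x‖ ≤ 1 / par.c * 4 + 2 / par.β := by
  have h1 := potential_ge (M := M) (pol := pol) hγ0 hγ1 hβ hc hl x
  have h2 := potential_le (M := M) (pol := pol) hγ0 hγ1 hβ hc hl x
  have h3 : 0 < 1 / par.c := by positivity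
  have h4 : 0 < 2 / par.β := by positivity
  exact abs_le.2 ⟨by linarith, by linarith⟩

lemma gradEst_eq_average (θ : Vec p) (w : Fin K → Vec q) {N : ℕ} (b : Fin N → Fin K → S × A)
    (k : Fin K) : gradEst pol φ θ w b k =
      (1 / (N : ℝ)) • ∑ i, gradSample pol φ θ w k (b i) := rfl

lemma norm_gradEst_le (h : SmoothBounded pol φ Cφ Lφ) (hCφ : 0 ≤ Cφ) (hB : 0 ≤ B) (θ : Vec p)
    {w : Fin K → Vec q} (hw : ∀ k, ‖w k‖ ≤ B) {N : ℕ} (hN : 1 ≤ N) (b : Fin N → Fin K → S × A)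
    (k : Fin K) : ‖gradEst pol φ θ w b k‖ ≤ Cφ ^ 2 * B := by
  rw [gradEst_eq_average]
  exact norm_average_le (norm_gradSample_le h hCφ hB θ hw k) hN b

lemma measurable_gradEst_batch (h : SmoothBounded pol φ Cφ Lφ) (hφ : ∀ k, Measurable (φ k))
    (θ : Vec p) (w : Fin K → Vec q) (N : ℕ) (k : Fin K) :
    Measurable fun b : Fin N → Fin K → S × A => gradEst pol φ θ w b k :=
  measurable_gradEst h hφ measurable_const measurable_const measurable_id k

lemma integral_gradEst (h : SmoothBounded pol φ Cφ Lφ) (hφ : ∀ k, Measurable (φ k))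
    (hCφ : 0 ≤ Cφ) (hB : 0 ≤ B) (hγ0 : 0 ≤ γ) (hγ1 : γ < 1) (θ : Vec p) {w : Fin K → Vec q}
    (hw : ∀ k, ‖w k‖ ≤ B) {N : ℕ} (hN : 1 ≤ N) (k : Fin K) :
    ∫ b, gradEst pol φ θ w b k ∂(batchLaw γ M pol θ N) = meanGrad γ M pol φ θ k (w k) := by
  have := fun k => isProb_visitation M pol k hγ0 hγ1 θ
  rw [← integral_gradSample h hφ hγ0 hγ1 θ w k]
  simp only [gradEst_eq_average]
  exact integral_average (measurable_gradSample h hφ θ w k)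
    (norm_gradSample_le h hCφ hB θ hw k) hN

lemma integral_sum_smul_gradEst (h : SmoothBounded pol φ Cφ Lφ) (hφ : ∀ k, Measurable (φ k))
    (hCφ : 0 ≤ Cφ) (hB : 0 ≤ B) (hγ0 : 0 ≤ γ) (hγ1 : γ < 1) (θ : Vec p) {w : Fin K → Vec q}
    (hw : ∀ k, ‖w k‖ ≤ B) {N : ℕ} (hN : 1 ≤ N) (u : Vec K) :
    ∫ b, ∑ k, u k • gradEst pol φ θ w b k ∂(batchLaw γ M pol θ N) =
      ∑ k, u k • meanGrad γ M pol φ θ k (w k) := by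
  have := isProb_batchLaw (M := M) (pol := pol) hγ0 hγ1 θ N
  have hi : ∀ k, Integrable (fun b => u k • gradEst pol φ θ w b k) (batchLaw γ M pol θ N) :=
    fun k => (integrable_of_bound (measurable_gradEst_batch h hφ θ w N k) fun b =>
      norm_gradEst_le h hCφ hB θ hw hN b k).smul (u k)
  rw [integral_finsetSum _ fun k _ => hi k]
  simp_rw [integral_smul, integral_gradEst h hφ hCφ hB hγ0 hγ1 θ hw hN]

lemma integral_norm_sum_smul_gradEst_sq_le (h : SmoothBounded pol φ Cφ Lφ)
    (hφ : ∀ k, Measurable (φ k)) (hCφ : 0 ≤ Cφ) (hB : 0 ≤ B) (hγ0 : 0 ≤ γ) (hγ1 : γ < 1)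
    (θ : Vec p) {w : Fin K → Vec q} (hw : ∀ k, ‖w k‖ ≤ B) {N : ℕ} (hN : 1 ≤ N) {u : Vec K}
    (hu : u ∈ simplex K) :
    ∫ b, ‖∑ k, u k • gradEst pol φ θ w b k‖ ^ 2 ∂(batchLaw γ M pol θ N) ≤
      ‖∑ k, u k • meanGrad γ M pol φ θ k (w k)‖ ^ 2 + (Cφ ^ 2 * B) ^ 2 / N := by
  have := fun k => isProb_visitation M pol k hγ0 hγ1 θ
  have mX : ∀ k, Measurable (gradSample pol φ θ w k) := measurable_gradSample h hφ θ w
  have bX : ∀ k y, ‖gradSample pol φ θ w k y‖ ≤ Cφ ^ 2 * B := norm_gradSample_le h hCφ hB θ hw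
  have mY : Measurable fun y : Fin K → S × A => ∑ k, u k • gradSample pol φ θ w k y :=
    Finset.measurable_sum _ fun k _ => (mX k).const_smul (u k)
  have bY : ∀ y, ‖∑ k, u k • gradSample pol φ θ w k y‖ ≤ Cφ ^ 2 * B := fun y =>
    norm_sum_smul_le hu fun k => bX k y
  have eY : ∫ y, ∑ k, u k • gradSample pol φ θ w k y
      ∂(Measure.pi fun k => visitation γ M pol k θ) =
        ∑ k, u k • meanGrad γ M pol φ θ k (w k) := by
    have hi : ∀ k, Integrable (fun y => u k • gradSample pol φ θ w k y)
        (Measure.pi fun k => visitation γ M pol k θ) := fun k =>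
      (integrable_of_bound (mX k) (bX k)).smul (u k)
    rw [integral_finsetSum _ fun k _ => hi k]
    simp_rw [integral_smul, integral_gradSample h hφ hγ0 hγ1 θ w]
  rw [← eY]
  simp only [sum_smul_gradEst]
  unfold batchLaw
  exact integral_norm_average_sq_le (μ := Measure.pi fun k => visitation γ M pol k θ)
    (X := fun y => ∑ k, u k • gradSample pol φ θ w k y) mY bY hN

/-- The noise terms of one iteration that do not come from the critic. -/
noncomputable def samplingError (K : ℕ) (κ L σ : ℝ) (par : Params) : ℝ :=
  κ * L * par.β * σ ^ 2 / par.Nactor + par.c * K * σ ^ 4 / par.NFC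

lemma integral_potential_nextState_le_aux (h : SmoothBounded pol φ Cφ Lφ)
    (hφ : ∀ k, Measurable (φ k))
    (hCφ : 0 ≤ Cφ) (hLφ : 0 ≤ Lφ) (hB : 0 ≤ B) (hγ0 : 0 ≤ γ) (hγ1 : γ < 1) {par : Params}
    (hβ : 0 < par.β) (hβL : par.β * gradLip γ M pol ≤ 1) (hc : 0 < par.c)
    (hcσ : par.c * (K * (Cφ ^ 2 * B) ^ 2) ≤ 1 / 8) (hNa : 1 ≤ par.Nactor) (hNF : 1 ≤ par.NFC)
    {l : Vec K} (hl : l ∈ simplex K) {x : State K p q} (hx : x.2.2 ∈ simplex K)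
    {w : Fin K → Vec q} (hw : ∀ k, ‖w k‖ ≤ B) :
    ∫ b, potential γ M pol par l (nextState pol φ par x w b) ∂(batchesLaw γ M pol par x.1) +
        3 / 8 * ‖∑ k, x.2.2 k • meanGrad γ M pol φ x.1 k (w k)‖ ^ 2 ≤
      potential γ M pol par l x + samplingError K (1 - γ) (gradLip γ M pol) (Cφ ^ 2 * B) par +
        2 * ‖∑ k, l k • meanGrad γ M pol φ x.1 k (w k) -
          (1 - γ) • weightedGrad γ M pol l x.1‖ ^ 2 := by
  have hpb := fun N => isProb_batchLaw (M := M) (pol := pol) hγ0 hγ1 x.1 N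
  have mD : Measurable fun b : Fin par.Nactor → Fin K → S × A =>
      ∑ k, x.2.2 k • gradEst pol φ x.1 w b k := Finset.measurable_sum _ fun k _ =>
    (measurable_gradEst_batch h hφ x.1 w _ k).const_smul (x.2.2 k)
  have bD : ∀ b : Fin par.Nactor → Fin K → S × A,
      ‖∑ k, x.2.2 k • gradEst pol φ x.1 w b k‖ ≤ Cφ ^ 2 * B := fun b =>
    norm_sum_smul_le hx (norm_gradEst_le h hCφ hB x.1 hw hNa b)
  have hF : ∀ θ' : Vec p, |weightedJ γ M pol l θ'| ≤ 1 / (1 - γ) := fun θ' => by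
    rw [abs_of_nonneg (weightedJ_nonneg hγ0 hγ1 hl θ')]
    exact weightedJ_le hγ0 hγ1 hl θ'
  have key := one_step_descent
    (fun k => measurable_gradEst_batch (N := par.NFC) h hφ x.1 w k)
    (norm_gradEst_le h hCφ hB x.1 hw hNF) mD bD
    (integral_gradEst (M := M) h hφ hCφ hB hγ0 hγ1 x.1 hw hNF) hx hl rfl
    (integral_norm_sum_smul_gradEst_sq_le h hφ hCφ hB hγ0 hγ1 x.1 hw hNF hx)
    (integral_sum_smul_gradEst h hφ hCφ hB hγ0 hγ1 x.1 hw hNa x.2.2)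
    (integral_norm_sum_smul_gradEst_sq_le h hφ hCφ hB hγ0 hγ1 x.1 hw hNa hx)
    (measurable_weightedJ (M := M) h hγ0 hγ1 hCφ hLφ l) hF
    hβ hc (κ := 1 - γ) (by linarith) (by linarith) gradLip_nonneg hβL hcσ
    (weightedJ_descent h hγ0 hγ1 hCφ hLφ hl x.1)
  rw [samplingError, ← add_assoc]
  exact key

/-- The decrease is turned from the estimated direction v to the true one, g = λᵀ∇J: since (1 −
γ)²‖g‖² ≤ 2‖v‖² + 2‖v − (1 − γ)g‖², the coefficient 3/8 becomes 3/16 at the cost of 3/8 of a squared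
bias. Together with the 2 already present this gives 19/8. -/
lemma integral_potential_nextState_le (h : SmoothBounded pol φ Cφ Lφ) (hφ : ∀ k, Measurable (φ k))
    (hCφ : 0 ≤ Cφ) (hLφ : 0 ≤ Lφ) (hB : 0 ≤ B) (hγ0 : 0 ≤ γ) (hγ1 : γ < 1) {par : Params}
    (hβ : 0 < par.β) (hβL : par.β * gradLip γ M pol ≤ 1) (hc : 0 < par.c)
    (hcσ : par.c * (K * (Cφ ^ 2 * B) ^ 2) ≤ 1 / 8) (hNa : 1 ≤ par.Nactor) (hNF : 1 ≤ par.NFC)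
    {l : Vec K} (hl : l ∈ simplex K) {x : State K p q} (hx : x.2.2 ∈ simplex K)
    {w : Fin K → Vec q} (hw : ∀ k, ‖w k‖ ≤ B) :
    ∫ b, potential γ M pol par l (nextState pol φ par x w b) ∂(batchesLaw γ M pol par x.1) +
        3 / 16 * (1 - γ) ^ 2 * ‖weightedGrad γ M pol x.2.2 x.1‖ ^ 2 ≤
      potential γ M pol par l x + samplingError K (1 - γ) (gradLip γ M pol) (Cφ ^ 2 * B) par +
        19 / 8 * ∑ k, ‖gradError γ M pol φ x.1 k (w k)‖ ^ 2 := by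
  have key := integral_potential_nextState_le_aux (M := M) h hφ hCφ hLφ hB hγ0 hγ1 hβ hβL hc hcσ
    hNa hNF hl hx hw
  have hκ : 0 < 1 - γ := by linarith
  have he : ∀ v : Vec K, ∑ k, v k • meanGrad γ M pol φ x.1 k (w k) -
      (1 - γ) • weightedGrad γ M pol v x.1 = ∑ k, v k • gradError γ M pol φ x.1 k (w k) :=
    fun v => by
      simp only [weightedGrad, gradError, smul_sub, Finset.sum_sub_distrib, Finset.smul_sum,
        smul_comm (1 - γ)]
  have e1 := norm_sum_smul_sq_le hl fun k => gradError γ M pol φ x.1 k (w k)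
  have e2 := norm_sum_smul_sq_le hx fun k => gradError γ M pol φ x.1 k (w k)
  rw [← he] at e1 e2
  set v := ∑ k, x.2.2 k • meanGrad γ M pol φ x.1 k (w k)
  set g := weightedGrad γ M pol x.2.2 x.1
  have e3 : (1 - γ) ^ 2 * ‖g‖ ^ 2 ≤ 2 * ‖v‖ ^ 2 + 2 * ‖v - (1 - γ) • g‖ ^ 2 := by
    have h2 := norm_sub_le v (v - (1 - γ) • g)
    rw [sub_sub_cancel, norm_smul, Real.norm_of_nonneg hκ.le] at h2
    have h3 := pow_le_pow_left₀ (by positivity) h2 2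
    rw [mul_pow] at h3
    exact h3.trans (by nlinarith [sq_nonneg (‖v‖ - ‖v - (1 - γ) • g‖)])
  linarith

end Convergence

/-! ### Averaging over the critic, telescoping, and the final constant. -/

section Main

variable {K p q : ℕ} {S A : Type*} [MeasurableSpace S] [MeasurableSpace A]
  {M : MultiTaskMDP K S A} {pol : PolicyClass p S A} {φ : Fin K → S × A → Vec q}
  {Cφ Lφ γ B lamA m ρ : ℝ}

lemma ae_criticsLaw_norm_le (hγ0 : 0 ≤ γ) (hγ1 : γ < 1) (hB : 0 ≤ B) (hφ : ∀ k, Measurable (φ k))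
    (mode : CriticSampling) {N : ℕ} (hN : 1 ≤ N) (x : State K p q) :
    ∀ᵐ w ∂(criticsLaw γ B lamA M pol φ mode N x), ∀ k, ‖w k‖ ≤ B := by
  obtain ⟨n, rfl⟩ : ∃ n, N = n + 1 := ⟨N - 1, by omega⟩
  have := fun k => isProb_criticLaw_fst (M := M) (pol := pol) (lamA := lamA) hγ0 hγ1 hB hφ mode
    (n + 1) x.1 (x.2.1 k) k
  refine ae_all_iff.2 fun k => ?_
  refine (measurePreserving_eval (fun k => (criticLaw γ B lamA M pol φ mode k x.1 (x.2.1 k)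
    (n + 1)).map Prod.fst) k).quasiMeasurePreserving.ae (p := fun w : Vec q => ‖w‖ ≤ B) ?_
  exact (ae_map_iff measurable_fst.aemeasurable
    (measurableSet_le measurable_norm measurable_const)).2
    (ae_criticLaw_norm_le hγ0 hγ1 hB (hφ k) mode x.1 (x.2.1 k) n)

lemma integral_criticsLaw_sq_le (hγ0 : 0 ≤ γ) (hγ1 : γ < 1) (hCφ : 0 ≤ Cφ) (hB : 0 ≤ B)
    (hlam : 0 < lamA) (hm : 0 < m) (hρ0 : 0 < ρ) (hρ1 : ρ < 1) (hφm : ∀ k, Measurable (φ k))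
    (hφ : ∀ k x, ‖φ k x‖ ≤ Cφ) (mode : CriticSampling)
    (herg : mode = .trajectory → UniformlyErgodic γ M pol m ρ) (hsol : Solvable γ M pol φ lamA)
    (hws : ∀ k θ, ‖tdLimit γ M pol φ k θ‖ ≤ B) {N : ℕ} (hN : 1 ≤ N) (x : State K p q)
    (k : Fin K) :
    ∫ w, ‖w k - tdLimit γ M pol φ k x.1‖ ^ 2 ∂(criticsLaw γ B lamA M pol φ mode N x) ≤
      criticConst Cφ B lamA m ρ / Real.sqrt N := by
  have := fun k => isProb_criticLaw_fst (M := M) (pol := pol) (lamA := lamA) hγ0 hγ1 hB hφm mode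
    N x.1 (x.2.1 k) k
  have hf : Measurable fun w : Vec q => ‖w - tdLimit γ M pol φ k x.1‖ ^ 2 := by fun_prop
  rw [criticsLaw, integral_pi_eval (μ := fun k => (criticLaw γ B lamA M pol φ mode k x.1
    (x.2.1 k) N).map Prod.fst) k hf, integral_map measurable_fst.aemeasurable
    hf.aestronglyMeasurable]
  exact critic_error hγ0 hγ1 hCφ hB hlam hm hρ0 hρ1 (hφm k) (hφ k) mode herg hsol x.1 (hws k x.1)
    (x.2.1 k) hN

/-- The error of one iteration caused by the critic. -/
noncomputable def approximationError (K : ℕ) (γ Cφ B cc ε : ℝ) (N : ℕ) : ℝ :=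
  19 / 8 * (K * (Cφ ^ 2 * (2 * Cφ ^ 2 * (cc / Real.sqrt N) +
    2 * ((Cφ * B + 1 / (1 - γ)) * ε))))

/-- The batches are drawn after the critic, so the conditional bound can be integrated over w. Only
E‖w^k − w*‖² for each task survives, and each marginal of the product law is one critic loop. -/
lemma integral_potential_iterLaw_le (h : SmoothBounded pol φ Cφ Lφ) (hφ : ∀ k, Measurable (φ k))
    (hCφ : 0 ≤ Cφ) (hLφ : 0 ≤ Lφ) (hB : 0 ≤ B) (hγ0 : 0 ≤ γ) (hγ1 : γ < 1)
    (hlam : 0 < lamA) (hm : 0 < m) (hρ0 : 0 < ρ) (hρ1 : ρ < 1) (mode : CriticSampling)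
    (herg : mode = .trajectory → UniformlyErgodic γ M pol m ρ) (hsol : Solvable γ M pol φ lamA)
    (hws : ∀ k θ, ‖tdLimit γ M pol φ k θ‖ ≤ B) {par : Params}
    (hβ : 0 < par.β) (hβL : par.β * gradLip γ M pol ≤ 1) (hc : 0 < par.c)
    (hcσ : par.c * (K * (Cφ ^ 2 * B) ^ 2) ≤ 1 / 8) (hNc : 1 ≤ par.Ncritic) (hNa : 1 ≤ par.Nactor)
    (hNF : 1 ≤ par.NFC) {l : Vec K} (hl : l ∈ simplex K) {x : State K p q}
    (hx : x.2.2 ∈ simplex K) :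
    ∫ y, potential γ M pol par l y ∂(iterLaw γ B lamA M pol φ mode par x) +
        3 / 16 * (1 - γ) ^ 2 * ‖weightedGrad γ M pol x.2.2 x.1‖ ^ 2 ≤
      potential γ M pol par l x + (samplingError K (1 - γ) (gradLip γ M pol) (Cφ ^ 2 * B) par +
        approximationError K γ Cφ B (criticConst Cφ B lamA m ρ) (epsApp γ M pol φ)
          par.Ncritic) := by
  set μ := criticsLaw γ B lamA M pol φ mode par.Ncritic x with hμ
  have hpμ : IsProbabilityMeasure μ := isProb_criticsLaw hγ0 hγ1 hB hφ mode par.Ncritic x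
  have hpb := isProb_batchesLaw (M := M) (pol := pol) hγ0 hγ1 par x.1
  have hball := ae_criticsLaw_norm_le (M := M) (pol := pol) (lamA := lamA) hγ0 hγ1 hB hφ mode hNc x
  have mΨ := measurable_potential (M := M) (q := q) h hγ0 hγ1 hCφ hLφ par l
  have bΨ := abs_potential_le (M := M) (pol := pol) (q := q) hγ0 hγ1 hβ hc hl
  have hstep : Measurable fun w => (batchesLaw γ M pol par x.1).map (nextState pol φ par x w) :=
    (measurable_stepKernel h hφ hγ0 hγ1 hl par).comp (f := fun w => (x, w)) (by fun_prop)
  have hsp := isProb_stepKernel (M := M) h hφ hγ0 hγ1 hl par x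
  set W : (Fin K → Vec q) → ℝ := fun w =>
    ∫ y, potential γ M pol par l y ∂((batchesLaw γ M pol par x.1).map (nextState pol φ par x w))
    with hW
  have iW : Integrable W μ := integrable_of_bound
    (measurable_integral_param hstep hsp (mΨ.comp measurable_snd))
    fun w => norm_integral_le_bound bΨ
  have eW : ∀ w, W w =
      ∫ b, potential γ M pol par l (nextState pol φ par x w b) ∂(batchesLaw γ M pol par x.1) :=
    fun w => integral_map ((measurable_nextState h hφ hl par).comp
      (f := fun b => ((x, w), b)) (by fun_prop)).aemeasurable mΨ.aestronglyMeasurable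
  rw [iterLaw_eq, ← hμ, integral_bind_of_bound hstep hsp mΨ bΨ]
  set ws := fun k => tdLimit γ M pol φ k x.1 with hwsdef
  set E := (Cφ * B + 1 / (1 - γ)) * epsApp γ M pol φ with hE
  set a := potential γ M pol par l x + samplingError K (1 - γ) (gradLip γ M pol) (Cφ ^ 2 * B) par -
    3 / 16 * (1 - γ) ^ 2 * ‖weightedGrad γ M pol x.2.2 x.1‖ ^ 2 with ha
  have isq : ∀ k, Integrable (fun w : Fin K → Vec q => ‖w k - ws k‖ ^ 2) μ := fun k => by
    have hms : Measurable fun w : Fin K → Vec q => ‖w k - ws k‖ ^ 2 := by fun_prop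
    refine Integrable.of_bound hms.aestronglyMeasurable (4 * B ^ 2) ?_
    filter_upwards [hball] with w hw
    rw [Real.norm_of_nonneg (by positivity)]
    exact norm_ball_sub_sq_le (hw k) (hws k x.1)
  have ik : ∀ k, Integrable (fun w : Fin K → Vec q =>
      Cφ ^ 2 * (2 * Cφ ^ 2 * ‖w k - ws k‖ ^ 2 + 2 * E)) μ := fun k =>
    (((isq k).const_mul _).add (integrable_const _)).const_mul _
  have h1 : ∫ w, W w ∂μ ≤ ∫ w, (a + 19 / 8 * ∑ k, Cφ ^ 2 * (2 * Cφ ^ 2 * ‖w k - ws k‖ ^ 2 +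
      2 * E)) ∂μ := by
    refine integral_mono_ae iW ((integrable_const a).add
      ((integrable_finsetSum _ fun k _ => ik k).const_mul _)) ?_
    filter_upwards [hball] with w hw
    have h2 := integral_potential_nextState_le (M := M) h hφ hCφ hLφ hB hγ0 hγ1 hβ hβL hc hcσ
      hNa hNF hl hx hw
    rw [← eW] at h2
    have h3 : ∑ k, ‖gradError γ M pol φ x.1 k (w k)‖ ^ 2 ≤
        ∑ k, Cφ ^ 2 * (2 * Cφ ^ 2 * ‖w k - ws k‖ ^ 2 + 2 * E) := Finset.sum_le_sum fun k _ =>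
      norm_gradError_sq_le h hφ hCφ hLφ hB hγ0 hγ1 hws x.1 k (w k)
    linarith
  rw [integral_add (integrable_const a) ((integrable_finsetSum _ fun k _ => ik k).const_mul _),
    integral_const, probReal_univ, one_smul, integral_const_mul,
    integral_finsetSum _ fun k _ => ik k] at h1
  have h4 : ∑ k, ∫ w, Cφ ^ 2 * (2 * Cφ ^ 2 * ‖w k - ws k‖ ^ 2 + 2 * E) ∂μ ≤
      ∑ _k : Fin K, Cφ ^ 2 * (2 * Cφ ^ 2 * (criticConst Cφ B lamA m ρ / Real.sqrt par.Ncritic) +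
        2 * E) := by
    refine Finset.sum_le_sum fun k _ => ?_
    rw [integral_const_mul, integral_add ((isq k).const_mul _) (integrable_const _),
      integral_const_mul, integral_const, probReal_univ, one_smul]
    have := integral_criticsLaw_sq_le hγ0 hγ1 hCφ hB hlam hm hρ0 hρ1 hφ h.2.2.1 mode herg hsol hws
      hNc x k
    gcongr
  rw [Finset.sum_const, Finset.card_univ, Fintype.card_fin, nsmul_eq_mul] at h4
  rw [approximationError]
  linarith

lemma norm_weightedGrad_le (h : SmoothBounded pol φ Cφ Lφ) (hγ0 : 0 ≤ γ) (hγ1 : γ < 1)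
    (hCφ : 0 ≤ Cφ) (hLφ : 0 ≤ Lφ) {l : Vec K} (hl : l ∈ simplex K) (θ : Vec p) :
    ‖weightedGrad γ M pol l θ‖ ≤ 1 / (1 - γ) * (1 / (1 - γ) * Cφ) :=
  norm_sum_smul_le hl fun k => norm_gradient_J_le h hγ0 hγ1 hCφ hLφ k θ

/-- The selection `lstar` is arbitrary and may be nonmeasurable, but the minimal norm does not
depend on it. Testing the minimum at θ with the minimizer of θ' shows that this value is Lipschitz
in θ, so the expectations in the rate are meaningful. -/
lemma continuous_norm_minimal_weightedGrad (h : SmoothBounded pol φ Cφ Lφ) (hγ0 : 0 ≤ γ)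
    (hγ1 : γ < 1) (hCφ : 0 ≤ Cφ) (hLφ : 0 ≤ Lφ) {lstar : Vec p → Vec K}
    (hl : ∀ θ, lstar θ ∈ simplex K ∧ ∀ l ∈ simplex K,
      ‖weightedGrad γ M pol (lstar θ) θ‖ ^ 2 ≤ ‖weightedGrad γ M pol l θ‖ ^ 2) :
    Continuous fun θ => ‖weightedGrad γ M pol (lstar θ) θ‖ := by
  have hL := gradLip_nonneg (γ := γ) (M := M) (pol := pol)
  refine (LipschitzWith.of_le_add_mul (K := ⟨gradLip γ M pol, hL⟩) fun θ θ' => ?_).continuous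
  have h1 : ‖weightedGrad γ M pol (lstar θ) θ‖ ≤ ‖weightedGrad γ M pol (lstar θ') θ‖ :=
    (pow_le_pow_iff_left₀ (norm_nonneg _) (norm_nonneg _) two_ne_zero).1
      ((hl θ).2 _ (hl θ').1)
  have h2 : weightedGrad γ M pol (lstar θ') θ = weightedGrad γ M pol (lstar θ') θ' +
      ∑ k, lstar θ' k • (gradient (J γ M pol k) θ - gradient (J γ M pol k) θ') := by
    simp [weightedGrad, smul_sub, Finset.sum_sub_distrib]
  have h3 : ‖∑ k, lstar θ' k • (gradient (J γ M pol k) θ - gradient (J γ M pol k) θ')‖ ≤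
      gradLip γ M pol * ‖θ - θ'‖ :=
    norm_sum_smul_le (hl θ').1 fun k => norm_gradient_sub_le_gradLip h hγ0 hγ1 hCφ hLφ k θ θ'
  rw [dist_eq_norm]
  calc _ ≤ _ := h1
    _ ≤ _ := by rw [h2]; exact norm_add_le _ _
    _ ≤ _ := add_le_add_right h3 _

lemma integrable_minimal_weightedGrad (h : SmoothBounded pol φ Cφ Lφ) (hγ0 : 0 ≤ γ)
    (hγ1 : γ < 1) (hCφ : 0 ≤ Cφ) (hLφ : 0 ≤ Lφ) {lstar : Vec p → Vec K}
    (hl : ∀ θ, lstar θ ∈ simplex K ∧ ∀ l ∈ simplex K,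
      ‖weightedGrad γ M pol (lstar θ) θ‖ ^ 2 ≤ ‖weightedGrad γ M pol l θ‖ ^ 2)
    (ν : Measure (State K p q)) [IsFiniteMeasure ν] :
    Integrable (fun x => ‖weightedGrad γ M pol (lstar x.1) x.1‖ ^ 2) ν :=
  integrable_of_bound (C := (1 / (1 - γ) * (1 / (1 - γ) * Cφ)) ^ 2)
    (((continuous_norm_minimal_weightedGrad h hγ0 hγ1 hCφ hLφ hl).measurable.comp
      measurable_fst).pow_const 2) fun x => by
    rw [norm_pow, norm_norm]
    exact pow_le_pow_left₀ (norm_nonneg _) (norm_weightedGrad_le h hγ0 hγ1 hCφ hLφ (hl _).1 _) 2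

lemma sum_integral_minimal_weightedGrad_le (h : SmoothBounded pol φ Cφ Lφ)
    (hφ : ∀ k, Measurable (φ k))
    (hCφ : 0 ≤ Cφ) (hLφ : 0 ≤ Lφ) (hB : 0 ≤ B) (hγ0 : 0 ≤ γ) (hγ1 : γ < 1)
    (hlam : 0 < lamA) (hm : 0 < m) (hρ0 : 0 < ρ) (hρ1 : ρ < 1) (mode : CriticSampling)
    (herg : mode = .trajectory → UniformlyErgodic γ M pol m ρ) (hsol : Solvable γ M pol φ lamA)
    (hws : ∀ k θ, ‖tdLimit γ M pol φ k θ‖ ≤ B) {par : Params}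
    (hβ : 0 < par.β) (hβL : par.β * gradLip γ M pol ≤ 1) (hc : 0 < par.c)
    (hcσ : par.c * (K * (Cφ ^ 2 * B) ^ 2) ≤ 1 / 8) (hNc : 1 ≤ par.Ncritic) (hNa : 1 ≤ par.Nactor)
    (hNF : 1 ≤ par.NFC) {lstar : Vec p → Vec K}
    (hl : ∀ θ, lstar θ ∈ simplex K ∧ ∀ l ∈ simplex K,
      ‖weightedGrad γ M pol (lstar θ) θ‖ ^ 2 ≤ ‖weightedGrad γ M pol l θ‖ ^ 2)
    {l₀ : Vec K} (hl₀ : l₀ ∈ simplex K) (θ₀ : Vec p) (w₀ : Fin K → Vec q) (T : ℕ) :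
    3 / 16 * (1 - γ) ^ 2 * ∑ t ∈ Finset.range T,
        ∫ x, ‖weightedGrad γ M pol (lstar x.1) x.1‖ ^ 2
          ∂(runLaw γ B lamA M pol φ mode par (θ₀, w₀, l₀) t) ≤
      2 / par.β + T * (samplingError K (1 - γ) (gradLip γ M pol) (Cφ ^ 2 * B) par +
        approximationError K γ Cφ B (criticConst Cφ B lamA m ρ) (epsApp γ M pol φ)
          par.Ncritic) := by
  set R := samplingError K (1 - γ) (gradLip γ M pol) (Cφ ^ 2 * B) par +
        approximationError K γ Cφ B (criticConst Cφ B lamA m ρ) (epsApp γ M pol φ) par.Ncritic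
  set ν := runLaw γ B lamA M pol φ mode par (θ₀, w₀, l₀) with hν
  have hpν : ∀ t, IsProbabilityMeasure (ν t) := fun t =>
    isProb_runLaw h hφ hγ0 hγ1 hB hl₀ mode par _ t
  have mΨ := measurable_potential (M := M) (q := q) h hγ0 hγ1 hCφ hLφ par l₀
  have bΨ := abs_potential_le (M := M) (pol := pol) (q := q) hγ0 hγ1 hβ hc hl₀
  have mit := measurable_iterLaw (M := M) (lamA := lamA) h hφ hγ0 hγ1 hB hl₀ mode par
  have pit := isProb_iterLaw (M := M) (lamA := lamA) h hφ hγ0 hγ1 hB hl₀ mode par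
  have iΨ : ∀ t, Integrable (potential γ M pol par l₀) (ν t) := fun t => integrable_of_bound mΨ bΨ
  have iG := fun t => integrable_minimal_weightedGrad (q := q) h hγ0 hγ1 hCφ hLφ hl (ν t)
  have hstep : ∀ t, ∫ x, potential γ M pol par l₀ x ∂(ν (t + 1)) + 3 / 16 * (1 - γ) ^ 2 *
      ∫ x, ‖weightedGrad γ M pol (lstar x.1) x.1‖ ^ 2 ∂(ν t) ≤
      ∫ x, potential γ M pol par l₀ x ∂(ν t) + R := fun t => by
    have e1 : ν (t + 1) = (ν t).bind (iterLaw γ B lamA M pol φ mode par) := rfl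
    have iI : Integrable (fun x => ∫ y, potential γ M pol par l₀ y
        ∂(iterLaw γ B lamA M pol φ mode par x)) (ν t) := integrable_of_bound
      (measurable_integral_param mit pit (mΨ.comp measurable_snd))
      fun w => norm_integral_le_bound bΨ
    rw [e1, integral_bind_of_bound mit pit mΨ bΨ, ← integral_const_mul,
      ← integral_add iI ((iG t).const_mul _)]
    calc _ ≤ ∫ x, (potential γ M pol par l₀ x + R) ∂(ν t) := by
          refine integral_mono_ae (iI.add ((iG t).const_mul _))
            ((iΨ t).add (integrable_const R)) ?_
          filter_upwards [ae_runLaw_simplex (M := M) (lamA := lamA) h hφ hγ0 hγ1 hB mode par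
            (x₀ := (θ₀, w₀, l₀)) hl₀ t] with x hx
          have h1 := integral_potential_iterLaw_le h hφ hCφ hLφ hB hγ0 hγ1 hlam hm hρ0 hρ1 mode
            herg hsol hws hβ hβL hc hcσ hNc hNa hNF hl₀ hx
          -- The only use of minimality in the descent: the current weights compete with the
          -- minimizer at the same θ.
          have h2 := mul_le_mul_of_nonneg_left ((hl x.1).2 _ hx)
            (by positivity : 0 ≤ 3 / 16 * (1 - γ) ^ 2)
          linarith
      _ = _ := by
          rw [integral_add (iΨ t) (integrable_const R), integral_const, probReal_univ, one_smul]
  have hind : ∀ n : ℕ, ∫ x, potential γ M pol par l₀ x ∂(ν n) + 3 / 16 * (1 - γ) ^ 2 *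
      ∑ t ∈ Finset.range n, ∫ x, ‖weightedGrad γ M pol (lstar x.1) x.1‖ ^ 2 ∂(ν t) ≤ n * R := by
    intro n
    induction n with
    | zero =>
      have e0 : ∫ x, potential γ M pol par l₀ x ∂(ν 0) =
          potential γ M pol par l₀ (θ₀, w₀, l₀) :=
        integral_dirac' _ _ mΨ.stronglyMeasurable
      rw [e0]
      simpa using potential_self_le hγ0 hγ1 hβ hl₀ θ₀ w₀
    | succ n ih =>
      rw [Finset.sum_range_succ, mul_add]
      push_cast
      linarith [hstep n]
  have hlow : -(2 / par.β) ≤ ∫ x, potential γ M pol par l₀ x ∂(ν T) := by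
    have := integral_mono (integrable_const (μ := ν T) (-(2 / par.β))) (iΨ T) fun x =>
      potential_ge (M := M) (pol := pol) hγ0 hγ1 hβ hc hl₀ x
    rwa [integral_const, probReal_univ, one_smul] at this
  linarith [hind T]

lemma criticConst_nonneg (hCφ : 0 ≤ Cφ) (hB : 0 ≤ B) (hlam : 0 < lamA) (hm : 0 < m)
    (hρ0 : 0 < ρ) (hρ1 : ρ < 1) : 0 ≤ criticConst Cφ B lamA m ρ := by
  have h1 : 0 < 1 - ρ := by linarith
  have h2 := criticStepConst_nonneg (lamA := lamA) hCφ hB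
    (Lu := 2 * ((1 + 2 * Cφ * B) * Cφ + 4 * B * Cφ ^ 2) * ((1 + 2 * m / ρ) / (1 - ρ)))
    (by positivity)
  unfold criticConst
  positivity

/-- The constant in the convergence rate. -/
noncomputable def rateConst (K : ℕ) (γ Cφ Lφ B lamA m ρ : ℝ) : ℝ :=
  16 / (3 * (1 - γ) ^ 2) * (2 + (1 - γ) * (6 * remainderConst γ Cφ Lφ) * (Cφ ^ 2 * B) ^ 2 +
    K * (Cφ ^ 2 * B) ^ 4 + 19 / 4 * K * Cφ ^ 4 * criticConst Cφ B lamA m ρ +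
    19 / 4 * K * Cφ ^ 2 * (Cφ * B + 1 / (1 - γ)))

lemma rateConst_pos (hγ1 : γ < 1) (hCφ : 0 ≤ Cφ) (hLφ : 0 ≤ Lφ) (hB : 0 ≤ B) (hlam : 0 < lamA)
    (hm : 0 < m) (hρ0 : 0 < ρ) (hρ1 : ρ < 1) : 0 < rateConst K γ Cφ Lφ B lamA m ρ := by
  have h1 : 0 < 1 - γ := by linarith
  have h2 := criticConst_nonneg hCφ hB hlam hm hρ0 hρ1
  have h3 := remainderConst_nonneg (Cφ := Cφ) hγ1 hLφ
  unfold rateConst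
  positivity

/-- Merges the separate constants into one. The extra y stands for 1/(cT), which the telescoping
does not produce and which only enlarges the right side. -/
lemma sum_mul_le_sum_mul_sum {a₁ a₂ a₃ a₄ a₅ x₁ x₂ x₃ x₄ x₅ y : ℝ} (ha₁ : 0 ≤ a₁) (ha₂ : 0 ≤ a₂)
    (ha₃ : 0 ≤ a₃) (ha₄ : 0 ≤ a₄) (ha₅ : 0 ≤ a₅) (hx₁ : 0 ≤ x₁) (hx₂ : 0 ≤ x₂) (hx₃ : 0 ≤ x₃)
    (hx₄ : 0 ≤ x₄) (hx₅ : 0 ≤ x₅) (hy : 0 ≤ y) :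
    a₁ * x₁ + a₂ * x₂ + a₃ * x₃ + a₄ * x₄ + a₅ * x₅ ≤
      (a₁ + a₂ + a₃ + a₄ + a₅) * (x₁ + y + x₅ + x₄ + x₂ + x₃) := by
  set s := a₁ + a₂ + a₃ + a₄ + a₅ with hs
  have h1 := mul_le_mul_of_nonneg_right (by linarith : a₁ ≤ s) hx₁
  have h2 := mul_le_mul_of_nonneg_right (by linarith : a₂ ≤ s) hx₂
  have h3 := mul_le_mul_of_nonneg_right (by linarith : a₃ ≤ s) hx₃
  have h4 := mul_le_mul_of_nonneg_right (by linarith : a₄ ≤ s) hx₄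
  have h5 := mul_le_mul_of_nonneg_right (by linarith : a₅ ≤ s) hx₅
  have h6 : 0 ≤ s * y := mul_nonneg (by linarith) hy
  linarith

lemma epsApp_nonneg : 0 ≤ epsApp γ M pol φ := Real.iSup_nonneg fun _ => Real.sqrt_nonneg _

/-- A point of the simplex forces K > 0, because an empty sum is not 1; otherwise the quotient would
be a division by zero. -/
lemma weight_step_bound (hCφ : 0 < Cφ) (hB : 0 < B) {l : Vec K} (hl : l ∈ simplex K) {c : ℝ}
    (hc : c ≤ 1 / (8 * K * Cφ ^ 4 * B ^ 2)) : c * (K * (Cφ ^ 2 * B) ^ 2) ≤ 1 / 8 := by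
  have hK : (0 : ℝ) < K := by
    rcases Nat.eq_zero_or_pos K with rfl | h
    · simpa using hl.2
    · exact_mod_cast h
  calc c * (K * (Cφ ^ 2 * B) ^ 2) ≤ 1 / (8 * K * Cφ ^ 4 * B ^ 2) * (K * (Cφ ^ 2 * B) ^ 2) := by
        gcongr
    _ = 1 / 8 := by field_simp

lemma average_minimal_weightedGrad_le (h : SmoothBounded pol φ Cφ Lφ)
    (hφ : ∀ k, Measurable (φ k))
    (hCφ : 0 ≤ Cφ) (hLφ : 0 ≤ Lφ) (hB : 0 ≤ B) (hγ0 : 0 ≤ γ) (hγ1 : γ < 1)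
    (hlam : 0 < lamA) (hm : 0 < m) (hρ0 : 0 < ρ) (hρ1 : ρ < 1) (mode : CriticSampling)
    (herg : mode = .trajectory → UniformlyErgodic γ M pol m ρ) (hsol : Solvable γ M pol φ lamA)
    (hws : ∀ k θ, ‖tdLimit γ M pol φ k θ‖ ≤ B) {par : Params}
    (hβ : 0 < par.β) (hβL : par.β * gradLip γ M pol ≤ 1) (hc : 0 < par.c)
    (hcσ : par.c * (K * (Cφ ^ 2 * B) ^ 2) ≤ 1 / 8) (hNc : 1 ≤ par.Ncritic) (hNa : 1 ≤ par.Nactor)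
    (hNF : 1 ≤ par.NFC) {lstar : Vec p → Vec K}
    (hl : ∀ θ, lstar θ ∈ simplex K ∧ ∀ l ∈ simplex K,
      ‖weightedGrad γ M pol (lstar θ) θ‖ ^ 2 ≤ ‖weightedGrad γ M pol l θ‖ ^ 2)
    {l₀ : Vec K} (hl₀ : l₀ ∈ simplex K) (θ₀ : Vec p) (w₀ : Fin K → Vec q) {T : ℕ} (hT : 1 ≤ T) :
    (1 / (T : ℝ)) * ∑ t ∈ Finset.range T, ∫ x, ‖weightedGrad γ M pol (lstar x.1) x.1‖ ^ 2
        ∂(runLaw γ B lamA M pol φ mode par (θ₀, w₀, l₀) t) ≤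
      rateConst K γ Cφ Lφ B lamA m ρ * (1 / (par.β * T) + 1 / (par.c * T) + epsApp γ M pol φ +
        1 / Real.sqrt par.Ncritic + par.β / par.Nactor + par.c / par.NFC) := by
  have key := sum_integral_minimal_weightedGrad_le h hφ hCφ hLφ hB hγ0 hγ1 hlam hm hρ0 hρ1 mode
    herg hsol hws hβ hβL hc hcσ hNc hNa hNF hl hl₀ θ₀ w₀ T
  have hκ : 0 < 1 - γ := by linarith
  have hT' : (0 : ℝ) < T := by exact_mod_cast hT
  have hcc := criticConst_nonneg hCφ hB hlam hm hρ0 hρ1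
  have hrc := remainderConst_nonneg (Cφ := Cφ) hγ1 hLφ
  have hL := gradLip_le (M := M) h hγ0 hγ1 hCφ hLφ
  set G := ∑ t ∈ Finset.range T, ∫ x, ‖weightedGrad γ M pol (lstar x.1) x.1‖ ^ 2
        ∂(runLaw γ B lamA M pol φ mode par (θ₀, w₀, l₀) t)
  set κ := 1 - γ
  set cc := criticConst Cφ B lamA m ρ
  set rc := remainderConst γ Cφ Lφ
  set ε := epsApp γ M pol φ
  have hε : 0 ≤ ε := epsApp_nonneg
  set s := samplingError K κ (gradLip γ M pol) (Cφ ^ 2 * B) par with hs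
  set e := approximationError K γ Cφ B cc ε par.Ncritic with he
  have h1 : (1 / (T : ℝ)) * G ≤ 16 / (3 * κ ^ 2) * (2 * (1 / (par.β * T)) + s + e) := by
    have : (1 / (T : ℝ)) * G = 16 / (3 * κ ^ 2) * (1 / T) * (3 / 16 * κ ^ 2 * G) := by
      field_simp
    rw [this]
    refine (mul_le_mul_of_nonneg_left key (by positivity)).trans (le_of_eq ?_)
    field_simp
    ring
  have h2 : s ≤ κ * (6 * rc) * (Cφ ^ 2 * B) ^ 2 * (par.β / par.Nactor) +
      K * (Cφ ^ 2 * B) ^ 4 * (par.c / par.NFC) := by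
    -- The instance-dependent `gradLip` is replaced by its explicit bound, so that the constant
    -- depends on the problem parameters alone.
    have h3 : κ * gradLip γ M pol * (Cφ ^ 2 * B) ^ 2 * (par.β / par.Nactor) ≤
        κ * (6 * rc) * (Cφ ^ 2 * B) ^ 2 * (par.β / par.Nactor) := by gcongr
    refine le_trans (le_of_eq ?_) (add_le_add_left h3 _)
    rw [hs, samplingError]
    ring
  have h3 : e = 19 / 4 * K * Cφ ^ 4 * cc * (1 / Real.sqrt par.Ncritic) +
      19 / 4 * K * Cφ ^ 2 * (Cφ * B + 1 / κ) * ε := by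
    rw [he, approximationError]
    ring
  have h4 := sum_mul_le_sum_mul_sum (a₁ := 2) (a₂ := κ * (6 * rc) * (Cφ ^ 2 * B) ^ 2)
    (a₃ := K * (Cφ ^ 2 * B) ^ 4) (a₄ := 19 / 4 * K * Cφ ^ 4 * cc)
    (a₅ := 19 / 4 * K * Cφ ^ 2 * (Cφ * B + 1 / κ)) (x₁ := 1 / (par.β * T))
    (x₂ := par.β / par.Nactor) (x₃ := par.c / par.NFC) (x₄ := 1 / Real.sqrt par.Ncritic) (x₅ := ε)
    (y := 1 / (par.c * T)) (by norm_num) (by positivity) (by positivity) (by positivity)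
    (by positivity) (by positivity) (by positivity) (by positivity) (by positivity) hε
    (by positivity)
  refine h1.trans ?_
  rw [rateConst, mul_assoc]
  refine mul_le_mul_of_nonneg_left ?_ (by positivity)
  linarith

end Main
end MTAC

theorem mainTheorem3 (K : ℕ) (γ Cφ Lφ B lamA m ρ : ℝ)
    (hγ0 : 0 ≤ γ) (hγ1 : γ < 1) (hCφ : 0 < Cφ) (hLφ : 0 < Lφ) (hB : 0 < B) (hlamA : 0 < lamA)
    (hm : 0 < m) (hρ0 : 0 < ρ) (hρ1 : ρ < 1) :
    ∃ C : ℝ, 0 < C ∧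
      ∀ (p q : ℕ) (S : Type*) (A : Type*) [MeasurableSpace S] [MeasurableSpace A]
        (M : MTAC.MultiTaskMDP K S A) (pol : MTAC.PolicyClass p S A)
        (φ : Fin K → S × A → MTAC.Vec q) (mode : MTAC.CriticSampling),
        (∀ k, Measurable (φ k)) →
        MTAC.SmoothBounded pol φ Cφ Lφ →
        (mode = .trajectory → MTAC.UniformlyErgodic γ M pol m ρ) →
        MTAC.Solvable γ M pol φ lamA →
        (∀ k θ, ‖MTAC.tdLimit γ M pol φ k θ‖ ≤ B) →
        (∀ k, Differentiable ℝ (MTAC.J γ M pol k)) ∧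
        (∃ L : ℝ, ∀ k θ θ', ‖gradient (MTAC.J γ M pol k) θ - gradient (MTAC.J γ M pol k) θ'‖
          ≤ L * ‖θ - θ'‖) ∧
        ∀ (par : MTAC.Params) (T : ℕ) (θ₀ : MTAC.Vec p) (w₀ : Fin K → MTAC.Vec q)
          (l₀ : MTAC.Vec K) (lstar : MTAC.Vec p → MTAC.Vec K),
          0 < par.β → par.β * MTAC.gradLip γ M pol ≤ 1 →
          0 < par.c → par.c ≤ 1 / (8 * K * Cφ ^ 4 * B ^ 2) →
          1 ≤ par.Ncritic → 1 ≤ par.Nactor → 1 ≤ par.NFC → 1 ≤ T →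
          l₀ ∈ MTAC.simplex K →
          (∀ θ, lstar θ ∈ MTAC.simplex K ∧ ∀ l ∈ MTAC.simplex K,
            ‖MTAC.weightedGrad γ M pol (lstar θ) θ‖ ^ 2 ≤ ‖MTAC.weightedGrad γ M pol l θ‖ ^ 2) →
          (∀ t, IsProbabilityMeasure
            (MTAC.runLaw γ B lamA M pol φ mode par (θ₀, w₀, l₀) t)) ∧
          (∀ t, Integrable (fun x => ‖MTAC.weightedGrad γ M pol (lstar x.1) x.1‖ ^ 2)
            (MTAC.runLaw γ B lamA M pol φ mode par (θ₀, w₀, l₀) t)) ∧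
          (1 / (T : ℝ)) * ∑ t ∈ Finset.range T,
              ∫ x, ‖MTAC.weightedGrad γ M pol (lstar x.1) x.1‖ ^ 2
                ∂(MTAC.runLaw γ B lamA M pol φ mode par (θ₀, w₀, l₀) t)
            ≤ C * (1 / (par.β * T) + 1 / (par.c * T) + MTAC.epsApp γ M pol φ
                + 1 / Real.sqrt par.Ncritic + par.β / par.Nactor + par.c / par.NFC) := by
  refine ⟨MTAC.rateConst K γ Cφ Lφ B lamA m ρ,
    MTAC.rateConst_pos hγ1 hCφ.le hLφ.le hB.le hlamA hm hρ0 hρ1, ?_⟩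
  intro p q S A _ _ M pol φ mode hφ h herg hsol hws
  refine ⟨fun k θ => (MTAC.hasGradientAt_J h hγ0 hγ1 hCφ.le hLφ.le θ).differentiableAt,
    ⟨6 * MTAC.remainderConst γ Cφ Lφ,
      MTAC.norm_gradient_J_sub_le h hγ0 hγ1 hCφ.le hLφ.le⟩, ?_⟩
  intro par T θ₀ w₀ l₀ lstar hβ hβL hc hcb hNc hNa hNF hT hl₀ hl
  have hprob : ∀ t, IsProbabilityMeasure
      (MTAC.runLaw γ B lamA M pol φ mode par (θ₀, w₀, l₀) t) :=
    MTAC.isProb_runLaw h hφ hγ0 hγ1 hB.le hl₀ mode par _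
  exact ⟨hprob,
    fun t => MTAC.integrable_minimal_weightedGrad h hγ0 hγ1 hCφ.le hLφ.le hl _,
    MTAC.average_minimal_weightedGrad_le h hφ hCφ.le hLφ.le hB.le hγ0 hγ1 hlamA hm hρ0 hρ1 mode
      herg hsol hws hβ hβL hc (MTAC.weight_step_bound hCφ hB hl₀ hcb) hNc hNa hNF hl hl₀ θ₀ w₀ hT⟩
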